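/- **Setting.** Let $k$ be an algebraically closed field, $\Lambda$ a basic finite dimensional $k$-algebra, $D\Lambda=\mathrm{Hom}_k(\Lambda,k)$ with its $\Lambda$-$\Lambda$-bimodule structure $(a'\varphi a'')(a)=\varphi(a''aa')$, and let $\widehat\Lambda$ be the repetitive algebra of $\Lambda$: the associative $k$-algebra (in general without identity) with underlying space $(\bigoplus_{i\in\mathbb Z}\Lambda)\oplus(\bigoplus_{i\in\mathbb Z}D\Lambda)$ and product $(a_i,\varphi_i)_i\cdot(b_i,\psi_i)_i=(a_ib_i,\;a_{i+1}\psi_i+\varphi_ib_i)_i$. Modules are left modules $M$ with $\widehat\Lambda M=M$, and $\widehat\Lambda$-mod is the category of those that are finite dimensional over $k$. For $\widehat V$ in $\widehat\Lambda$-mod, $\underline{\mathrm{End}}_{\widehat\Lambda}(\widehat V)$ is the quotient of $\mathrm{End}_{\widehat\Lambda}(\widehat V)$ by the ideal of the endomorphisms that factor through a finite dimensional projective module; $\Omega\widehat V$ is the kernel of a projective cover of $\widehat V$; and, for $\widehat V$ indecomposable and not projective, $\tau\widehat V$ is the Auslander–Reiten translate, i.e. the left-hand term of an almost split sequence $0\to\tau\widehat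 V\to\widehat E\to\widehat V\to0$ in $\widehat\Lambda$-mod. Let $\widehat{\mathcal C}$ be the category of complete local commutative Noetherian $k$-algebras with residue field $k$, with the continuous $k$-algebra homomorphisms inducing the identity on $k$. A *lift* of $\widehat V$ over $R\in\widehat{\mathcal C}$ is a pair $(\widehat M,\phi)$ of a finitely generated $R\otimes_k\widehat\Lambda$-module $\widehat M$, free of finite rank over $R$, and an isomorphism of $\widehat\Lambda$-modules $\phi:k\otimes_R\widehat M\to\widehat V$; lifts $(\widehat M,\phi)$, $(\widehat M',\phi')$ are isomorphic if there is an isomorphism $\alpha:\widehat M\to\widehat M'$ of $R\otimes_k\widehat\Lambda$-modules with $\phi'\circ(\mathrm{id}_k\otimes\alpha)=\phi$. Let $\widehat F_{\widehat V}(R)$ be the set of isomorphism classes of lifts (deformations) of $\widehat V$ over $R$, a covariant functor of $R$ by base change. A pair $(R,U)$ with $R\in\widehat{\mathcal C}$ and $U\in\widehat F_{\widehat V}(R)$ is *versal* if for every $S\in\widehat{\mathcal C}$ the map $\mathrm{Hom}_{\widehat{\mathcal C}}(R,S)\to\widehat F_{\widehat V}(S)$, $\theta\mapsto\widehat F_{\widehat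 V}(\theta)(U)$, is surjective, and it is bijective for $S=k[\epsilon]$, $\epsilon^2=0$; it is *universal* if this map is bijective for every $S$. If $(R,U)$ is versal, then $R=R(\widehat\Lambda,\widehat V)$ is called a versal deformation ring of $\widehat V$. **Theorem.** Let $\widehat V$ be a $\widehat\Lambda$-module of finite dimension over $k$. Then $\widehat V$ has a versal deformation ring $R(\widehat\Lambda,\widehat V)$, and it is unique up to isomorphism of $k$-algebras. Assume further that $\underline{\mathrm{End}}_{\widehat\Lambda}(\widehat V)\cong k$. Then: (i) every versal pair of $\widehat V$ is universal, and for every finite dimensional projective $\widehat\Lambda$-module $\widehat P$ every versal pair of $\widehat V\oplus\widehat P$ is universal and $R(\widehat\Lambda,\widehat V\oplus\widehat P)\cong R(\widehat\Lambda,\widehat V)$; (ii) $\Omega\widehat V$ exists, every versal pair of $\Omega\widehat V$ is universal, and $R(\widehat\Lambda,\Omega\widehat V)\cong R(\widehat\Lambda,\widehat V)$; (iii) if $\widehat V$ is indecomposable, then $\tau\widehat V$ exists, every versal pair of $\tau\widehat V$ is universal, and $R(\widehat\Lambda,\tau\widehat V)\cong R(\widehat\Lambda,\widehat V)$. -/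

import Mathlib

open scoped TensorProduct

universe u v w

/-! ### Basic algebras and the repetitive algebra -/

/-- A finite dimensional algebra `Λ` over an algebraically closed field `k` is basic if
`Λ / rad Λ` is isomorphic, as a `k`-algebra, to a finite product of copies of `k`. -/
def IsBasicAlgebra (k : Type u) [Field k] (Λ : Type v) [Ring Λ] [Algebra k Λ] : Prop :=
  ∃ (n : ℕ) (f : Λ →ₐ[k] (Fin n → k)),
    Function.Surjective f ∧ RingHom.ker f = Ring.jacobson Λ

section Dual

variable {k : Type u} [Field k] {Λ : Type v} [Ring Λ] [Algebra k Λ]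

/-- The left action of `Λ` on `DΛ = Hom_k(Λ, k)`: `(a φ)(x) = φ (x a)`. -/
def dualLeft (a : Λ) (φ : Module.Dual k Λ) : Module.Dual k Λ :=
  φ ∘ₗ LinearMap.mulRight k a

/-- The right action of `Λ` on `DΛ = Hom_k(Λ, k)`: `(φ b)(x) = φ (b x)`. -/
def dualRight (φ : Module.Dual k Λ) (b : Λ) : Module.Dual k Λ :=
  φ ∘ₗ LinearMap.mulLeft k b

@[simp] lemma dualLeft_apply (a : Λ) (φ : Module.Dual k Λ) (x : Λ) :
    dualLeft a φ x = φ (x * a) := rfl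

@[simp] lemma dualRight_apply (φ : Module.Dual k Λ) (b x : Λ) :
    dualRight φ b x = φ (b * x) := rfl

end Dual

/-- The underlying space `(⨁_{i ∈ ℤ} Λ) ⊕ (⨁_{i ∈ ℤ} DΛ)` of the repetitive algebra of `Λ`. -/
def RepetitiveAlgebra (k : Type u) [Field k] (Λ : Type v) [Ring Λ] [Algebra k Λ] :
    Type (max u v) :=
  (ℤ →₀ Λ) × (ℤ →₀ Module.Dual k Λ)

namespace RepetitiveAlgebra

variable {k : Type u} [Field k] {Λ : Type v} [Ring Λ] [Algebra k Λ]

noncomputable instance : AddCommGroup (RepetitiveAlgebra k Λ) :=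
  inferInstanceAs (AddCommGroup ((ℤ →₀ Λ) × (ℤ →₀ Module.Dual k Λ)))

noncomputable instance : Module k (RepetitiveAlgebra k Λ) :=
  inferInstanceAs (Module k ((ℤ →₀ Λ) × (ℤ →₀ Module.Dual k Λ)))

/-- The component `a_i ∈ Λ` of an element `(a_i, φ_i)_i`. -/
def alg (x : RepetitiveAlgebra k Λ) (i : ℤ) : Λ := x.1 i

/-- The component `φ_i ∈ DΛ` of an element `(a_i, φ_i)_i`. -/
def dual (x : RepetitiveAlgebra k Λ) (i : ℤ) : Module.Dual k Λ := x.2 i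

@[ext] lemma ext {x y : RepetitiveAlgebra k Λ} (h₁ : ∀ i, x.alg i = y.alg i)
    (h₂ : ∀ i, x.dual i = y.dual i) : x = y :=
  Prod.ext (Finsupp.ext h₁) (Finsupp.ext h₂)

/-- The product `(a_i, φ_i)_i (b_i, ψ_i)_i = (a_i b_i, a_{i+1} ψ_i + φ_i b_i)_i`. -/
noncomputable instance : Mul (RepetitiveAlgebra k Λ) where
  mul x y :=
    (Finsupp.onFinset x.1.support (fun i => x.alg i * y.alg i) (by
      intro i h
      rw [Finsupp.mem_support_iff]
      intro h0
      exact h (by simp [alg, h0])),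
     Finsupp.onFinset (x.2.support ∪ y.2.support)
      (fun i => dualLeft (x.alg (i + 1)) (y.dual i) + dualRight (x.dual i) (y.alg i)) (by
      intro i h
      rw [Finset.mem_union, Finsupp.mem_support_iff, Finsupp.mem_support_iff]
      by_contra! h0
      refine h ?_
      ext z
      simp [dual, h0.1, h0.2]))

@[simp] lemma alg_mul (x y : RepetitiveAlgebra k Λ) (i : ℤ) :
    (x * y).alg i = x.alg i * y.alg i := rfl

@[simp] lemma dual_mul (x y : RepetitiveAlgebra k Λ) (i : ℤ) :
    (x * y).dual i = dualLeft (x.alg (i + 1)) (y.dual i) + dualRight (x.dual i) (y.alg i) := rfl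

@[simp] lemma alg_add (x y : RepetitiveAlgebra k Λ) (i : ℤ) :
    (x + y).alg i = x.alg i + y.alg i := rfl

@[simp] lemma dual_add (x y : RepetitiveAlgebra k Λ) (i : ℤ) :
    (x + y).dual i = x.dual i + y.dual i := rfl

@[simp] lemma alg_zero (i : ℤ) : (0 : RepetitiveAlgebra k Λ).alg i = 0 := rfl

@[simp] lemma dual_zero (i : ℤ) : (0 : RepetitiveAlgebra k Λ).dual i = 0 := rfl

/-- The repetitive algebra is an associative ring, in general without identity. -/
noncomputable instance : NonUnitalRing (RepetitiveAlgebra k Λ) where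
  left_distrib x y z := by
    ext i
    · simp [mul_add]
    · simp [add_mul]; abel
  right_distrib x y z := by
    ext i
    · simp [add_mul]
    · simp [mul_add]; abel
  zero_mul x := by ext i <;> simp
  mul_zero x := by ext i <;> simp
  mul_assoc x y z := by
    ext i
    · simp [mul_assoc]
    · simp [mul_assoc, add_assoc]

end RepetitiveAlgebra

/-! ### Modules over a possibly non-unital algebra -/

/-- For a `k`-algebra `A`, possibly without identity, and a commutative `k`-algebra `R`:
a left module `M` over `R ⊗_k A`, i.e. an `R`-module with a `k`-linear multiplicative action of
`A` by `R`-linear endomorphisms, which is unital in the sense that `A M = M`. -/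
structure NUModule (k : Type u) [Field k] (A : Type w) [NonUnitalRing A] [Module k A]
    (R : Type u) [CommRing R] [Algebra k R] where
  carrier : Type u
  [addCommGroup : AddCommGroup carrier]
  [module : Module R carrier]
  act : A →ₙ+* Module.End R carrier
  act_smul : ∀ (c : k) (a : A), act (c • a) = algebraMap k R c • act a
  unital : ∀ m : carrier, m ∈ Submodule.span R {x : carrier | ∃ (a : A) (y : carrier), act a y = x}

namespace NUModule

section General

variable {k : Type u} [Field k] {A : Type w} [NonUnitalRing A] [Module k A]
variable {R : Type u} [CommRing R] [Algebra k R]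

instance : CoeSort (NUModule k A R) (Type u) := ⟨NUModule.carrier⟩

instance (M : NUModule k A R) : AddCommGroup M := M.addCommGroup

instance (M : NUModule k A R) : Module R M := M.module

/-- An `R`-linear map is a homomorphism of `R ⊗_k A`-modules if it commutes with `A`. -/
def IsHom {M N : NUModule k A R} (f : M →ₗ[R] N) : Prop :=
  ∀ (a : A) (m : M), f (M.act a m) = N.act a (f m)

/-- The direct sum of two modules. -/
def prod (M N : NUModule k A R) : NUModule k A R where
  carrier := M × N
  act :=
    { toFun := fun a => (M.act a).prodMap (N.act a)
      map_mul' := fun a b => by ext <;> simp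
      map_zero' := by ext <;> simp
      map_add' := fun a b => by ext <;> simp }
  act_smul c a := by
    change (M.act (c • a)).prodMap (N.act (c • a)) = algebraMap k R c • (M.act a).prodMap (N.act a)
    rw [act_smul, act_smul]
    rfl
  unital := by
    rintro ⟨m, n⟩
    have h1 : LinearMap.inl R M N m ∈ Submodule.span R
        {x : M × N | ∃ (a : A) (y : M × N), (M.act a).prodMap (N.act a) y = x} := by
      have h := Submodule.mem_map_of_mem (f := LinearMap.inl R M N) (M.unital m)
      rw [Submodule.map_span] at h
      refine Submodule.span_mono ?_ h
      rintro _ ⟨_, ⟨a, y, rfl⟩, rfl⟩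
      exact ⟨a, (y, 0), by simp⟩
    have h2 : LinearMap.inr R M N n ∈ Submodule.span R
        {x : M × N | ∃ (a : A) (y : M × N), (M.act a).prodMap (N.act a) y = x} := by
      have h := Submodule.mem_map_of_mem (f := LinearMap.inr R M N) (N.unital n)
      rw [Submodule.map_span] at h
      refine Submodule.span_mono ?_ h
      rintro _ ⟨_, ⟨a, y, rfl⟩, rfl⟩
      exact ⟨a, (0, y), by simp⟩
    have h3 : LinearMap.inl R M N m + LinearMap.inr R M N n = (m, n) := by simp
    rw [← h3]
    exact Submodule.add_mem _ h1 h2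

variable {S : Type u} [CommRing S] [Algebra k S]

/-- The base change `S ⊗_{R,θ} M` along a morphism `θ : R → S` of commutative `k`-algebras. -/
noncomputable def baseChange (θ : R →ₐ[k] S) (M : NUModule k A R) : NUModule k A S :=
  letI : Algebra R S := θ.toRingHom.toAlgebra
  { carrier := S ⊗[R] M
    act :=
      { toFun := fun a => (M.act a).baseChange S
        map_mul' := fun a b => by
          rw [map_mul]; exact LinearMap.baseChange_mul _ _
        map_zero' := by rw [map_zero]; exact LinearMap.baseChange_zero
        map_add' := fun a b => by rw [map_add]; exact LinearMap.baseChange_add _ _ }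
    act_smul := fun c a => by
      refine LinearMap.ext fun x => ?_
      induction x using TensorProduct.induction_on with
      | zero => simp
      | add x y hx hy => rw [map_add, map_add, hx, hy]
      | tmul s m =>
        have h : algebraMap R S (algebraMap k R c) = algebraMap k S c := θ.commutes c
        change s ⊗ₜ[R] (M.act (c • a) m) = algebraMap k S c • (s ⊗ₜ[R] (M.act a m))
        rw [act_smul, LinearMap.smul_apply, TensorProduct.tmul_smul, ← algebraMap_smul S, h]
    unital := fun x => by
      induction x using TensorProduct.induction_on with
      | zero => exact Submodule.zero_mem _
      | add x y hx hy => exact Submodule.add_mem _ hx hy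
      | tmul s m =>
        have key : ((1 : S) ⊗ₜ[R] m) ∈ Submodule.span S
            {x : S ⊗[R] M | ∃ (a : A) (y : S ⊗[R] M), (M.act a).baseChange S y = x} := by
          induction M.unital m using Submodule.span_induction with
          | mem x hx =>
            obtain ⟨a, y, rfl⟩ := hx
            exact Submodule.subset_span ⟨a, 1 ⊗ₜ y, by simp⟩
          | zero => simp
          | add x y _ _ hx hy => rw [TensorProduct.tmul_add]; exact Submodule.add_mem _ hx hy
          | smul r x _ hx =>
            rw [TensorProduct.tmul_smul, ← algebraMap_smul S r]
            exact Submodule.smul_mem _ _ hx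
        have h := Submodule.smul_mem _ s key
        rwa [TensorProduct.smul_tmul', smul_eq_mul, mul_one] at h }

/-- The map `id_S ⊗ f : S ⊗_{R,θ} M → S ⊗_{R,θ} N` induced by `f : M → N`. -/
noncomputable def baseChangeMap (θ : R →ₐ[k] S) {M N : NUModule k A R} (f : M →ₗ[R] N) :
    M.baseChange θ →ₗ[S] N.baseChange θ :=
  letI : Algebra R S := θ.toRingHom.toAlgebra
  f.baseChange S

/-- The map `id_S ⊗ f` for an isomorphism `f : M → N`. -/
noncomputable def baseChangeEquiv (θ : R →ₐ[k] S) {M N : NUModule k A R} (f : M ≃ₗ[R] N) :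
    M.baseChange θ ≃ₗ[S] N.baseChange θ :=
  letI : Algebra R S := θ.toRingHom.toAlgebra
  f.baseChange R S M N

variable {T : Type u} [CommRing T] [Algebra k T]

/-- The natural isomorphism `T ⊗_S (S ⊗_R M) ≅ T ⊗_R M`, `t ⊗ (s ⊗ m) ↦ t s ⊗ m`, for a
composition `ρ = η ∘ θ : R → S → T`. -/
noncomputable def baseChangeTrans (θ : R →ₐ[k] S) (η : S →ₐ[k] T) (ρ : R →ₐ[k] T)
    (h : η.comp θ = ρ) (M : NUModule k A R) :
    (M.baseChange θ).baseChange η ≃ₗ[T] M.baseChange ρ :=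
  letI : Algebra R S := θ.toRingHom.toAlgebra
  letI : Algebra S T := η.toRingHom.toAlgebra
  letI : Algebra R T := ρ.toRingHom.toAlgebra
  haveI : IsScalarTower R S T := IsScalarTower.of_algebraMap_eq fun r =>
    (DFunLike.congr_fun h r).symm
  TensorProduct.AlgebraTensorModule.cancelBaseChange R S T T M

lemma baseChangeTrans_isHom (θ : R →ₐ[k] S) (η : S →ₐ[k] T) (ρ : R →ₐ[k] T)
    (h : η.comp θ = ρ) (M : NUModule k A R) :
    IsHom (baseChangeTrans θ η ρ h M).toLinearMap := by
  let : Algebra R S := θ.toRingHom.toAlgebra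
  let : Algebra S T := η.toRingHom.toAlgebra
  let : Algebra R T := ρ.toRingHom.toAlgebra
  have : IsScalarTower R S T := IsScalarTower.of_algebraMap_eq fun r =>
    (DFunLike.congr_fun h r).symm
  intro a x
  change TensorProduct.AlgebraTensorModule.cancelBaseChange R S T T M
      (((M.act a).baseChange S).baseChange T x) =
    (M.act a).baseChange T (TensorProduct.AlgebraTensorModule.cancelBaseChange R S T T M x)
  change T ⊗[S] (S ⊗[R] M) at x
  induction x using TensorProduct.induction_on with
  | zero => simp
  | add x y hx hy => simp only [map_add, hx, hy]
  | tmul t y =>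
    induction y using TensorProduct.induction_on with
    | zero => simp
    | add x y hx hy => simp only [TensorProduct.tmul_add, map_add, hx, hy]
    | tmul s m => simp

lemma baseChangeTrans_naturality (θ : R →ₐ[k] S) (η : S →ₐ[k] T) (ρ : R →ₐ[k] T)
    (h : η.comp θ = ρ) {M N : NUModule k A R} (f : M →ₗ[R] N)
    (x : (M.baseChange θ).baseChange η) :
    baseChangeTrans θ η ρ h N (baseChangeMap η (baseChangeMap θ f) x) =
      baseChangeMap ρ f (baseChangeTrans θ η ρ h M x) := by
  let : Algebra R S := θ.toRingHom.toAlgebra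
  let : Algebra S T := η.toRingHom.toAlgebra
  let : Algebra R T := ρ.toRingHom.toAlgebra
  have : IsScalarTower R S T := IsScalarTower.of_algebraMap_eq fun r =>
    (DFunLike.congr_fun h r).symm
  change TensorProduct.AlgebraTensorModule.cancelBaseChange R S T T N
      ((f.baseChange S).baseChange T x) =
    f.baseChange T (TensorProduct.AlgebraTensorModule.cancelBaseChange R S T T M x)
  change T ⊗[S] (S ⊗[R] M) at x
  induction x using TensorProduct.induction_on with
  | zero => simp
  | add x y hx hy => simp only [map_add, hx, hy]
  | tmul t y =>
    induction y using TensorProduct.induction_on with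
    | zero => simp
    | add x y hx hy => simp only [TensorProduct.tmul_add, map_add, hx, hy]
    | tmul s m => simp

lemma baseChangeMap_isHom (θ : R →ₐ[k] S) {M N : NUModule k A R} {f : M →ₗ[R] N}
    (hf : IsHom f) : IsHom (baseChangeMap θ f) := by
  let : Algebra R S := θ.toRingHom.toAlgebra
  intro a x
  change f.baseChange S ((M.act a).baseChange S x) = (N.act a).baseChange S (f.baseChange S x)
  change S ⊗[R] M at x
  induction x using TensorProduct.induction_on with
  | zero => simp
  | add x y hx hy => simp only [map_add, hx, hy]
  | tmul s m => simp [hf a m]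

end General

/-! ### Finite dimensional modules: projectives, stable endomorphisms, syzygies, almost split
sequences -/

section FiniteDimensional

variable {k : Type u} [Field k] {A : Type w} [NonUnitalRing A] [Module k A]

/-- A finite dimensional `A`-module is projective if homomorphisms out of it lift along
surjective homomorphisms of finite dimensional `A`-modules. -/
def IsProjective (P : NUModule k A k) : Prop :=
  Module.Finite k P ∧
    ∀ (X Y : NUModule k A k), Module.Finite k X → Module.Finite k Y →
      ∀ (g : X →ₗ[k] Y) (f : P →ₗ[k] Y), IsHom g → Function.Surjective g → IsHom f →
        ∃ h : P →ₗ[k] X, IsHom h ∧ g ∘ₗ h = f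

/-- The endomorphism `k`-algebra of an `A`-module. -/
def endAlgebra (V : NUModule k A k) : Subalgebra k (Module.End k V) where
  carrier := {f | IsHom (M := V) (N := V) f}
  mul_mem' {f g} hf hg a m := by
    change f (g (V.act a m)) = V.act a (f (g m))
    rw [hg a m, hf a (g m)]
  add_mem' {f g} hf hg a m := by
    change f (V.act a m) + g (V.act a m) = V.act a (f m + g m)
    rw [hf a m, hg a m, map_add]
  algebraMap_mem' c a m := by
    change c • V.act a m = V.act a (c • m)
    rw [map_smul]

/-- `f : M → N` factors through a finite dimensional projective module. -/
def FactorsThroughProjective {M N : NUModule k A k} (f : M →ₗ[k] N) : Prop :=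
  ∃ (P : NUModule k A k) (g : M →ₗ[k] P) (h : P →ₗ[k] N),
    IsProjective P ∧ IsHom g ∧ IsHom h ∧ f = h ∘ₗ g

lemma IsProjective.prod {P Q : NUModule k A k} (hP : IsProjective P) (hQ : IsProjective Q) :
    IsProjective (P.prod Q) := by
  obtain ⟨hPf, hP⟩ := hP
  obtain ⟨hQf, hQ⟩ := hQ
  refine ⟨inferInstanceAs (Module.Finite k (P × Q)), fun X Y hX hY g f hg hgs hf => ?_⟩
  obtain ⟨h₁, hh₁, e₁⟩ := hP X Y hX hY g (f ∘ₗ LinearMap.inl k P Q) hg hgs (fun a m => by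
    have := hf a ((m, 0) : P × Q)
    change f ((P.act a m, Q.act a 0) : P × Q) = _ at this
    rw [map_zero] at this
    exact this)
  obtain ⟨h₂, hh₂, e₂⟩ := hQ X Y hX hY g (f ∘ₗ LinearMap.inr k P Q) hg hgs (fun a m => by
    have := hf a ((0, m) : P × Q)
    change f ((P.act a 0, Q.act a m) : P × Q) = _ at this
    rw [map_zero] at this
    exact this)
  refine ⟨h₁.coprod h₂, ?_, ?_⟩
  · rintro a ⟨p, q⟩
    change h₁ (P.act a p) + h₂ (Q.act a q) = X.act a (h₁ p + h₂ q)
    rw [hh₁, hh₂, map_add]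
  · refine LinearMap.ext ?_
    rintro ⟨p, q⟩
    change g (h₁ p + h₂ q) = f ((p, q) : P × Q)
    have h1 : g (h₁ p) = f ((p, 0) : P × Q) := LinearMap.congr_fun e₁ p
    have h2 : g (h₂ q) = f ((0, q) : P × Q) := LinearMap.congr_fun e₂ q
    have h3 : ((p, q) : P × Q) = (p, 0) + (0, q) := by simp
    rw [map_add, h1, h2, h3]
    exact (map_add f ((p, 0) : P × Q) ((0, q) : P × Q)).symm

/-- The zero module. -/
def zero (k : Type u) [Field k] (A : Type w) [NonUnitalRing A] [Module k A] :
    NUModule k A k where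
  carrier := PUnit.{u + 1}
  act := 0
  act_smul c a := Subsingleton.elim _ _
  unital m := by
    rw [Subsingleton.elim m 0]
    exact Submodule.zero_mem _

lemma isProjective_zero : IsProjective (zero k A) := by
  refine ⟨inferInstanceAs (Module.Finite k PUnit.{u + 1}), fun X Y _ _ g f _ _ _ =>
    ⟨0, fun a m => by simp, ?_⟩⟩
  refine LinearMap.ext fun m => ?_
  have : m = 0 := Subsingleton.elim (α := PUnit.{u + 1}) _ _
  rw [this, map_zero, map_zero]

/-- The ideal of `End_A(V)` of those endomorphisms that factor through a finite dimensional
projective module. -/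
def projectiveIdeal (V : NUModule k A k) : Ideal V.endAlgebra where
  carrier := {f | FactorsThroughProjective (f : Module.End k V)}
  add_mem' := by
    rintro f f' ⟨P, g, h, hP, hg, hh, e⟩ ⟨P', g', h', hP', hg', hh', e'⟩
    refine ⟨P.prod P', g.prod g', h.coprod h', hP.prod hP', ?_, ?_, ?_⟩
    · intro a m
      change (g (V.act a m), g' (V.act a m)) = (P.act a (g m), P'.act a (g' m))
      rw [hg, hg']
    · rintro a ⟨p, q⟩
      change h (P.act a p) + h' (P'.act a q) = V.act a (h p + h' q)
      rw [hh, hh', map_add]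
    · refine LinearMap.ext fun m => ?_
      change (f : Module.End k V) m + (f' : Module.End k V) m = h (g m) + h' (g' m)
      rw [e, e']
      rfl
  zero_mem' := ⟨zero k A, 0, 0, isProjective_zero, fun a m => by simp, fun a m => by simp,
    by simp⟩
  smul_mem' := by
    rintro c f ⟨P, g, h, hP, hg, hh, e⟩
    refine ⟨P, g, (c : Module.End k V) ∘ₗ h, hP, hg, fun a m => ?_, ?_⟩
    · change (c : Module.End k V) (h (P.act a m)) = V.act a ((c : Module.End k V) (h m))
      rw [hh]
      exact c.2 a (h m)
    · refine LinearMap.ext fun m => ?_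
      change (c : Module.End k V) ((f : Module.End k V) m) = (c : Module.End k V) (h (g m))
      rw [e]
      rfl

instance (V : NUModule k A k) : (projectiveIdeal V).IsTwoSided where
  mul_mem_of_left := by
    rintro f c ⟨P, g, h, hP, hg, hh, e⟩
    refine ⟨P, g ∘ₗ (c : Module.End k V), h, hP, fun a m => ?_, hh, ?_⟩
    · have hc : (c : Module.End k V) (V.act a m) = V.act a ((c : Module.End k V) m) := c.2 a m
      change g ((c : Module.End k V) (V.act a m)) = P.act a (g ((c : Module.End k V) m))
      rw [hc, hg]
    · refine LinearMap.ext fun m => ?_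
      change (f : Module.End k V) ((c : Module.End k V) m) = h (g ((c : Module.End k V) m))
      rw [e]
      rfl

/-- The stable endomorphism algebra: the quotient of `End_A(V)` by the ideal of the
endomorphisms factoring through a finite dimensional projective module. -/
abbrev StableEnd (V : NUModule k A k) : Type u :=
  V.endAlgebra ⧸ projectiveIdeal V

/-- `V` is non-zero and is not a direct sum of two non-zero modules. -/
def IsIndecomposable (V : NUModule k A k) : Prop :=
  Nontrivial V ∧ ∀ (X Y : NUModule k A k) (e : V ≃ₗ[k] X.prod Y), IsHom e.toLinearMap →
    Subsingleton X ∨ Subsingleton Y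

/-- `p : P → V` is a projective cover: `P` is (finite dimensional and) projective, `p` is a
surjective homomorphism, and its kernel is a superfluous submodule of `P`. -/
def IsProjectiveCover {P V : NUModule k A k} (p : P →ₗ[k] V) : Prop :=
  IsProjective P ∧ IsHom p ∧ Function.Surjective p ∧
    ∀ N : Submodule k P, (∀ (a : A), ∀ x ∈ N, P.act a x ∈ N) →
      N ⊔ LinearMap.ker p = ⊤ → N = ⊤

/-- `K` is (isomorphic to) the syzygy `Ω V`, the kernel of a projective cover of `V`. -/
def IsSyzygy (K V : NUModule k A k) : Prop :=
  ∃ (P : NUModule k A k) (p : P →ₗ[k] V) (i : K →ₗ[k] P),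
    IsProjectiveCover p ∧ IsHom i ∧ Function.Injective i ∧ LinearMap.range i = LinearMap.ker p

/-- A homomorphism with a left inverse. -/
def IsSplitMono {M N : NUModule k A k} (f : M →ₗ[k] N) : Prop :=
  ∃ r : N →ₗ[k] M, IsHom r ∧ r ∘ₗ f = LinearMap.id

/-- A homomorphism with a right inverse. -/
def IsSplitEpi {M N : NUModule k A k} (f : M →ₗ[k] N) : Prop :=
  ∃ s : N →ₗ[k] M, IsHom s ∧ f ∘ₗ s = LinearMap.id

/-- `f : T → E` is left almost split in the category of finite dimensional modules. -/
def IsLeftAlmostSplit {T E : NUModule k A k} (f : T →ₗ[k] E) : Prop :=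
  IsHom f ∧ ¬ IsSplitMono f ∧
    ∀ (X : NUModule k A k) (h : T →ₗ[k] X), Module.Finite k X → IsHom h → ¬ IsSplitMono h →
      ∃ h' : E →ₗ[k] X, IsHom h' ∧ h' ∘ₗ f = h

/-- `g : E → V` is right almost split in the category of finite dimensional modules. -/
def IsRightAlmostSplit {E V : NUModule k A k} (g : E →ₗ[k] V) : Prop :=
  IsHom g ∧ ¬ IsSplitEpi g ∧
    ∀ (X : NUModule k A k) (h : X →ₗ[k] V), Module.Finite k X → IsHom h → ¬ IsSplitEpi h →
      ∃ h' : X →ₗ[k] E, IsHom h' ∧ g ∘ₗ h' = h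

/-- `T` is (isomorphic to) the Auslander-Reiten translate `τ V`: there is an almost split
sequence `0 → T → E → V → 0` of finite dimensional modules. -/
def IsARTranslate (T V : NUModule k A k) : Prop :=
  ∃ (E : NUModule k A k) (f : T →ₗ[k] E) (g : E →ₗ[k] V),
    Module.Finite k T ∧ Module.Finite k E ∧ Module.Finite k V ∧
    Function.Injective f ∧ LinearMap.range f = LinearMap.ker g ∧ Function.Surjective g ∧
    IsLeftAlmostSplit f ∧ IsRightAlmostSplit g

end FiniteDimensional

end NUModule

/-! ### Complete local Noetherian algebras with residue field `k` -/

/-- The complete local commutative Noetherian `k`-algebras with residue field `k`. -/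
structure CompleteLocalAlgebra (k : Type u) [Field k] where
  carrier : Type u
  [commRing : CommRing carrier]
  [algebra : Algebra k carrier]
  [isLocalRing : IsLocalRing carrier]
  [isNoetherianRing : IsNoetherianRing carrier]
  [isAdicComplete : IsAdicComplete (IsLocalRing.maximalIdeal carrier) carrier]
  residue_bijective : Function.Bijective (algebraMap k (IsLocalRing.ResidueField carrier))

namespace CompleteLocalAlgebra

variable {k : Type u} [Field k]

instance : CoeSort (CompleteLocalAlgebra k) (Type u) := ⟨CompleteLocalAlgebra.carrier⟩

instance (R : CompleteLocalAlgebra k) : CommRing R := R.commRing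
instance (R : CompleteLocalAlgebra k) : Algebra k R := R.algebra
instance (R : CompleteLocalAlgebra k) : IsLocalRing R := R.isLocalRing
instance (R : CompleteLocalAlgebra k) : IsNoetherianRing R := R.isNoetherianRing
instance (R : CompleteLocalAlgebra k) :
    IsAdicComplete (IsLocalRing.maximalIdeal R) R := R.isAdicComplete

/-- The canonical projection `R → R / 𝔪_R = k`. -/
noncomputable def aug (R : CompleteLocalAlgebra k) : R →ₐ[k] k :=
  ((AlgEquiv.ofBijective (Algebra.ofId k (IsLocalRing.ResidueField R))
      R.residue_bijective).symm : IsLocalRing.ResidueField R →ₐ[k] k).comp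
    (IsScalarTower.toAlgHom k R (IsLocalRing.ResidueField R))

/-- The projection is the only `k`-algebra homomorphism `R → k`. -/
lemma eq_aug (R : CompleteLocalAlgebra k) (f : R →ₐ[k] k) : f = R.aug := by
  have hm : ∀ (g : R →ₐ[k] k) (x : R), x ∈ IsLocalRing.maximalIdeal R → g x = 0 := by
    intro g x hx
    by_contra h
    have hu : IsUnit (algebraMap k R (g x)) := (IsUnit.mk0 _ h).map (algebraMap k R)
    have h1 : IsUnit (algebraMap k R (g x) - x) := by
      by_contra hn
      have h2 : algebraMap k R (g x) - x ∈ IsLocalRing.maximalIdeal R :=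
        (IsLocalRing.mem_maximalIdeal _).2 hn
      have h3 := Ideal.add_mem _ h2 hx
      rw [sub_add_cancel] at h3
      exact (IsLocalRing.mem_maximalIdeal _).1 h3 hu
    have h4 := h1.map g
    rw [map_sub, AlgHom.commutes, Algebra.algebraMap_self_apply, sub_self] at h4
    exact not_isUnit_zero h4
  refine AlgHom.ext fun x => ?_
  obtain ⟨c, hc⟩ := R.residue_bijective.2 (IsLocalRing.residue R x)
  have hx : x - algebraMap k R c ∈ IsLocalRing.maximalIdeal R := by
    rw [← IsLocalRing.residue_eq_zero_iff, map_sub, ← hc, sub_eq_zero]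
    rfl
  have h1 := hm f _ hx
  have h2 := hm R.aug _ hx
  rw [map_sub, AlgHom.commutes, sub_eq_zero] at h1 h2
  rw [h1, h2]

/-- Morphisms of complete local algebras are the `k`-algebra homomorphisms: such a homomorphism
is automatically compatible with the projections to `k`, hence maps `𝔪_R` into `𝔪_S`, hence is
continuous. -/
lemma aug_comp {R S : CompleteLocalAlgebra k} (θ : R →ₐ[k] S) : S.aug.comp θ = R.aug :=
  R.eq_aug _

lemma isLocalHom {R S : CompleteLocalAlgebra k} (θ : R →ₐ[k] S) : IsLocalHom θ where
  map_nonunit x hx := by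
    by_contra h
    have h1 : IsUnit (S.aug (θ x)) := hx.map S.aug
    have h2 : R.aug x = 0 := by
      change (AlgEquiv.ofBijective (Algebra.ofId k (IsLocalRing.ResidueField R))
        R.residue_bijective).symm (IsLocalRing.residue R x) = 0
      rw [(IsLocalRing.residue_eq_zero_iff x).2 ((IsLocalRing.mem_maximalIdeal x).2 h), map_zero]
    rw [← aug_comp θ] at h2
    rw [show S.aug (θ x) = 0 from h2] at h1
    exact not_isUnit_zero h1

end CompleteLocalAlgebra

namespace CompleteLocalAlgebra

/-- The ring of dual numbers `k[ε]`, `ε² = 0`. -/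
def dualNumber (k : Type u) [Field k] : CompleteLocalAlgebra k where
  carrier := DualNumber k
  isAdicComplete := by
    have hsq : ∀ x ∈ IsLocalRing.maximalIdeal (DualNumber k), TrivSqZeroExt.fst x = 0 := by
      intro x hx
      rw [DualNumber.maximalIdeal_eq_span_singleton_eps, Ideal.mem_span_singleton] at hx
      exact DualNumber.fst_eq_zero_iff_eps_dvd.2 hx
    have hzero : (IsLocalRing.maximalIdeal (DualNumber k)) ^ 2 = ⊥ := by
      rw [pow_two, eq_bot_iff, Ideal.mul_le]
      intro x hx y hy
      have h1 := hsq x hx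
      have h2 := hsq y hy
      rw [Ideal.mem_bot]
      ext <;> simp [h1, h2]
    have htop : ∀ n, 2 ≤ n →
        ((IsLocalRing.maximalIdeal (DualNumber k)) ^ n • ⊤ : Submodule (DualNumber k) (DualNumber k))
          = ⊥ := by
      intro n hn
      have h := Ideal.pow_le_pow_right (I := IsLocalRing.maximalIdeal (DualNumber k)) hn
      rw [hzero, le_bot_iff] at h
      rw [h, Submodule.bot_smul]
    exact
      { haus' := fun x hx => by
          have h := hx 2
          rwa [htop 2 le_rfl, SModEq.bot] at h
        prec' := fun f hf => ⟨f 2, fun n => by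
          rcases le_total n 2 with hn | hn
          · exact hf hn
          · have h := hf hn
            rw [htop 2 le_rfl, SModEq.bot] at h
            rw [h]
            exact SModEq.refl _⟩ }
  residue_bijective := by
    refine ⟨(algebraMap k _).injective, fun y => ?_⟩
    obtain ⟨x, rfl⟩ := IsLocalRing.residue_surjective y
    refine ⟨TrivSqZeroExt.fst x, ?_⟩
    change IsLocalRing.residue (DualNumber k) (algebraMap k (DualNumber k) (TrivSqZeroExt.fst x)) = _
    rw [← sub_eq_zero, ← map_sub, IsLocalRing.residue_eq_zero_iff,
      DualNumber.maximalIdeal_eq_span_singleton_eps, Ideal.mem_span_singleton,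
      ← DualNumber.fst_eq_zero_iff_eps_dvd]
    simp [TrivSqZeroExt.algebraMap_eq_inl]

end CompleteLocalAlgebra

/-! ### Lifts, deformations and versal deformation rings -/

open NUModule

section Deformation

variable {k : Type u} [Field k] {A : Type w} [NonUnitalRing A] [Module k A]

/-- A lift `(M, φ)` of `V` over `R`: an `R ⊗_k A`-module `M`, finitely generated and free over
`R`, with an isomorphism of `A`-modules `φ : k ⊗_R M → V`. -/
structure Lift (V : NUModule k A k) (R : CompleteLocalAlgebra k) where
  M : NUModule k A R
  free : Module.Free R M
  finite : Module.Finite R M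
  φ : M.baseChange R.aug ≃ₗ[k] V
  φ_isHom : IsHom φ.toLinearMap

namespace Lift

variable {V : NUModule k A k} {R S : CompleteLocalAlgebra k}

/-- Two lifts `(M, φ)`, `(M', φ')` are isomorphic if there is an isomorphism `α : M → M'` of
`R ⊗_k A`-modules with `φ' ∘ (id_k ⊗ α) = φ`. -/
def Isom (L L' : Lift V R) : Prop :=
  ∃ α : L.M ≃ₗ[R] L'.M, IsHom α.toLinearMap ∧
    ∀ x, L'.φ (baseChangeMap R.aug α.toLinearMap x) = L.φ x

end Lift

lemma NUModule.baseChangeMap_refl {R S : Type u} [CommRing R] [Algebra k R] [CommRing S]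
    [Algebra k S] (θ : R →ₐ[k] S) (M : NUModule k A R) (x : M.baseChange θ) :
    baseChangeMap θ (LinearMap.id : M →ₗ[R] M) x = x := by
  let : Algebra R S := θ.toRingHom.toAlgebra
  change (LinearMap.id : M →ₗ[R] M).baseChange S x = x
  rw [LinearMap.baseChange_id]
  rfl

lemma NUModule.baseChangeMap_comp {R S : Type u} [CommRing R] [Algebra k R] [CommRing S]
    [Algebra k S] (θ : R →ₐ[k] S) {M N P : NUModule k A R} (f : M →ₗ[R] N) (g : N →ₗ[R] P)
    (x : M.baseChange θ) :
    baseChangeMap θ (g ∘ₗ f) x = baseChangeMap θ g (baseChangeMap θ f x) := by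
  let : Algebra R S := θ.toRingHom.toAlgebra
  change (g ∘ₗ f).baseChange S x = g.baseChange S (f.baseChange S x)
  rw [LinearMap.baseChange_comp]
  rfl

namespace Lift

variable {V : NUModule k A k} {R S : CompleteLocalAlgebra k}

lemma isom_equivalence : Equivalence (Isom (V := V) (R := R)) where
  refl L := ⟨LinearEquiv.refl R L.M, fun _ _ => rfl, fun x =>
    congrArg L.φ (NUModule.baseChangeMap_refl R.aug L.M x)⟩
  symm := by
    rintro L L' ⟨α, hα, h⟩
    refine ⟨α.symm, fun a m => ?_, fun x => ?_⟩
    · have := hα a (α.symm m)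
      change α (L.M.act a (α.symm m)) = L'.M.act a (α (α.symm m)) at this
      change α.symm (L'.M.act a m) = L.M.act a (α.symm m)
      rw [LinearEquiv.apply_symm_apply] at this
      rw [← this, LinearEquiv.symm_apply_apply]
    · rw [← h, ← NUModule.baseChangeMap_comp]
      have : α.toLinearMap ∘ₗ α.symm.toLinearMap = LinearMap.id := by ext; simp
      rw [this, NUModule.baseChangeMap_refl]
  trans := by
    rintro L L' L'' ⟨α, hα, h⟩ ⟨β, hβ, h'⟩
    refine ⟨α.trans β, fun a m => ?_, fun x => ?_⟩
    · change β (α (L.M.act a m)) = L''.M.act a (β (α m))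
      exact (congrArg β (hα a m)).trans (hβ a (α m))
    · rw [← h, ← h', ← NUModule.baseChangeMap_comp]
      rfl

instance isomSetoid (V : NUModule k A k) (R : CompleteLocalAlgebra k) : Setoid (Lift V R) where
  r := Isom
  iseqv := isom_equivalence

/-- The lift `(S ⊗_{R,θ} M, φ_θ)`, where `φ_θ` is the composition
`k ⊗_S (S ⊗_{R,θ} M) ≅ k ⊗_R M → V` of the natural isomorphism with `φ`. -/
noncomputable def map (θ : R →ₐ[k] S) (L : Lift V R) : Lift V S where
  M := L.M.baseChange θ
  free :=
    letI : Algebra R S := θ.toRingHom.toAlgebra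
    haveI := L.free
    inferInstanceAs (Module.Free S (S ⊗[R] L.M))
  finite :=
    letI : Algebra R S := θ.toRingHom.toAlgebra
    haveI := L.finite
    inferInstanceAs (Module.Finite S (S ⊗[R] L.M))
  φ := (baseChangeTrans θ S.aug R.aug (CompleteLocalAlgebra.aug_comp θ) L.M).trans L.φ
  φ_isHom a x := by
    have h1 := baseChangeTrans_isHom θ S.aug R.aug (CompleteLocalAlgebra.aug_comp θ) L.M a x
    exact (congrArg L.φ h1).trans (L.φ_isHom a _)

lemma map_isom (θ : R →ₐ[k] S) {L L' : Lift V R} (h : Isom L L') :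
    Isom (L.map θ) (L'.map θ) := by
  obtain ⟨α, hα, h⟩ := h
  refine ⟨baseChangeEquiv θ α, baseChangeMap_isHom θ hα, fun x => ?_⟩
  have h1 := baseChangeTrans_naturality θ S.aug R.aug (CompleteLocalAlgebra.aug_comp θ)
    α.toLinearMap x
  exact (congrArg L'.φ h1).trans (h _)

end Lift

/-- The set of deformations of `V` over `R`: the isomorphism classes of lifts. -/
def Def (V : NUModule k A k) (R : CompleteLocalAlgebra k) : Type (max (u + 1) w) :=
  Quotient (Lift.isomSetoid V R)

/-- The action of the deformation functor on a morphism `θ : R → S`. -/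
noncomputable def Def.map {V : NUModule k A k} {R S : CompleteLocalAlgebra k} (θ : R →ₐ[k] S) :
    Def V R → Def V S :=
  Quotient.map (Lift.map θ) fun _ _ h => Lift.map_isom θ h

/-- `(R, U)` is a versal deformation ring of `V` with its versal deformation: every deformation
of `V` over every `S` is induced from `U` by a morphism `R → S`, and this morphism is unique
when `S = k[ε]`. -/
def IsVersal (V : NUModule k A k) (R : CompleteLocalAlgebra k) (U : Def V R) : Prop :=
  (∀ S : CompleteLocalAlgebra k,
    Function.Surjective fun θ : R →ₐ[k] S => Def.map θ U) ∧
  Function.Bijective fun θ : R →ₐ[k] CompleteLocalAlgebra.dualNumber k => Def.map θ U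

/-- `(R, U)` is a universal deformation ring of `V` with its universal deformation: `R`
represents the deformation functor via `U`. -/
def IsUniversal (V : NUModule k A k) (R : CompleteLocalAlgebra k) (U : Def V R) : Prop :=
  ∀ S : CompleteLocalAlgebra k, Function.Bijective fun θ : R →ₐ[k] S => Def.map θ U

end Deformation

/-! ### The augmentation of a complete local algebra -/

namespace CompleteLocalAlgebra

variable {k : Type u} [Field k] (R : CompleteLocalAlgebra k)

/-! Deformations are compared through `Lift.Induces`: a lift over `S` is induced from a lift over
`R` along `θ` exactly when there is a `θ`-semilinear, equivariant map between them which is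
compatible with the reductions to `V` (`map_isom_iff_induces`). Such a map is automatically an
isomorphism after base change, because a linear map of lifts that reduces to the identity has a unit
as determinant.

Existence and uniqueness. A finite dimensional module sees only a finite dimensional corner `eAe` of
the algebra `A`, so a lift is a tuple `Y` of matrices reducing to the tuple `B` of `V`, subject to
polynomial equations and taken up to conjugation by matrices congruent to 1. Let `δ` be the
commutator map `Z ↦ (Z B_i - B_i Z)` and `q` a generalized inverse of it. By successive
approximation every tuple can be conjugated into the slice `q (Y - B) = 0` (`exists_conj_inSlice`).
Hence the quotient of a power series ring by the equations for a representation in the slice carries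
a versal deformation (`Chart.exists_versal`). Over `k[ε]`, conjugate tuples in the slice coincide.
Over an arbitrary ring they coincide as soon as all endomorphisms of `V` lift to all its lifts
(`eq_of_inSlice`), and then the deformation is universal. Versal rings are isomorphic because an
endomorphism of a complete local Noetherian algebra that is the identity on tangent vectors is
bijective (`bijective_of_tangent`).

The Frobenius structure. The form `∑ φ_i(1)` on the repetitive algebra has dual families `x_s`,
`y_s`, and its Nakayama automorphism is the shift. The trace `∑ y_s φ x_s` turns linear maps into
homomorphisms, and a homomorphism factors through a projective module exactly when it is a trace
(`factorsThroughProjective_iff`). Linear maps lift to any lifts, hence so do traces. If the stable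
endomorphism ring is `k`, every endomorphism is a scalar plus a trace and therefore lifts; this
gives universality.

Transport to other modules. `DeformationEquivalent` is a correspondence of lifts respecting
`Induces`; it carries universality and the ring from one module to another. Adding a projective
summand, passing to the kernel of a surjection from a projective module, and twisting by an
automorphism are such equivalences. This settles `V ⊕ P` and `Ω V`. For `τ V`, let `W` be the
Nakayama twist of `V`. A trace form on the endomorphisms of `V` that vanishes on those factoring
through projectives produces a homomorphism from `V` to the kernel `K₁` of a projective module
mapping onto `W`. It does not factor through a projective module, but its composite with any map
that is not a split epimorphism does. Pulling back a projective module mapping onto `K₁` gives a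
right almost split map whose kernel is reached from `V` by a twist and two kernels. Its minimal
version has the same kernel up to a projective summand, because the kernel is again stably scalar.
-/

lemma aug_eq_zero_iff (x : R) : R.aug x = 0 ↔ x ∈ IsLocalRing.maximalIdeal R := by
  constructor
  · intro h
    rw [IsLocalRing.mem_maximalIdeal]
    intro hx
    have h1 : IsUnit (R.aug x) := hx.map R.aug
    rw [h] at h1
    exact not_isUnit_zero h1
  · intro hx
    change (AlgEquiv.ofBijective (Algebra.ofId k (IsLocalRing.ResidueField R))
        R.residue_bijective).symm (IsLocalRing.residue R x) = 0
    rw [(IsLocalRing.residue_eq_zero_iff x).2 hx, map_zero]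

lemma isUnit_of_aug_ne_zero {x : R} (h : R.aug x ≠ 0) : IsUnit x := by
  by_contra hx
  exact h ((R.aug_eq_zero_iff x).2 ((IsLocalRing.mem_maximalIdeal x).2 hx))

lemma aug_algebraMap (c : k) : R.aug (algebraMap k R c) = c := R.aug.commutes c

lemma aug_apply {R S : CompleteLocalAlgebra k} (θ : R →ₐ[k] S) (r : R) :
    S.aug (θ r) = R.aug r :=
  DFunLike.congr_fun (aug_comp θ) r

end CompleteLocalAlgebra

/-! ### Semilinear and equivariant maps, and base change -/

namespace NUModule

variable {k : Type u} [Field k] {A : Type w} [NonUnitalRing A] [Module k A]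
variable {R : Type u} [CommRing R] [Algebra k R] {S : Type u} [CommRing S] [Algebra k S]
variable {T : Type u} [CommRing T] [Algebra k T]

/-- An additive map which is semilinear with respect to a homomorphism of the base rings. -/
def IsSemilinear (θ : R →ₐ[k] S) {M : NUModule k A R} {N : NUModule k A S} (f : M →+ N) : Prop :=
  ∀ (r : R) (m : M), f (r • m) = θ r • f m

/-- An additive map commuting with the action of `A`. -/
def IsEquivariant {M : NUModule k A R} {N : NUModule k A S} (f : M →+ N) : Prop :=
  ∀ (a : A) (m : M), f (M.act a m) = N.act a (f m)

section

variable {M : NUModule k A R} {N : NUModule k A S} {P : NUModule k A T}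

lemma IsSemilinear.comp {θ : R →ₐ[k] S} {η : S →ₐ[k] T} {g : N →+ P} {f : M →+ N}
    (hg : IsSemilinear η g) (hf : IsSemilinear θ f) : IsSemilinear (η.comp θ) (g.comp f) := by
  intro r m
  change g (f (r • m)) = η (θ r) • g (f m)
  rw [hf, hg]

lemma IsEquivariant.comp {g : N →+ P} {f : M →+ N}
    (hg : IsEquivariant g) (hf : IsEquivariant f) : IsEquivariant (g.comp f) := by
  intro r m
  change g (f (M.act r m)) = P.act r (g (f m))
  rw [hf, hg]

lemma isSemilinear_linear {M N : NUModule k A R} (f : M →ₗ[R] N) :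
    IsSemilinear (AlgHom.id k R) f.toAddMonoidHom := fun r m => f.map_smul r m

/-- The linear map underlying an additive map which is semilinear over the identity. -/
def IsSemilinear.toLinear {M N : NUModule k A R} {f : M →+ N}
    (h : IsSemilinear (AlgHom.id k R) f) : M →ₗ[R] N where
  toFun := f
  map_add' := f.map_add
  map_smul' := h

end

section

/-- The canonical map `M → S ⊗_{R,θ} M`, `m ↦ 1 ⊗ m`. -/
noncomputable def unit (θ : R →ₐ[k] S) (M : NUModule k A R) : M →+ M.baseChange θ :=
  letI : Algebra R S := θ.toRingHom.toAlgebra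
  { toFun := fun m => ((1 : S) ⊗ₜ[R] m : S ⊗[R] M)
    map_zero' := TensorProduct.tmul_zero _ _
    map_add' := fun _ _ => TensorProduct.tmul_add _ _ _ }

lemma unit_isSemilinear (θ : R →ₐ[k] S) (M : NUModule k A R) : IsSemilinear θ (unit θ M) := by
  let : Algebra R S := θ.toRingHom.toAlgebra
  intro r m
  exact TensorProduct.tmul_smul r (1 : S) m

lemma unit_isEquivariant (θ : R →ₐ[k] S) (M : NUModule k A R) : IsEquivariant (unit θ M) :=
  fun _ _ => rfl

lemma baseChange_induction (θ : R →ₐ[k] S) (M : NUModule k A R) {p : M.baseChange θ → Prop}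
    (hz : p 0) (ha : ∀ x y, p x → p y → p (x + y)) (hs : ∀ (s : S) (m : M), p (s • unit θ M m))
    (x : M.baseChange θ) : p x := by
  let : Algebra R S := θ.toRingHom.toAlgebra
  refine TensorProduct.induction_on (motive := p) x hz (fun s m => ?_) ha
  have h0 : (s ⊗ₜ[R] m : S ⊗[R] M) = s • ((1 : S) ⊗ₜ[R] m) := by
    rw [TensorProduct.smul_tmul', smul_eq_mul, mul_one]
  rw [h0]
  exact hs s m

lemma baseChangeMap_unit (θ : R →ₐ[k] S) {M N : NUModule k A R} (f : M →ₗ[R] N) (m : M) :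
    baseChangeMap θ f (unit θ M m) = unit θ N (f m) := by
  let : Algebra R S := θ.toRingHom.toAlgebra
  exact LinearMap.baseChange_tmul _ _ _

lemma baseChange_ext {θ : R →ₐ[k] S} {η : S →ₐ[k] T} {M : NUModule k A R} {N : NUModule k A T}
    {g h : M.baseChange θ →+ N} (hg : IsSemilinear η g) (hh : IsSemilinear η h)
    (e : ∀ m, g (unit θ M m) = h (unit θ M m)) : g = h := by
  refine AddMonoidHom.ext fun x => ?_
  induction x using baseChange_induction with
  | hz => rw [map_zero, map_zero]
  | ha x y hx hy => rw [map_add, map_add, hx, hy]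
  | hs s m => rw [hg, hh, e]

lemma IsSemilinear.smul_act {θ : R →ₐ[k] S} {M : NUModule k A R} {N : NUModule k A S} {f : M →+ N}
    (hf : IsSemilinear θ f) (a : A) :
    IsSemilinear θ (f.comp (M.act a).toAddMonoidHom) := fun r m => by
  change f (M.act a (r • m)) = θ r • f (M.act a m)
  rw [map_smul, hf]

lemma IsSemilinear.act_smul {θ : R →ₐ[k] S} {M : NUModule k A R} {N : NUModule k A S} {f : M →+ N}
    (hf : IsSemilinear θ f) (a : A) :
    IsSemilinear θ ((N.act a).toAddMonoidHom.comp f) := fun r m => by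
  change N.act a (f (r • m)) = θ r • N.act a (f m)
  rw [hf, map_smul]

/-- Base change along `θ` is left adjoint to restriction of scalars. Equivariance of the adjoint map
compares two semilinear maps, so it is enough to check it on the elements `unit θ M m`. -/
lemma exists_baseChange_lift (θ : R →ₐ[k] S) (M : NUModule k A R) (N : NUModule k A S)
    (f : M →+ N) (hf : IsSemilinear θ f) (hA : IsEquivariant f) :
    ∃ F : M.baseChange θ →ₗ[S] N, IsHom F ∧ ∀ m, F (unit θ M m) = f m := by
  have key : ∃ F : M.baseChange θ →ₗ[S] N, ∀ m, F (unit θ M m) = f m := by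
    let : Algebra R S := θ.toRingHom.toAlgebra
    let : Module R N := Module.compHom N θ.toRingHom
    have : IsScalarTower R S N := ⟨fun r s m => by
      change (θ r * s) • m = θ r • (s • m)
      rw [mul_smul]⟩
    let f' : M →ₗ[R] N := { toFun := f, map_add' := f.map_add, map_smul' := hf }
    refine ⟨f'.liftBaseChange S, fun m => ?_⟩
    exact (LinearMap.liftBaseChange_tmul ..).trans (one_smul _ _)
  obtain ⟨F, hF⟩ := key
  refine ⟨F, fun a x => ?_, hF⟩
  have h := baseChange_ext ((isSemilinear_linear F).smul_act a) ((isSemilinear_linear F).act_smul a)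
    fun m => by
      change F ((M.baseChange θ).act a (unit θ M m)) = N.act a (F (unit θ M m))
      rw [← unit_isEquivariant, hF, hF, hA]
  exact DFunLike.congr_fun h x

end

end NUModule

/-! ### Reduction maps of lifts and lifts induced along a morphism -/

namespace Lift

variable {k : Type u} [Field k] {A : Type w} [NonUnitalRing A] [Module k A]
variable {V W : NUModule k A k} {R S T : CompleteLocalAlgebra k}

/-- The reduction map `M → k ⊗_R M ≅ V` of a lift. -/
noncomputable def red (L : Lift V R) : L.M →+ V :=
  L.φ.toLinearMap.toAddMonoidHom.comp (unit R.aug L.M)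

lemma φ_unit (L : Lift V R) (m : L.M) : L.φ (unit R.aug L.M m) = L.red m := rfl

lemma red_smul (L : Lift V R) (r : R) (m : L.M) : L.red (r • m) = R.aug r • L.red m := by
  rw [← φ_unit, unit_isSemilinear, map_smul, φ_unit]

lemma red_isSemilinear (L : Lift V R) : IsSemilinear R.aug L.red := L.red_smul

lemma red_act (L : Lift V R) (a : A) (m : L.M) : L.red (L.M.act a m) = V.act a (L.red m) := by
  rw [← φ_unit, unit_isEquivariant]
  exact L.φ_isHom a _

lemma red_isEquivariant (L : Lift V R) : IsEquivariant L.red := L.red_act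

/-- Every basis of `V` lifts to a basis of every lift of `V`. -/
lemma exists_basis (L : Lift V R) {ι : Type*} [Fintype ι] [DecidableEq ι]
    (v : Module.Basis ι k V) :
    ∃ b : Module.Basis ι R L.M, ∀ i, L.red (b i) = v i := by
  let : Algebra R k := R.aug.toRingHom.toAlgebra
  have := L.free
  have := L.finite
  let b0 := Module.Free.chooseBasis R L.M
  let w0 : Module.Basis _ k V := (b0.baseChange k).map L.φ
  have hw0 : ∀ i, L.red (b0 i) = w0 i := fun i =>
    congrArg L.φ (Module.Basis.baseChange_apply k b0 i).symm
  let e := w0.indexEquiv v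
  let b1 := b0.reindex e
  let w1 := w0.reindex e
  have hw1 : ∀ i, L.red (b1 i) = w1 i := fun i => by simp [b1, w1, hw0]
  -- The transition matrices between two bases of `V` have entries in `k`; read over `R` they stay
  -- mutually inverse and move `b1` to a basis reducing to `v`.
  have h1 : ((w1.toMatrix v).map (algebraMap k R)) * ((v.toMatrix w1).map (algebraMap k R)) = 1 :=
      by
    rw [← Matrix.map_mul, Module.Basis.toMatrix_mul_toMatrix_flip]; simp
  have h2 : ((v.toMatrix w1).map (algebraMap k R)) * ((w1.toMatrix v).map (algebraMap k R)) = 1 :=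
      by
    rw [← Matrix.map_mul, Module.Basis.toMatrix_mul_toMatrix_flip]; simp
  refine ⟨b1.map (Matrix.toLinOfInv b1 b1 h1 h2), fun i => ?_⟩
  rw [Module.Basis.map_apply]
  change L.red (Matrix.toLin b1 b1 ((w1.toMatrix v).map (algebraMap k R)) (b1 i)) = v i
  rw [Matrix.toLin_self, map_sum]
  simp only [Matrix.map_apply, red_smul, hw1, CompleteLocalAlgebra.aug_algebraMap]
  exact Module.Basis.sum_toMatrix_smul_self w1 v i

lemma red_sum (L : Lift V R) {ι : Type*} [Fintype ι] (b : Module.Basis ι R L.M) (m : L.M) :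
    L.red m = ∑ i, R.aug (b.repr m i) • L.red (b i) := by
  conv_lhs => rw [← b.sum_repr m, map_sum]
  simp only [red_smul]

lemma red_surjective (L : Lift V R) : Function.Surjective L.red := by
  classical
  let : Algebra R k := R.aug.toRingHom.toAlgebra
  have := L.free
  have := L.finite
  let b0 := Module.Free.chooseBasis R L.M
  let w0 : Module.Basis _ k V := (b0.baseChange k).map L.φ
  have hw0 : ∀ i, L.red (b0 i) = w0 i := fun i =>
    congrArg L.φ (Module.Basis.baseChange_apply k b0 i).symm
  intro x
  refine ⟨∑ i, algebraMap k R (w0.repr x i) • b0 i, ?_⟩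
  rw [map_sum]
  simp only [red_smul, hw0, CompleteLocalAlgebra.aug_algebraMap]
  exact w0.sum_repr x

lemma finite_of_lift (L : Lift V R) : Module.Finite k V := by
  let : Algebra R k := R.aug.toRingHom.toAlgebra
  have := L.finite
  exact Module.Finite.equiv (show (k ⊗[R] L.M) ≃ₗ[k] V from L.φ)

/-- A linear map between lifts of `V` which reduces to the identity of `V` is bijective. -/
lemma bijective_of_red (L L' : Lift V R) (f : L.M →ₗ[R] L'.M)
    (hf : ∀ m, L'.red (f m) = L.red m) : Function.Bijective f := by
  classical
  have := L.finite_of_lift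
  let v := Module.finBasis k V
  obtain ⟨b, hb⟩ := L.exists_basis v
  obtain ⟨b', hb'⟩ := L'.exists_basis v
  -- In bases lifting one basis of `V`, the matrix of `f` is the identity modulo the maximal ideal,
  -- so its determinant is a unit.
  have h1 : R.aug.mapMatrix (LinearMap.toMatrix b b' f) = 1 := by
    ext i j
    have h2 := L'.red_sum b' (f (b j))
    rw [hf, hb] at h2
    simp only [hb'] at h2
    have h3 := congrArg (fun x => v.repr x i) h2
    simp only [map_sum, map_smul, Finsupp.coe_finsetSum, Finset.sum_apply, Finsupp.smul_apply,
      Module.Basis.repr_self, Finsupp.single_apply, smul_eq_mul, mul_ite, mul_one, mul_zero,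
      Finset.sum_ite_eq', Finset.mem_univ, if_true] at h3
    rw [AlgHom.mapMatrix_apply, Matrix.map_apply, LinearMap.toMatrix_apply, ← h3, Matrix.one_apply]
    simp [eq_comm]
  have h2 : IsUnit (LinearMap.toMatrix b b' f).det := by
    apply R.isUnit_of_aug_ne_zero
    rw [AlgHom.map_det, h1, Matrix.det_one]
    exact one_ne_zero
  exact (LinearEquiv.ofIsUnitDet h2).bijective

/-- A linear equivalence from a linear map reducing to the identity. -/
noncomputable def equivOfRed (L L' : Lift V R) (f : L.M →ₗ[R] L'.M)
    (hf : ∀ m, L'.red (f m) = L.red m) : L.M ≃ₗ[R] L'.M :=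
  LinearEquiv.ofBijective f (bijective_of_red L L' f hf)

@[simp] lemma equivOfRed_apply (L L' : Lift V R) (f : L.M →ₗ[R] L'.M)
    (hf : ∀ m, L'.red (f m) = L.red m) (m : L.M) : equivOfRed L L' f hf m = f m := rfl

lemma red_equivOfRed_symm (L L' : Lift V R) (f : L.M →ₗ[R] L'.M)
    (hf : ∀ m, L'.red (f m) = L.red m) (m : L'.M) :
    L.red ((equivOfRed L L' f hf).symm m) = L'.red m := by
  rw [← hf, ← equivOfRed_apply L L' f hf, LinearEquiv.apply_symm_apply]

lemma isom_of_red (L L' : Lift V R) (f : L.M →ₗ[R] L'.M) (hA : IsHom f)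
    (hf : ∀ m, L'.red (f m) = L.red m) : Isom L L' := by
  refine ⟨equivOfRed L L' f hf, hA, fun x => ?_⟩
  induction x using baseChange_induction with
  | hz => simp
  | ha x y hx hy => rw [map_add, map_add, map_add, hx, hy]
  | hs c m =>
    rw [map_smul, map_smul, map_smul, baseChangeMap_unit, φ_unit, φ_unit]
    exact congrArg (c • ·) (hf m)

lemma red_map_unit (L : Lift V R) (θ : R →ₐ[k] S) (m : L.M) :
    (L.map θ).red (unit θ L.M m) = L.red m := by
  let : Algebra R S := θ.toRingHom.toAlgebra
  let : Algebra S k := S.aug.toRingHom.toAlgebra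
  let : Algebra R k := R.aug.toRingHom.toAlgebra
  have : IsScalarTower R S k := IsScalarTower.of_algebraMap_eq fun r =>
    (DFunLike.congr_fun (CompleteLocalAlgebra.aug_comp θ) r).symm
  change L.φ (TensorProduct.AlgebraTensorModule.cancelBaseChange R S k k L.M
    ((1 : k) ⊗ₜ[S] ((1 : S) ⊗ₜ[R] m))) = L.φ ((1 : k) ⊗ₜ[R] m : k ⊗[R] L.M)
  rw [TensorProduct.AlgebraTensorModule.cancelBaseChange_tmul, one_smul]

/-- The lift `L'` over `S` is induced by the lift `L` over `R` along `θ : R → S`. -/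
def Induces (θ : R →ₐ[k] S) (L : Lift V R) (L' : Lift V S) : Prop :=
  ∃ f : L.M →+ L'.M, IsSemilinear θ f ∧ IsEquivariant f ∧ ∀ m, L'.red (f m) = L.red m

lemma Induces.trans {θ : R →ₐ[k] S} {η : S →ₐ[k] T} {L : Lift V R} {L' : Lift V S}
    {L'' : Lift V T} (h : Induces θ L L') (h' : Induces η L' L'') :
    Induces (η.comp θ) L L'' := by
  obtain ⟨f, hf1, hf2, hf3⟩ := h
  obtain ⟨g, hg1, hg2, hg3⟩ := h'
  exact ⟨g.comp f, hg1.comp hf1, hg2.comp hf2, fun m => (hg3 _).trans (hf3 m)⟩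

/-- By adjunction a semilinear equivariant map out of `L.M` is a homomorphism out of the base
change, and compatibility with the reductions already makes the latter bijective. This lets later
comparisons of deformations avoid tensor products. -/
lemma map_isom_iff_induces (θ : R →ₐ[k] S) (L : Lift V R) (L' : Lift V S) :
    Isom (L.map θ) L' ↔ Induces θ L L' := by
  constructor
  · rintro ⟨α, hα, h⟩
    refine ⟨(α.toLinearMap.toAddMonoidHom).comp (unit θ L.M), fun r m => ?_, fun a m => ?_,
      fun m => ?_⟩
    · change α (unit θ L.M (r • m)) = θ r • α (unit θ L.M m)
      rw [unit_isSemilinear]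
      exact α.map_smul _ _
    · exact hα a (unit θ L.M m)
    · have h1 := h (unit S.aug (L.map θ).M (unit θ L.M m))
      exact ((congrArg L'.φ (baseChangeMap_unit S.aug α.toLinearMap _)).symm.trans h1).trans
        (red_map_unit L θ m)
  · rintro ⟨f, hf1, hf2, hf3⟩
    obtain ⟨F, hA, hF⟩ := exists_baseChange_lift θ L.M L'.M f hf1 hf2
    refine isom_of_red (L.map θ) L' F hA fun x => ?_
    have h := baseChange_ext (θ := θ) (M := L.M) (g := L'.red.comp F.toAddMonoidHom)
      (h := (L.map θ).red) (L'.red_isSemilinear.comp (isSemilinear_linear F))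
      (L.map θ).red_isSemilinear fun m => by
        refine Eq.trans ?_ (red_map_unit L θ m).symm
        rw [← hf3, ← hF]
        rfl
    exact DFunLike.congr_fun h x

lemma induces_map (θ : R →ₐ[k] S) (L : Lift V R) : Induces θ L (L.map θ) :=
  (map_isom_iff_induces θ L _).1 (isom_equivalence.refl _)

lemma Def.map_eq_iff (θ : R →ₐ[k] S) (L : Lift V R) (L' : Lift V S) :
    Def.map θ (Quotient.mk _ L) = (Quotient.mk _ L' : Def V S) ↔ Induces θ L L' :=
  Quotient.eq.trans (map_isom_iff_induces θ L L')

/-- The lift given by a module with a basis and a reduction map. -/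
noncomputable def ofRed {ι : Type*} [Finite ι] (M : NUModule k A R) (b : Module.Basis ι R M)
    (v : Module.Basis ι k V) (f : M →+ V) (hf : IsSemilinear R.aug f) (hA : IsEquivariant f)
    (hv : ∀ i, f (b i) = v i) : Lift V R :=
  letI : Algebra R k := R.aug.toRingHom.toAlgebra
  { M := M
    free := Module.Free.of_basis b
    finite := Module.Finite.of_basis b
    φ := (show (k ⊗[R] M) ≃ₗ[k] V from (b.baseChange k).equiv v (Equiv.refl ι))
    φ_isHom := by
      let : Module R V := Module.compHom V R.aug.toRingHom
      have : IsScalarTower R k V := ⟨fun r s m => by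
        change (R.aug r * s) • m = R.aug r • (s • m)
        rw [mul_smul]⟩
      let f' : M →ₗ[R] V := { toFun := f, map_add' := f.map_add, map_smul' := hf }
      have h1 : ((b.baseChange k).equiv v (Equiv.refl ι)).toLinearMap = f'.liftBaseChange k := by
        refine (b.baseChange k).ext fun i => ?_
        change ((b.baseChange k).equiv v (Equiv.refl ι)) _ = _
        rw [Module.Basis.equiv_apply, Module.Basis.baseChange_apply,
          LinearMap.liftBaseChange_tmul, one_smul]
        exact (hv i).symm
      intro a x
      change k ⊗[R] M at x
      have h2 : ∀ y : k ⊗[R] M, ((b.baseChange k).equiv v (Equiv.refl ι)).toLinearMap y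
        = f'.liftBaseChange k y := fun y => DFunLike.congr_fun h1 y
      refine (h2 _).trans (Eq.trans ?_ (congrArg (V.act a) (h2 x)).symm)
      change f'.liftBaseChange k ((M.act a).baseChange k x) = V.act a (f'.liftBaseChange k x)
      induction x using TensorProduct.induction_on with
      | zero => simp
      | add x y hx hy => simp only [map_add, hx, hy]
      | tmul s m =>
        rw [LinearMap.baseChange_tmul, LinearMap.liftBaseChange_tmul,
          LinearMap.liftBaseChange_tmul, map_smul]
        exact congrArg (s • ·) (hA a m) }

lemma red_ofRed {ι : Type*} [Finite ι] (M : NUModule k A R) (b : Module.Basis ι R M)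
    (v : Module.Basis ι k V) (f : M →+ V) (hf : IsSemilinear R.aug f) (hA : IsEquivariant f)
    (hv : ∀ i, f (b i) = v i) (m : M) : (ofRed M b v f hf hA hv).red m = f m := by
  let : Algebra R k := R.aug.toRingHom.toAlgebra
  let : Module R V := Module.compHom V R.aug.toRingHom
  let f' : M →ₗ[R] V := { toFun := f, map_add' := f.map_add, map_smul' := hf }
  let g' : M →ₗ[R] V :=
    { toFun := (ofRed M b v f hf hA hv).red
      map_add' := map_add _
      map_smul' := (ofRed M b v f hf hA hv).red_smul }
  have : g' = f' := by
    refine b.ext fun i => ?_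
    change ((b.baseChange k).equiv v (Equiv.refl ι)) ((1 : k) ⊗ₜ[R] b i) = f (b i)
    rw [hv, ← Module.Basis.baseChange_apply (S := k) b, Module.Basis.equiv_apply, Equiv.refl_apply]
  exact DFunLike.congr_fun this m

/-- Linear maps lift to semilinear maps between lifts. -/
lemma exists_semilinear (θ : R →ₐ[k] S) (L : Lift V R) (L' : Lift W S) (g : V →ₗ[k] W) :
    ∃ f : L.M →+ L'.M, IsSemilinear θ f ∧ ∀ m, L'.red (f m) = g (L.red m) := by
  classical
  have := L.finite_of_lift
  let v := Module.finBasis k V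
  obtain ⟨b, hb⟩ := L.exists_basis v
  -- Through `θ` the target becomes an `R`-module, so a map can be prescribed on a lifted basis; its
  -- values are preimages under the reduction.
  let : Module R L'.M := Module.compHom L'.M θ.toRingHom
  choose n hn using fun i => L'.red_surjective (g (v i))
  let F : L.M →ₗ[R] L'.M := b.constr ℕ n
  have hF : IsSemilinear θ (F.toAddMonoidHom : L.M →+ L'.M) := fun r m => F.map_smul r m
  refine ⟨F.toAddMonoidHom, hF, fun m => ?_⟩
  rw [L.red_sum b m, ← b.sum_repr m]
  simp only [map_sum, map_smul, hb]
  refine Finset.sum_congr rfl fun i _ => ?_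
  rw [hF, red_smul, CompleteLocalAlgebra.aug_apply]
  congr 1
  · simp
  · rw [← hn i]
    congr 1
    exact b.constr_basis ℕ n i

lemma exists_linear (L : Lift V R) (L' : Lift W R) (g : V →ₗ[k] W) :
    ∃ f : L.M →ₗ[R] L'.M, ∀ m, L'.red (f m) = g (L.red m) := by
  obtain ⟨f, hf, h⟩ := exists_semilinear (AlgHom.id k R) L L' g
  exact ⟨hf.toLinear, h⟩

end Lift

/-! ### Versality in terms of representatives -/

section Versal

variable {k : Type u} [Field k] {A : Type w} [NonUnitalRing A] [Module k A]
variable {V : NUModule k A k} {R : CompleteLocalAlgebra k}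

open Lift

/-- For a fixed representative, equality of classes is `Induces`, and two morphisms give the same
deformation exactly when they induce a common lift. -/
lemma isVersal_iff (L : Lift V R) : IsVersal V R (Quotient.mk _ L) ↔
    (∀ (S : CompleteLocalAlgebra k) (L' : Lift V S), ∃ θ : R →ₐ[k] S, Induces θ L L') ∧
    ∀ (L' : Lift V (CompleteLocalAlgebra.dualNumber k))
      (θ θ' : R →ₐ[k] CompleteLocalAlgebra.dualNumber k), Induces θ L L' → Induces θ' L L' →
        θ = θ' := by
  constructor
  · rintro ⟨h1, h2, -⟩
    refine ⟨fun S L' => ?_, fun L' θ θ' h h' => h2 ?_⟩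
    · obtain ⟨θ, hθ⟩ := h1 S (Quotient.mk _ L')
      exact ⟨θ, (Def.map_eq_iff θ L L').1 hθ⟩
    · exact ((Def.map_eq_iff θ L L').2 h).trans ((Def.map_eq_iff θ' L L').2 h').symm
  · rintro ⟨h1, h2⟩
    have h3 : ∀ S : CompleteLocalAlgebra k, Function.Surjective fun θ : R →ₐ[k] S =>
        Def.map θ (Quotient.mk _ L : Def V R) := by
      intro S U
      induction U using Quotient.inductionOn with
      | h L' =>
        obtain ⟨θ, hθ⟩ := h1 S L'
        exact ⟨θ, (Def.map_eq_iff θ L L').2 hθ⟩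
    refine ⟨h3, fun θ θ' h => ?_, h3 _⟩
    exact h2 (L.map θ') θ θ' ((Def.map_eq_iff θ L _).1 h) (induces_map θ' L)

lemma isUniversal_iff (L : Lift V R) : IsUniversal V R (Quotient.mk _ L) ↔
    (∀ (S : CompleteLocalAlgebra k) (L' : Lift V S), ∃ θ : R →ₐ[k] S, Induces θ L L') ∧
    ∀ (S : CompleteLocalAlgebra k) (L' : Lift V S)
      (θ θ' : R →ₐ[k] S), Induces θ L L' → Induces θ' L L' → θ = θ' := by
  constructor
  · intro h
    refine ⟨fun S L' => ?_, fun S L' θ θ' h1 h' => (h S).1 ?_⟩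
    · obtain ⟨θ, hθ⟩ := (h S).2 (Quotient.mk _ L')
      exact ⟨θ, (Def.map_eq_iff θ L L').1 hθ⟩
    · exact ((Def.map_eq_iff θ L L').2 h1).trans ((Def.map_eq_iff θ' L L').2 h').symm
  · rintro ⟨h1, h2⟩ S
    refine ⟨fun θ θ' h => ?_, fun U => ?_⟩
    · exact h2 S (L.map θ') θ θ' ((Def.map_eq_iff θ L _).1 h) (induces_map θ' L)
    · induction U using Quotient.inductionOn with
      | h L' =>
        obtain ⟨θ, hθ⟩ := h1 S L'
        exact ⟨θ, (Def.map_eq_iff θ L L').2 hθ⟩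

lemma IsUniversal.isVersal {U : Def V R} (h : IsUniversal V R U) : IsVersal V R U :=
  ⟨fun S => (h S).2, h _⟩

end Versal

/-! ### Tangent spaces and the uniqueness of versal rings -/

/-- A surjective endomorphism of a Noetherian ring is injective. -/
lemma injective_of_surjective_ringHom {R : Type*} [CommRing R] [IsNoetherianRing R]
    (f : R →+* R) (hf : Function.Surjective f) : Function.Injective f := by
  let F : ℕ →o Ideal R :=
    { toFun := fun n => RingHom.ker (f ^ n)
      monotone' := monotone_nat_of_le_succ fun n x hx => by
        rw [RingHom.mem_ker] at hx ⊢
        rw [pow_succ', RingHom.mul_def, RingHom.comp_apply, hx, map_zero] }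
  -- The kernels of the powers of `f` stabilize. If `f ^ n y` is killed by `f`, then `y` lies in the
  -- kernel of `f ^ (n + 1)`, which is that of `f ^ n`.
  obtain ⟨n, hn⟩ := monotone_stabilizes_iff_noetherian.2 ‹IsNoetherianRing R› F
  have hs : ∀ n : ℕ, Function.Surjective (f ^ n : R →+* R) := by
    intro n
    induction n with
    | zero => exact fun x => ⟨x, rfl⟩
    | succ n ih => rw [pow_succ']; exact hf.comp ih
  rw [injective_iff_map_eq_zero]
  intro x hx
  obtain ⟨y, rfl⟩ := hs n x
  have h1 : y ∈ F (n + 1) := by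
    change (f ^ (n + 1)) y = 0
    rw [pow_succ']
    exact hx
  rw [← hn (n + 1) (Nat.le_succ n)] at h1
  exact h1

namespace CompleteLocalAlgebra

variable {k : Type u} [Field k] {R : CompleteLocalAlgebra k}

/-- The homomorphism to the dual numbers given by a tangent vector. -/
noncomputable def tangentHom (D : R →ₗ[k] k) (h1 : D 1 = 0)
    (h2 : ∀ x ∈ (IsLocalRing.maximalIdeal R) ^ 2, D x = 0) :
    R →ₐ[k] dualNumber k :=
  AlgHom.ofLinearMap
    (show R →ₗ[k] TrivSqZeroExt k k from
      { toFun := fun r => TrivSqZeroExt.inl (R.aug r) + TrivSqZeroExt.inr (D r)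
        map_add' := fun x y => by ext <;> simp
        map_smul' := fun c x => by ext <;> simp })
    (by
      change (TrivSqZeroExt.inl (R.aug 1) + TrivSqZeroExt.inr (D 1) : TrivSqZeroExt k k) = 1
      rw [h1, map_one]
      simp)
    (by
      intro x y
      change (TrivSqZeroExt.inl (R.aug (x * y)) + TrivSqZeroExt.inr (D (x * y)) :
        TrivSqZeroExt k k) = (TrivSqZeroExt.inl (R.aug x) + TrivSqZeroExt.inr (D x)) *
          (TrivSqZeroExt.inl (R.aug y) + TrivSqZeroExt.inr (D y))
      have hm : ∀ z : R, z - algebraMap k R (R.aug z) ∈ IsLocalRing.maximalIdeal R := fun z => by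
        rw [← aug_eq_zero_iff, map_sub, aug_algebraMap, sub_self]
      -- Subtracting the constant parts puts both factors in the maximal ideal. That `D` kills their
      -- product is the Leibniz rule.
      have h3 := h2 _ (by rw [pow_two]; exact Ideal.mul_mem_mul (hm x) (hm y))
      have h4 : (x - algebraMap k R (R.aug x)) * (y - algebraMap k R (R.aug y))
          = x * y - R.aug x • y - R.aug y • x + (R.aug x * R.aug y) • (1 : R) := by
        simp only [Algebra.smul_def, map_mul]
        ring
      rw [h4] at h3
      simp only [map_add, map_sub, map_smul, h1, smul_eq_mul, mul_zero, add_zero] at h3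
      ext
      · simp
      · simp
        linear_combination h3)

lemma tangentHom_apply (D : R →ₗ[k] k) (h1 : D 1 = 0)
    (h2 : ∀ x ∈ (IsLocalRing.maximalIdeal R) ^ 2, D x = 0) (r : R) :
    tangentHom D h1 h2 r =
      (TrivSqZeroExt.inl (R.aug r) + TrivSqZeroExt.inr (D r) : TrivSqZeroExt k k) := rfl

/-- A linear functional vanishing on the constants and on the square of the maximal ideal is the
`ε`-component of a morphism to `k[ε]` (`tangentHom`), and such functionals separate the points of
the cotangent space. -/
lemma mem_sq_of_dualNumber_hom {y : R} (hy : y ∈ IsLocalRing.maximalIdeal R)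
    (h : ∀ ξ : R →ₐ[k] dualNumber k, ξ y = 0) : y ∈ (IsLocalRing.maximalIdeal R) ^ 2 := by
  by_contra hn
  let p : Submodule k R := Submodule.span k {1} ⊔
    ((IsLocalRing.maximalIdeal R) ^ 2).restrictScalars k
  have hp : y ∉ p := by
    intro hp
    obtain ⟨a, ha, b, hb, rfl⟩ := Submodule.mem_sup.1 hp
    obtain ⟨c, rfl⟩ := Submodule.mem_span_singleton.1 ha
    have hb' : b ∈ (IsLocalRing.maximalIdeal R) ^ 2 := hb
    have hb2 : R.aug b = 0 := (R.aug_eq_zero_iff b).2 (Ideal.pow_le_self two_ne_zero hb')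
    have h0 := (R.aug_eq_zero_iff _).2 hy
    rw [map_add, map_smul, map_one, hb2, smul_eq_mul, mul_one, add_zero] at h0
    subst h0
    apply hn
    rwa [zero_smul, zero_add]
  obtain ⟨D, hD, hDp⟩ := Submodule.exists_le_ker_of_notMem hp
  have h1 : D 1 = 0 := hDp ((le_sup_left : _ ≤ p) (Submodule.mem_span_singleton_self 1))
  have h2 : ∀ x ∈ (IsLocalRing.maximalIdeal R) ^ 2, D x = 0 := fun x hx =>
    hDp ((le_sup_right : _ ≤ p) hx)
  have h3 := h (tangentHom D h1 h2)
  rw [tangentHom_apply] at h3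
  have h4 := congrArg TrivSqZeroExt.snd h3
  apply hD
  change TrivSqZeroExt.snd (TrivSqZeroExt.inl (R.aug y) + TrivSqZeroExt.inr (D y) :
    TrivSqZeroExt k k) = 0 at h4
  simpa using h4

/-- An endomorphism which is the identity on the tangent space is bijective. -/
lemma bijective_of_tangent (η : R →ₐ[k] R)
    (h : ∀ ξ : R →ₐ[k] dualNumber k, ξ.comp η = ξ) : Function.Bijective η := by
  have hm : ∀ x ∈ IsLocalRing.maximalIdeal R, η x ∈ IsLocalRing.maximalIdeal R := fun x hx => by
    rw [← aug_eq_zero_iff, aug_apply, aug_eq_zero_iff]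
    exact hx
  have h1 : (IsLocalRing.maximalIdeal R).map η.toRingHom = IsLocalRing.maximalIdeal R := by
    apply le_antisymm
    · rw [Ideal.map_le_iff_le_comap]
      exact hm
    -- Nakayama's lemma: `η x - x` lies in the square of the maximal ideal, so the images of its
    -- elements generate that ideal modulo its square.
    · apply Submodule.le_of_le_smul_of_le_jacobson_bot
        (I := IsLocalRing.maximalIdeal R) (IsNoetherian.noetherian _)
        (IsLocalRing.maximalIdeal_le_jacobson _)
      intro x hx
      have h2 : η x - x ∈ (IsLocalRing.maximalIdeal R) ^ 2 := by
        apply mem_sq_of_dualNumber_hom (sub_mem (hm x hx) hx)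
        intro ξ
        rw [map_sub, sub_eq_zero]
        exact DFunLike.congr_fun (h ξ) x
      rw [show x = η x - (η x - x) by ring]
      refine Submodule.sub_mem _ (Submodule.mem_sup_left (Ideal.mem_map_of_mem _ hx))
        (Submodule.mem_sup_right ?_)
      rwa [smul_eq_mul, ← pow_two]
  have hs : Function.Surjective η := by
    have : IsHausdorff ((IsLocalRing.maximalIdeal R).map η.toRingHom) R := by
      rw [h1]
      infer_instance
    -- By completeness it suffices to be surjective modulo the extended maximal ideal, where the
    -- constants are enough.
    refine surjective_of_mk_map_comp_surjective (I := IsLocalRing.maximalIdeal R) η.toRingHom ?_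
    intro y
    obtain ⟨y, rfl⟩ := Ideal.Quotient.mk_surjective y
    refine ⟨algebraMap k R (R.aug y), ?_⟩
    change Ideal.Quotient.mk _ (η (algebraMap k R (R.aug y))) = _
    rw [Ideal.Quotient.eq, h1, ← aug_eq_zero_iff, map_sub, AlgHom.commutes, aug_algebraMap,
      sub_self]
  exact ⟨injective_of_surjective_ringHom η.toRingHom hs, hs⟩

end CompleteLocalAlgebra

section Versal

variable {k : Type u} [Field k] {A : Type w} [NonUnitalRing A] [Module k A]
variable {V : NUModule k A k} {R R' : CompleteLocalAlgebra k}

open Lift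

/-- Both `ξ ∘ η` and `ξ` induce `L.map ξ`, so uniqueness over `k[ε]` makes `η` act as the identity
on tangent vectors. -/
lemma bijective_of_induces_self {L : Lift V R} (h : IsVersal V R (Quotient.mk _ L))
    {η : R →ₐ[k] R} (hη : Induces η L L) : Function.Bijective η := by
  rw [isVersal_iff] at h
  exact CompleteLocalAlgebra.bijective_of_tangent η fun ξ =>
    h.2 (L.map ξ) _ _ (hη.trans (induces_map ξ L)) (induces_map ξ L)

lemma bijective_of_induces {L : Lift V R} {L' : Lift V R'} (h : IsVersal V R (Quotient.mk _ L))
    (h' : IsVersal V R' (Quotient.mk _ L')) {θ : R →ₐ[k] R'} (hθ : Induces θ L L') :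
    Function.Bijective θ := by
  obtain ⟨θ', hθ'⟩ := ((isVersal_iff L').1 h').1 R L
  have h1 := bijective_of_induces_self h (hθ.trans hθ')
  have h2 := bijective_of_induces_self h' (hθ'.trans hθ)
  exact ⟨Function.Injective.of_comp (f := θ') h1.1, Function.Surjective.of_comp (g := θ') h2.2⟩

lemma IsVersal.nonempty_algEquiv {U : Def V R} {U' : Def V R'} (h : IsVersal V R U)
    (h' : IsVersal V R' U') : Nonempty (R ≃ₐ[k] R') := by
  induction U using Quotient.inductionOn with
  | h L =>
  induction U' using Quotient.inductionOn with
  | h L' =>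
  obtain ⟨θ, hθ⟩ := ((isVersal_iff L).1 h).1 R' L'
  exact ⟨AlgEquiv.ofBijective θ (bijective_of_induces h h' hθ)⟩

/-- The comparison morphism between two versal rings is bijective, so morphisms out of `R'` are
determined by their composites with it, where the universality of `R` applies. -/
lemma IsVersal.isUniversal {U : Def V R} {U' : Def V R'} (h : IsUniversal V R U)
    (h' : IsVersal V R' U') : IsUniversal V R' U' := by
  induction U using Quotient.inductionOn with
  | h L =>
  induction U' using Quotient.inductionOn with
  | h L' =>
  obtain ⟨θ, hθ⟩ := ((isVersal_iff L).1 h.isVersal).1 R' L'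
  have hb := bijective_of_induces h.isVersal h' hθ
  rw [isUniversal_iff]
  refine ⟨((isVersal_iff L').1 h').1, fun S M α β hα hβ => ?_⟩
  have h1 := ((isUniversal_iff L).1 h).2 S M _ _ (hθ.trans hα) (hθ.trans hβ)
  refine AlgHom.ext fun x => ?_
  obtain ⟨y, rfl⟩ := hb.2 x
  exact DFunLike.congr_fun h1 y

end Versal

/-! ### Power series rings and their complete local quotients -/

namespace MvPowerSeries

variable {k : Type u} [Field k] {σ : Type} [Finite σ]

/-- Power series form the completion of the polynomial ring along the ideal of the variables. This
ideal is finitely generated, so the kernel of reduction modulo it is its multiple of the completion.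
-/
lemma mem_span_X_of_constantCoeff {f : MvPowerSeries σ k} (hf : constantCoeff f = 0) :
    f ∈ (Ideal.span (Set.range X) : Ideal (MvPowerSeries σ k)) := by
  let e := toAdicCompletionAlgEquiv σ k
  have h1 : e f ∈ (AdicCompletion.eval (MvPolynomial.idealOfVars σ k)
      (MvPolynomial σ k) 1).ker := by
    rw [LinearMap.mem_ker]
    change (toAdicCompletion σ k f).val 1 = 0
    rw [toAdicCompletion_apply_eq_mk_truncTotal]
    have h2 : truncTotal 1 f = 0 := by
      ext d
      by_cases hd : Finsupp.degree d < 1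
      · rw [coeff_truncTotal _ hd]
        have : d = 0 := by
          rw [Nat.lt_one_iff] at hd
          exact (Finsupp.degree_eq_zero_iff d).1 hd
        subst this
        simpa using hf
      · rw [coeff_truncTotal_eq_zero _ (not_lt.1 hd)]
        simp
    rw [h2]
    exact map_zero _
  rw [← AdicCompletion.pow_smul_top_eq_ker_eval (MvPolynomial.idealOfVars_fg σ k), pow_one] at h1
  rw [← e.symm_apply_apply f]
  refine Submodule.smul_induction_on h1 (fun r hr y _ => ?_) fun x y hx hy => ?_
  · rw [map_smul]
    have h3 : (r : MvPowerSeries σ k) ∈ (Ideal.span (Set.range X) : Ideal (MvPowerSeries σ k)) := by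
      have h4 := Ideal.mem_map_of_mem (MvPolynomial.coeToMvPowerSeries.ringHom (R := k)) hr
      rw [Ideal.map_span, ← Set.range_comp] at h4
      have h5 : (MvPolynomial.coeToMvPowerSeries.ringHom (R := k)) ∘ MvPolynomial.X =
          (X : σ → MvPowerSeries σ k) := funext fun i => MvPolynomial.coe_X i
      rw [h5] at h4
      exact h4
    rw [Algebra.smul_def]
    exact Ideal.mul_mem_right _ _ h3
  · rw [map_add]
    exact Ideal.add_mem _ hx hy

lemma maximalIdeal_eq_span_X :
    IsLocalRing.maximalIdeal (MvPowerSeries σ k) = Ideal.span (Set.range X) := by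
  apply le_antisymm
  · intro f hf
    apply mem_span_X_of_constantCoeff
    rw [IsLocalRing.mem_maximalIdeal, mem_nonunits_iff, isUnit_iff_constantCoeff,
      isUnit_iff_ne_zero, not_not] at hf
    exact hf
  · rw [Ideal.span_le]
    rintro _ ⟨i, rfl⟩
    rw [SetLike.mem_coe, IsLocalRing.mem_maximalIdeal, mem_nonunits_iff, isUnit_iff_constantCoeff]
    simp

instance isAdicComplete_maximalIdeal : IsAdicComplete
    (IsLocalRing.maximalIdeal (MvPowerSeries σ k)) (MvPowerSeries σ k) := by
  rw [maximalIdeal_eq_span_X]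
  infer_instance

end MvPowerSeries

namespace CompleteLocalAlgebra

variable {k : Type u} [Field k]

open MvPowerSeries in
/-- Power series can be evaluated at elements of the maximal ideal of a complete local algebra. -/
lemma exists_aeval {σ : Type} [Finite σ] (S : CompleteLocalAlgebra k) (x : σ → S)
    (hx : ∀ i, x i ∈ IsLocalRing.maximalIdeal S) :
    ∃ θ : MvPowerSeries σ k →ₐ[k] S,
      ∀ p : MvPolynomial σ k, θ p = MvPolynomial.aeval x p := by
  -- With `k` discrete and `S` adic, elements of the maximal ideal are topologically nilpotent, as
  -- the evaluation of power series requires.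
  let : UniformSpace k := ⊥
  have : DiscreteUniformity k := ⟨rfl⟩
  have : DiscreteTopology k := inferInstance
  let : WithIdeal S := ⟨IsLocalRing.maximalIdeal S⟩
  have hadic : IsAdic (IsLocalRing.maximalIdeal S) := rfl
  have hc := hadic.isAdicComplete_iff.1 S.isAdicComplete
  have := hc.1
  have := hc.2
  have : IsLinearTopology S S := inferInstance
  have : ContinuousSMul k S := continuousSMul_of_algebraMap k S continuous_of_discreteTopology
  have hev : HasEval x := by
    refine ⟨fun i => ?_, ?_⟩
    · refine (hadic.hasBasis_nhds_zero.tendsto_right_iff).2 fun n _ => ?_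
      filter_upwards [Filter.eventually_ge_atTop n] with m hm
      exact Ideal.pow_le_pow_right hm (Ideal.pow_mem_pow (hx i) m)
    · rw [Filter.cofinite_eq_bot]
      exact Filter.tendsto_bot
  exact ⟨aeval hev, fun p => aeval_coe hev p⟩

/-- The quotient of a complete local algebra by a proper ideal. -/
noncomputable def quotient (R : Type u) [CommRing R] [Algebra k R] [IsLocalRing R]
    [IsNoetherianRing R] [IsAdicComplete (IsLocalRing.maximalIdeal R) R]
    (hR : Function.Surjective (algebraMap k (IsLocalRing.ResidueField R)))
    (J : Ideal R) (hJ : J ≠ ⊤) : CompleteLocalAlgebra k :=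
  haveI : Nontrivial (R ⧸ J) := Ideal.Quotient.nontrivial_iff.2 hJ
  haveI hloc : IsLocalRing (R ⧸ J) :=
    IsLocalRing.of_surjective' (Ideal.Quotient.mk J) Ideal.Quotient.mk_surjective
  { carrier := R ⧸ J
    isLocalRing := hloc
    isAdicComplete := by
      have hmap : (IsLocalRing.maximalIdeal R).map (algebraMap R (R ⧸ J)) =
          IsLocalRing.maximalIdeal (R ⧸ J) :=
        IsLocalRing.map_maximalIdeal_of_surjective _ Ideal.Quotient.mk_surjective
      rw [← hmap, IsAdicComplete.map_algebraMap_iff]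
      -- Convergence of Cauchy sequences passes to the quotient because adic completion preserves
      -- surjections.
      have h1 : IsPrecomplete (IsLocalRing.maximalIdeal R) (R ⧸ J) := by
        rw [← AdicCompletion.of_surjective_iff]
        intro y
        obtain ⟨x, rfl⟩ := AdicCompletion.map_surjective (IsLocalRing.maximalIdeal R)
          (f := (Ideal.Quotient.mkₐ R J).toLinearMap) Ideal.Quotient.mk_surjective y
        obtain ⟨z, rfl⟩ := AdicCompletion.of_surjective (IsLocalRing.maximalIdeal R) R x
        exact ⟨_, (AdicCompletion.map_of _ _ z).symm⟩
      exact { }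
    residue_bijective := by
      refine ⟨(algebraMap k _).injective, fun y => ?_⟩
      obtain ⟨y, rfl⟩ := IsLocalRing.residue_surjective y
      obtain ⟨y, rfl⟩ := Ideal.Quotient.mk_surjective y
      obtain ⟨c, hc⟩ := hR (IsLocalRing.residue R y)
      refine ⟨c, ?_⟩
      have hc' : IsLocalRing.residue R (algebraMap k R c) = IsLocalRing.residue R y := hc
      rw [← sub_eq_zero, ← map_sub, IsLocalRing.residue_eq_zero_iff] at hc'
      change IsLocalRing.residue (R ⧸ J) (Ideal.Quotient.mk J (algebraMap k R c)) = _
      rw [← sub_eq_zero, ← map_sub, ← map_sub, IsLocalRing.residue_eq_zero_iff]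
      have hmap : (IsLocalRing.maximalIdeal R).map (Ideal.Quotient.mk J) =
          IsLocalRing.maximalIdeal (R ⧸ J) :=
        IsLocalRing.map_maximalIdeal_of_surjective _ Ideal.Quotient.mk_surjective
      rw [← hmap]
      exact Ideal.mem_map_of_mem _ hc' }

/-- Polynomial equations which are satisfied at the origin have a universal solution with
coordinates in the maximal ideal of a complete local algebra. -/
theorem exists_universal_solution {σ : Type} [Finite σ] (rel : Set (MvPolynomial σ k))
    (hrel : ∀ p ∈ rel, MvPolynomial.constantCoeff p = 0) :
    ∃ (R : CompleteLocalAlgebra k) (X : σ → R), (∀ i, X i ∈ IsLocalRing.maximalIdeal R) ∧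
      (∀ p ∈ rel, MvPolynomial.aeval X p = 0) ∧
      (∀ (S : CompleteLocalAlgebra k) (x : σ → S), (∀ i, x i ∈ IsLocalRing.maximalIdeal S) →
        (∀ p ∈ rel, MvPolynomial.aeval x p = 0) → ∃ θ : R →ₐ[k] S, ∀ i, θ (X i) = x i) ∧
      ∀ (S : CompleteLocalAlgebra k) (θ θ' : R →ₐ[k] S), (∀ i, θ (X i) = θ' (X i)) → θ = θ' := by
  let P := MvPowerSeries σ k
  let ι : MvPolynomial σ k →ₐ[k] P := MvPolynomial.coeToMvPowerSeries.algHom k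
  have hι : ∀ p : MvPolynomial σ k, ι p = (p : MvPowerSeries σ k) := fun p => by
    change MvPowerSeries.map (algebraMap k k) (p : MvPowerSeries σ k) = _
    ext d
    simp
  let J : Ideal P := Ideal.span (ι '' rel)
  have hJ : J ≤ IsLocalRing.maximalIdeal P := by
    rw [Ideal.span_le]
    rintro _ ⟨p, hp, rfl⟩
    rw [SetLike.mem_coe, IsLocalRing.mem_maximalIdeal, mem_nonunits_iff,
      MvPowerSeries.isUnit_iff_constantCoeff]
    have : MvPowerSeries.constantCoeff (ι p) = 0 := by
      rw [hι, ← hrel p hp, ← MvPowerSeries.coeff_zero_eq_constantCoeff_apply,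
        MvPolynomial.coeff_coe, MvPolynomial.constantCoeff_eq]
    rw [this]
    exact not_isUnit_zero
  have hres : Function.Surjective (algebraMap k (IsLocalRing.ResidueField P)) := by
    intro y
    obtain ⟨y, rfl⟩ := IsLocalRing.residue_surjective y
    refine ⟨MvPowerSeries.constantCoeff y, ?_⟩
    change IsLocalRing.residue P (algebraMap k P _) = _
    rw [← sub_eq_zero, ← map_sub, IsLocalRing.residue_eq_zero_iff,
      MvPowerSeries.maximalIdeal_eq_span_X]
    apply MvPowerSeries.mem_span_X_of_constantCoeff
    rw [map_sub, MvPowerSeries.algebraMap_apply]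
    simp
  have hJ' : J ≠ ⊤ := fun h => (IsLocalRing.maximalIdeal.isMaximal P).ne_top
    (top_le_iff.1 (h ▸ hJ))
  let R : CompleteLocalAlgebra k := quotient P hres J hJ'
  let π : P →ₐ[k] R := Ideal.Quotient.mkₐ k J
  have hπ : Function.Surjective π := Ideal.Quotient.mk_surjective
  let X : σ → R := fun i => π (MvPowerSeries.X i)
  have hX : ∀ p, MvPolynomial.aeval X p = π (ι p) := by
    intro p
    have : (MvPolynomial.aeval X : MvPolynomial σ k →ₐ[k] R) = π.comp ι := by
      refine MvPolynomial.algHom_ext fun i => ?_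
      rw [MvPolynomial.aeval_X, AlgHom.comp_apply, hι, MvPolynomial.coe_X]
    exact DFunLike.congr_fun this p
  have hmax : IsLocalRing.maximalIdeal R = Ideal.span (Set.range X) := by
    have h1 : (IsLocalRing.maximalIdeal P).map π = IsLocalRing.maximalIdeal R :=
      IsLocalRing.map_maximalIdeal_of_surjective _ hπ
    rw [← h1, MvPowerSeries.maximalIdeal_eq_span_X, Ideal.map_span, ← Set.range_comp]
    rfl
  refine ⟨R, X, fun i => ?_, fun p hp => ?_, fun S x hx hxrel => ?_, fun S θ θ' h => ?_⟩
  · rw [hmax]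
    exact Ideal.subset_span ⟨i, rfl⟩
  · rw [hX]
    exact Ideal.Quotient.eq_zero_iff_mem.2 (Ideal.subset_span ⟨p, hp, rfl⟩)
  · obtain ⟨θ, hθ⟩ := exists_aeval S x hx
    have hθJ : ∀ a ∈ J, θ a = 0 := by
      intro a ha
      have : J ≤ RingHom.ker θ := by
        rw [Ideal.span_le]
        rintro _ ⟨p, hp, rfl⟩
        exact (hθ p).trans (hxrel p hp)
      exact this ha
    refine ⟨Ideal.Quotient.liftₐ J θ hθJ, fun i => ?_⟩
    change θ (MvPowerSeries.X i) = x i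
    rw [← MvPolynomial.coe_X, hθ, MvPolynomial.aeval_X]
  -- Morphisms that agree on generators of the maximal ideal of `R` agree modulo every power of that
  -- of `S`, by induction on the power. Separatedness of `S` then gives equality.
  · have key : ∀ n : ℕ, ∀ r : R, θ r - θ' r ∈ (IsLocalRing.maximalIdeal S) ^ n := by
      have hloc : ∀ (η : R →ₐ[k] S) (r : R), r ∈ IsLocalRing.maximalIdeal R →
          η r ∈ IsLocalRing.maximalIdeal S := fun η r hr => by
        rw [← aug_eq_zero_iff, aug_apply, aug_eq_zero_iff]
        exact hr
      intro n
      induction n with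
      | zero => intro r; simp
      | succ n ih =>
        have hm : ∀ r ∈ IsLocalRing.maximalIdeal R,
            θ r - θ' r ∈ (IsLocalRing.maximalIdeal S) ^ (n + 1) := by
          intro r hr
          rw [hmax] at hr
          induction hr using Submodule.span_induction with
          | mem x hx =>
            obtain ⟨i, rfl⟩ := hx
            rw [h, sub_self]
            exact zero_mem _
          | zero => simp
          | add x y _ _ hx hy =>
            rw [map_add, map_add, add_sub_add_comm]
            exact add_mem hx hy
          | smul a x hx' hx =>
            rw [smul_eq_mul, map_mul, map_mul,
              show θ a * θ x - θ' a * θ' x = (θ a - θ' a) * θ x + θ' a * (θ x - θ' x) by ring]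
            refine add_mem ?_ (Ideal.mul_mem_left _ _ hx)
            rw [pow_succ]
            exact Ideal.mul_mem_mul (ih a) (hloc θ x (hmax ▸ hx'))
        intro r
        have h1 := hm (r - algebraMap k R (R.aug r)) (by
          rw [← aug_eq_zero_iff, map_sub, aug_algebraMap, sub_self])
        rw [map_sub, map_sub, AlgHom.commutes, AlgHom.commutes, sub_sub_sub_cancel_right] at h1
        exact h1
    refine AlgHom.ext fun r => ?_
    rw [← sub_eq_zero]
    refine IsHausdorff.haus (I := IsLocalRing.maximalIdeal S) inferInstance _ fun n => ?_
    rw [SModEq.zero, smul_eq_mul, Ideal.mul_top]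
    exact key n r

end CompleteLocalAlgebra

/-! ### Scalar extension of linear maps between coordinate spaces -/

section CoordinateMaps

variable {k : Type u} [Field k] {α β γ : Type} [Fintype α] [DecidableEq α]
  [Fintype β] [DecidableEq β] [Fintype γ] [DecidableEq γ]

/-- A linear map between finite dimensional vector spaces has a generalized inverse. -/
lemma LinearMap.exists_generalized_inverse {E F : Type*} [AddCommGroup E] [Module k E]
    [AddCommGroup F] [Module k F] (f : E →ₗ[k] F) :
    ∃ g : F →ₗ[k] E, f ∘ₗ g ∘ₗ f = f ∧ g ∘ₗ f ∘ₗ g = g := by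
  obtain ⟨h, hh⟩ := f.rangeRestrict.exists_rightInverse_of_surjective f.range_rangeRestrict
  obtain ⟨g0, hg0⟩ := LinearMap.exists_extend h
  have h1 : ∀ x, f (g0 (f x)) = f x := fun x => by
    have h2 : g0 (f x) = h (f.rangeRestrict x) := DFunLike.congr_fun hg0 (f.rangeRestrict x)
    rw [h2]
    exact congrArg Subtype.val (DFunLike.congr_fun hh (f.rangeRestrict x))
  -- The map `g0` is only known to satisfy `f g0 f = f`; sandwiching `f` between two copies of it
  -- yields the second identity too.
  refine ⟨g0 ∘ₗ f ∘ₗ g0, ?_, ?_⟩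
  · ext x
    simp [h1]
  · ext x
    simp [h1]

/-- The extension of scalars of a linear map between coordinate spaces. -/
noncomputable def extendScalars (S : Type*) [CommRing S] [Algebra k S]
    (f : (α → k) →ₗ[k] (β → k)) : (α → S) →ₗ[S] (β → S) :=
  Matrix.toLin' ((LinearMap.toMatrix' f).map (algebraMap k S))

lemma extendScalars_apply (S : Type*) [CommRing S] [Algebra k S]
    (f : (α → k) →ₗ[k] (β → k)) (x : α → S) (b : β) :
    extendScalars S f x b = ∑ a, algebraMap k S (f (Pi.single a 1) b) * x a := by
  simp [extendScalars, Matrix.mulVec, dotProduct, LinearMap.toMatrix'_apply]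

lemma extendScalars_comp (S : Type*) [CommRing S] [Algebra k S]
    (g : (β → k) →ₗ[k] (γ → k)) (f : (α → k) →ₗ[k] (β → k)) (x : α → S) :
    extendScalars S g (extendScalars S f x) = extendScalars S (g ∘ₗ f) x := by
  simp only [extendScalars, LinearMap.toMatrix'_comp, Matrix.map_mul, Matrix.toLin'_mul,
    LinearMap.comp_apply]

lemma extendScalars_map {R S : Type*} [CommRing R] [Algebra k R] [CommRing S] [Algebra k S]
    (θ : R →ₐ[k] S) (f : (α → k) →ₗ[k] (β → k)) (x : α → R) (b : β) :
    θ (extendScalars R f x b) = extendScalars S f (fun a => θ (x a)) b := by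
  simp [extendScalars_apply]

lemma extendScalars_mem {S : Type*} [CommRing S] [Algebra k S] (I : Ideal S)
    (f : (α → k) →ₗ[k] (β → k)) {x : α → S} (hx : ∀ a, x a ∈ I) (b : β) :
    extendScalars S f x b ∈ I := by
  rw [extendScalars_apply]
  exact sum_mem fun a _ => I.mul_mem_left _ (hx a)

lemma eq_extendScalars {S : Type*} [CommRing S] [Algebra k S] (f : (α → k) →ₗ[k] (β → k))
    (F : (α → S) →ₗ[S] (β → S))
    (h : ∀ a b, F (Pi.single a 1) b = algebraMap k S (f (Pi.single a 1) b)) :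
    F = extendScalars S f := by
  refine (Pi.basisFun S α).ext fun a => ?_
  ext b
  rw [Pi.basisFun_apply, h, extendScalars_apply]
  simp [Pi.single_apply]

end CoordinateMaps

/-! ### Matrices with entries in an ideal -/

section MatrixIdeal

variable {S : Type*} [CommRing S] {n : Type} [Fintype n] [DecidableEq n]

/-- All entries of the matrix lie in the ideal. -/
def MatIn (I : Ideal S) (M : Matrix n n S) : Prop := ∀ i j, M i j ∈ I

namespace MatIn

variable {I J : Ideal S} {M N : Matrix n n S}

lemma mono (h : MatIn I M) (hIJ : I ≤ J) : MatIn J M := fun i j => hIJ (h i j)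
lemma add (h : MatIn I M) (h' : MatIn I N) : MatIn I (M + N) := fun i j =>
    I.add_mem (h i j) (h' i j)
lemma sub (h : MatIn I M) (h' : MatIn I N) : MatIn I (M - N) := fun i j =>
    I.sub_mem (h i j) (h' i j)
lemma neg (h : MatIn I M) : MatIn I (-M) := fun i j => I.neg_mem (h i j)
lemma mul (h : MatIn I M) (h' : MatIn J N) : MatIn (I * J) (M * N) := fun i j => by
  rw [Matrix.mul_apply]
  exact sum_mem fun l _ => Ideal.mul_mem_mul (h i l) (h' l j)
lemma mul_left (h : MatIn I M) (N : Matrix n n S) : MatIn I (N * M) := fun i j => by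
  rw [Matrix.mul_apply]
  exact sum_mem fun l _ => I.mul_mem_left _ (h l j)
lemma mul_right (h : MatIn I M) (N : Matrix n n S) : MatIn I (M * N) := fun i j => by
  rw [Matrix.mul_apply]
  exact sum_mem fun l _ => I.mul_mem_right _ (h i l)
lemma mul_pow {j : ℕ} (h : MatIn (I ^ j) M) (h' : MatIn I N) : MatIn (I ^ (j + 1)) (M * N) := by
  rw [pow_succ]; exact h.mul h'
lemma pow_mul {j : ℕ} (h : MatIn I M) (h' : MatIn (I ^ j) N) : MatIn (I ^ (j + 1)) (M * N) := by
  rw [pow_succ']; exact h.mul h'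

end MatIn

/-- With `Δ = u - u'` the difference is `Δ M u⁻¹ - u' M u'⁻¹ Δ u⁻¹`. Conjugation is therefore
adically continuous, which permits passing to a limit of conjugators. -/
lemma matIn_conj_sub {I : Ideal S} {u u' : (Matrix n n S)ˣ}
    (h : MatIn I ((u : Matrix n n S) - (u' : Matrix n n S))) (M : Matrix n n S) :
    MatIn I ((u : Matrix n n S) * M * (↑u⁻¹ : Matrix n n S) -
      (u' : Matrix n n S) * M * (↑u'⁻¹ : Matrix n n S)) := by
  have e : (u : Matrix n n S) * M * (↑u⁻¹ : Matrix n n S) -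
      (u' : Matrix n n S) * M * (↑u'⁻¹ : Matrix n n S) =
      ((u : Matrix n n S) - (u' : Matrix n n S)) * (M * (↑u⁻¹ : Matrix n n S)) -
        ((u' : Matrix n n S) * M * (↑u'⁻¹ : Matrix n n S)) *
          (((u : Matrix n n S) - (u' : Matrix n n S)) * (↑u⁻¹ : Matrix n n S)) := by
    simp only [sub_mul, mul_sub, mul_assoc, Units.mul_inv, mul_one, Units.inv_mul_cancel_left]
    abel
  rw [e]
  exact (h.mul_right _).sub ((h.mul_right _).mul_left _)

end MatrixIdeal

namespace CompleteLocalAlgebra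

variable {k : Type u} [Field k] (S : CompleteLocalAlgebra k) {n : Type} [Fintype n] [DecidableEq n]

lemma matIn_iff (M : Matrix n n S) :
    MatIn (IsLocalRing.maximalIdeal S) M ↔ S.aug.mapMatrix M = 0 := by
  simp only [MatIn, ← aug_eq_zero_iff, ← Matrix.ext_iff, AlgHom.mapMatrix_apply, Matrix.map_apply,
    Matrix.zero_apply]

lemma isUnit_of_mapMatrix {M : Matrix n n S} (h : S.aug.mapMatrix M = 1) : IsUnit M := by
  rw [Matrix.isUnit_iff_isUnit_det]
  apply S.isUnit_of_aug_ne_zero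
  rw [AlgHom.map_det, h, Matrix.det_one]
  exact one_ne_zero

lemma mapMatrix_inv {u : (Matrix n n S)ˣ} (h : S.aug.mapMatrix (u : Matrix n n S) = 1) :
    S.aug.mapMatrix (↑u⁻¹ : Matrix n n S) = 1 := by
  have h1 : S.aug.mapMatrix ((u : Matrix n n S) * (↑u⁻¹ : Matrix n n S)) = 1 := by
    rw [Units.mul_inv, map_one]
  rwa [map_mul, h, one_mul] at h1

lemma eq_zero_of_forall_mem_pow {x : S} (h : ∀ j, x ∈ (IsLocalRing.maximalIdeal S) ^ j) :
    x = 0 := by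
  refine IsHausdorff.haus (I := IsLocalRing.maximalIdeal S) inferInstance _ fun j => ?_
  rw [SModEq.zero, smul_eq_mul, Ideal.mul_top]
  exact h j

lemma exists_limit {ι : Type*} (f : ℕ → ι → S)
    (hf : ∀ j i, f (j + 1) i - f j i ∈ (IsLocalRing.maximalIdeal S) ^ j) :
    ∃ g : ι → S, ∀ j i, g i - f j i ∈ (IsLocalRing.maximalIdeal S) ^ j := by
  have h1 : ∀ i, ∃ y : S, ∀ j, f j i ≡ y [SMOD ((IsLocalRing.maximalIdeal S) ^ j • ⊤ : Ideal S)] :=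
      by
    intro i
    refine IsPrecomplete.prec (I := IsLocalRing.maximalIdeal S) inferInstance ?_
    intro a b hab
    induction b, hab using Nat.le_induction with
    | base => exact SModEq.refl _
    | succ b hab ih =>
      refine ih.trans (SModEq.symm ?_)
      rw [SModEq.sub_mem, smul_eq_mul, Ideal.mul_top]
      exact Ideal.pow_le_pow_right hab (hf b i)
  choose g hg using h1
  refine ⟨g, fun j i => ?_⟩
  have := (hg i j).symm
  rwa [SModEq.sub_mem, smul_eq_mul, Ideal.mul_top] at this

end CompleteLocalAlgebra

/-! ### The commutator map and slices for simultaneous conjugation -/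

section Slice

variable {k : Type u} [Field k] {n p : Type} [Fintype n] [DecidableEq n] [Fintype p]
  [DecidableEq p]

/-- The commutators `Z B_i - B_i Z`, over an extension of scalars. -/
noncomputable def commutatorMap (B : p → Matrix n n k) (S : Type*) [CommRing S] [Algebra k S] :
    (n × n → S) →ₗ[S] (p × n × n → S) where
  toFun z t := (Matrix.of (fun a b => z (a, b)) * (B t.1).map (algebraMap k S) -
    (B t.1).map (algebraMap k S) * Matrix.of (fun a b => z (a, b))) t.2.1 t.2.2
  map_add' z z' := by
    ext t
    simp only [Matrix.sub_apply, Matrix.mul_apply, Matrix.of_apply, Pi.add_apply, add_mul, mul_add,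
      Finset.sum_add_distrib]
    abel
  map_smul' c z := by
    ext t
    simp only [Matrix.sub_apply, Matrix.mul_apply, Matrix.of_apply, Pi.smul_apply, smul_eq_mul,
      RingHom.id_apply, mul_sub, Finset.mul_sum]
    congr 1
    · exact Finset.sum_congr rfl fun _ _ => by ring
    · exact Finset.sum_congr rfl fun _ _ => by ring

lemma commutatorMap_eq_extendScalars (B : p → Matrix n n k) (S : Type*) [CommRing S]
    [Algebra k S] : commutatorMap B S = extendScalars S (commutatorMap B k) := by
  refine eq_extendScalars _ _ fun a t => ?_
  have h : ∀ c : n × n, (Pi.single a (1 : S) : n × n → S) c =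
      algebraMap k S ((Pi.single a (1 : k) : n × n → k) c) := fun c => by
    by_cases hc : c = a
    · subst hc; simp
    · simp [hc]
  simp only [commutatorMap, LinearMap.coe_mk, AddHom.coe_mk, Matrix.sub_apply, Matrix.mul_apply,
    Matrix.of_apply, Matrix.map_apply, h, map_sub, map_sum, map_mul, Algebra.algebraMap_self,
    RingHom.id_apply]

/-- A tuple of matrices lies in the slice through `B` defined by `q`. -/
def InSlice (B : p → Matrix n n k) (q : (p × n × n → k) →ₗ[k] (n × n → k)) {S : Type*}
    [CommRing S] [Algebra k S] (Y : p → Matrix n n S) : Prop :=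
  extendScalars S q (fun t => (Y t.1 - (B t.1).map (algebraMap k S)) t.2.1 t.2.2) = 0

variable (B : p → Matrix n n k) (q : (p × n × n → k) →ₗ[k] (n × n → k))

namespace CompleteLocalAlgebra

variable (S : CompleteLocalAlgebra k)

local notation "𝔪" => IsLocalRing.maximalIdeal S

/-- The tuple reduces to `B` modulo the maximal ideal. -/
def IsDeformationOf (Y : p → Matrix n n S) : Prop := ∀ i, S.aug.mapMatrix (Y i) = B i

variable {B S}

lemma IsDeformationOf.matIn {Y : p → Matrix n n S} (h : S.IsDeformationOf B Y) (i : p) :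
    MatIn 𝔪 (Y i - (B i).map (algebraMap k S)) := by
  rw [matIn_iff, map_sub, h i]
  ext a b
  simp

lemma IsDeformationOf.conj {Y : p → Matrix n n S} (h : S.IsDeformationOf B Y)
    {u : (Matrix n n S)ˣ} (hu : S.aug.mapMatrix (u : Matrix n n S) = 1) :
    S.IsDeformationOf B fun i => (u : Matrix n n S) * Y i * (↑u⁻¹ : Matrix n n S) := fun i => by
  rw [map_mul, map_mul, hu, S.mapMatrix_inv hu, h i, one_mul, mul_one]

/-- The value of `q` on the displacement of the conjugate of `Y` by `u`. -/
noncomputable def displacement (B : p → Matrix n n k) (q : (p × n × n → k) →ₗ[k] (n × n → k))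
    (Y : p → Matrix n n S) (u : (Matrix n n S)ˣ) : n × n → S :=
  extendScalars S q (fun t => ((u : Matrix n n S) * Y t.1 * (↑u⁻¹ : Matrix n n S) -
    (B t.1).map (algebraMap k S)) t.2.1 t.2.2)

lemma displacement_sub (Y : p → Matrix n n S) (u u' : (Matrix n n S)ˣ) :
    displacement B q Y u - displacement B q Y u' =
      extendScalars S q (fun t => ((u : Matrix n n S) * Y t.1 * (↑u⁻¹ : Matrix n n S) -
        (u' : Matrix n n S) * Y t.1 * (↑u'⁻¹ : Matrix n n S)) t.2.1 t.2.2) := by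
  rw [displacement, displacement, ← map_sub]
  congr 1
  ext t
  simp only [Pi.sub_apply, Matrix.sub_apply]
  ring

/-- A Newton step. Let `y` be the displacement. Conjugation by `1 - y` changes the tuple by minus
the commutators of `y` with `B`, up to one further power of the maximal ideal. As `q δ q = q`,
applying `q` to these commutators returns `y`, which cancels the displacement. -/
lemma exists_conj_step (hq : q ∘ₗ commutatorMap B k ∘ₗ q = q) {Y : p → Matrix n n S}
    (hY : S.IsDeformationOf B Y) {j : ℕ} (u : (Matrix n n S)ˣ)
    (hu : S.aug.mapMatrix (u : Matrix n n S) = 1)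
    (hd : ∀ t, displacement B q Y u t ∈ 𝔪 ^ (j + 1)) :
    ∃ u' : (Matrix n n S)ˣ, S.aug.mapMatrix (u' : Matrix n n S) = 1 ∧
      (∀ t, displacement B q Y u' t ∈ 𝔪 ^ (j + 2)) ∧
      MatIn (𝔪 ^ (j + 1)) ((u' : Matrix n n S) - (u : Matrix n n S)) := by
  set y : Matrix n n S := Matrix.of fun a b => displacement B q Y u (a, b) with hy
  have hyj : MatIn (𝔪 ^ (j + 1)) y := fun a b => hd (a, b)
  have hym : MatIn 𝔪 y := hyj.mono (Ideal.pow_le_self (by omega))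
  have hy0 : S.aug.mapMatrix y = 0 := (S.matIn_iff y).1 hym
  have h1y : S.aug.mapMatrix (1 - y) = 1 := by rw [map_sub, map_one, hy0, sub_zero]
  obtain ⟨w, hw⟩ := S.isUnit_of_mapMatrix h1y
  have hw1 : S.aug.mapMatrix (w : Matrix n n S) = 1 := by rw [hw, h1y]
  refine ⟨w * u, ?_, ?_, ?_⟩
  · rw [Units.val_mul, map_mul, hw1, hu, one_mul]
  · have key : ∀ i, MatIn (𝔪 ^ (j + 2)) (((w * u : (Matrix n n S)ˣ) : Matrix n n S) * Y i *
        (↑(w * u)⁻¹ : Matrix n n S) - (u : Matrix n n S) * Y i * (↑u⁻¹ : Matrix n n S) +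
        (y * (B i).map (algebraMap k S) - (B i).map (algebraMap k S) * y)) := by
      intro i
      set C : Matrix n n S := (u : Matrix n n S) * Y i * (↑u⁻¹ : Matrix n n S) with hC
      set b : Matrix n n S := (B i).map (algebraMap k S) with hb
      have hCb : MatIn 𝔪 (C - b) := (hY.conj hu).matIn i
      have hw2 : MatIn 𝔪 ((↑w⁻¹ : Matrix n n S) - 1) := by
        rw [matIn_iff, map_sub, S.mapMatrix_inv hw1, map_one, sub_self]
      have hyw : y = 1 - (w : Matrix n n S) := by rw [hw]; abel
      -- The exact error term: every product pairs `y`, of order `j + 1`, with a factor in the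
      -- maximal ideal.
      have e : ((w * u : (Matrix n n S)ˣ) : Matrix n n S) * Y i *
          (↑(w * u)⁻¹ : Matrix n n S) - C + (y * b - b * y) =
          ((C - b) * y - y * (C - b)) +
            (C * y - y * C) * ((↑w⁻¹ : Matrix n n S) - 1) := by
        have e1 : ((w * u : (Matrix n n S)ˣ) : Matrix n n S) * Y i *
          (↑(w * u)⁻¹ : Matrix n n S) = (w : Matrix n n S) * C * (↑w⁻¹ : Matrix n n S) := by
          rw [mul_inv_rev, Units.val_mul, Units.val_mul, hC]
          simp only [mul_assoc]
        have e2 : C = C * (w : Matrix n n S) * (↑w⁻¹ : Matrix n n S) := by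
          rw [mul_assoc, Units.mul_inv, mul_one]
        have e3 : (C * y - y * C) * (↑w⁻¹ : Matrix n n S) =
            (w : Matrix n n S) * C * (↑w⁻¹ : Matrix n n S) - C := by
          conv_rhs => rw [e2]
          rw [hyw, ← sub_mul, mul_assoc C _ _, Units.mul_inv, mul_one]
          congr 1
          noncomm_ring
        rw [e1, mul_sub (C * y - y * C), e3]
        noncomm_ring
      rw [e]
      refine ((MatIn.pow_mul hCb hyj).sub (hyj.mul_pow hCb)).add ?_
      exact ((hyj.mul_left C).sub (hyj.mul_right C)).mul_pow hw2
    intro t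
    have e : displacement B q Y (w * u) =
        extendScalars S q (fun t => (((w * u : (Matrix n n S)ˣ) : Matrix n n S) * Y t.1 *
          (↑(w * u)⁻¹ : Matrix n n S) - (u : Matrix n n S) * Y t.1 * (↑u⁻¹ : Matrix n n S) +
        (y * (B t.1).map (algebraMap k S) - (B t.1).map (algebraMap k S) * y)) t.2.1 t.2.2) := by
      -- The displacement is a value of `q`, so `q δ q = q` recovers it from its commutators.
      have e1 : extendScalars S q (commutatorMap B S (displacement B q Y u)) =
          displacement B q Y u := by
        rw [commutatorMap_eq_extendScalars, displacement, extendScalars_comp, extendScalars_comp]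
        exact congrArg (fun f => extendScalars S f _) hq
      have e2 := displacement_sub (B := B) q Y (w * u) u
      rw [sub_eq_iff_eq_add] at e2
      rw [e2]
      rw [← e1]
      rw [← map_add]
      congr 1
    rw [e]
    exact extendScalars_mem _ q (fun t => key t.1 t.2.1 t.2.2) t
  · have e : ((w * u : (Matrix n n S)ˣ) : Matrix n n S) - (u : Matrix n n S) =
        -(y * (u : Matrix n n S)) := by
      rw [Units.val_mul, hw]; noncomm_ring
    rw [e]
    exact (hyj.mul_right _).neg

/-- Every deformation is conjugate to one in the slice. -/
lemma exists_conj_inSlice (hq : q ∘ₗ commutatorMap B k ∘ₗ q = q) {Y : p → Matrix n n S}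
    (hY : S.IsDeformationOf B Y) :
    ∃ u : (Matrix n n S)ˣ, S.aug.mapMatrix (u : Matrix n n S) = 1 ∧
      InSlice B q fun i => (u : Matrix n n S) * Y i * (↑u⁻¹ : Matrix n n S) := by
  -- The `j`-th conjugator leaves a displacement of order `j + 1`. The identity can serve as the
  -- initial term because `Y` reduces to `B`.
  let P : ℕ → Type u := fun j => {u : (Matrix n n S)ˣ //
    S.aug.mapMatrix (u : Matrix n n S) = 1 ∧ ∀ t, displacement B q Y u t ∈ 𝔪 ^ (j + 1)}
  have hstep : ∀ j (u : P j), ∃ u' : P (j + 1),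
      MatIn (𝔪 ^ (j + 1)) ((u'.1 : Matrix n n S) - (u.1 : Matrix n n S)) := by
    rintro j ⟨u, hu, hd⟩
    obtain ⟨u', h1, h2, h3⟩ := exists_conj_step q hq hY u hu hd
    exact ⟨⟨u', h1, h2⟩, h3⟩
  choose next hnext using hstep
  have h0 : ∀ t, displacement B q Y 1 t ∈ 𝔪 ^ (0 + 1) := fun t => by
    rw [zero_add, pow_one]
    refine extendScalars_mem _ q (fun t => ?_) t
    exact (hY.conj (u := 1) (by rw [Units.val_one, map_one])).matIn t.1 t.2.1 t.2.2
  let seq : ∀ j, P j := fun j =>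
    Nat.rec ⟨1, by rw [Units.val_one, map_one], h0⟩ (fun j u => next j u) j
  have hseq : ∀ j, MatIn (𝔪 ^ (j + 1))
      (((seq (j + 1)).1 : Matrix n n S) - ((seq j).1 : Matrix n n S)) := fun j => hnext j (seq j)
  obtain ⟨g, hg⟩ := S.exists_limit
    (fun j (t : n × n) => ((seq j).1 : Matrix n n S) t.1 t.2) fun j t =>
      Ideal.pow_le_pow_right (Nat.le_succ j) (hseq j t.1 t.2)
  let G : Matrix n n S := Matrix.of fun a b => g (a, b)
  have hG : ∀ j, MatIn (𝔪 ^ j) (G - ((seq j).1 : Matrix n n S)) := fun j a b => hg j (a, b)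
  have hG1 : S.aug.mapMatrix G = 1 := by
    have h := hG 1
    rw [pow_one, matIn_iff, map_sub, (seq 1).2.1, sub_eq_zero] at h
    exact h
  obtain ⟨u, hu⟩ := S.isUnit_of_mapMatrix hG1
  refine ⟨u, by rw [hu, hG1], ?_⟩
  ext t
  refine S.eq_zero_of_forall_mem_pow fun j => ?_
  -- The limit differs from the `j`-th conjugator by order `j`, hence so do the displacements.
  have h1 : (displacement B q Y u - displacement B q Y (seq j).1) t ∈ 𝔪 ^ j := by
    rw [displacement_sub]
    refine extendScalars_mem _ q (fun t => ?_) t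
    refine matIn_conj_sub ?_ _ _ _
    rw [hu]
    exact hG j
  have h2 := Ideal.add_mem _ h1
    (Ideal.pow_le_pow_right (Nat.le_succ j) ((seq j).2.2 t))
  rw [Pi.sub_apply, sub_add_cancel] at h2
  exact h2

/-- With `Z = g - 1`, the relation `g Y = Y' g` makes `Y' - Y` agree with the commutators of `Z`
with `B` to order `j + 1`. On the slice `q` kills `Y' - Y`, so `δ = δ q δ` forces these commutators,
and with them `Y' - Y`, to have order `j + 1`. -/
lemma conj_step_of_inSlice (hδ : commutatorMap B k ∘ₗ q ∘ₗ commutatorMap B k = commutatorMap B k)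
    {Y Y' : p → Matrix n n S} (hY : S.IsDeformationOf B Y) (hY' : S.IsDeformationOf B Y')
    (hs : InSlice B q Y) (hs' : InSlice B q Y') {g : Matrix n n S}
    (hg : ∀ i, g * Y i = Y' i * g) {j : ℕ} (hj : MatIn (𝔪 ^ j) (g - 1)) :
    (∀ i, MatIn (𝔪 ^ (j + 1)) (Y' i - Y i)) ∧
      ∀ t, commutatorMap B S (fun t => (g - 1) t.1 t.2) t ∈ 𝔪 ^ (j + 1) := by
  set Z := g - 1 with hZ
  have key : ∀ i, MatIn (𝔪 ^ (j + 1)) ((Y' i - Y i) -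
      (Z * (B i).map (algebraMap k S) - (B i).map (algebraMap k S) * Z)) := by
    intro i
    have e : (Y' i - Y i) -
      (Z * (B i).map (algebraMap k S) - (B i).map (algebraMap k S) * Z) =
      Z * (Y i - (B i).map (algebraMap k S)) - (Y' i - (B i).map (algebraMap k S)) * Z := by
      have h1 : Z * Y i - Y' i * Z = Y' i - Y i := by
        rw [hZ, sub_mul, mul_sub, hg i]; noncomm_ring
      rw [← h1]; noncomm_ring
    rw [e]
    exact (hj.mul_pow (hY.matIn i)).sub (MatIn.pow_mul (hY'.matIn i) hj)
  have h2 : extendScalars S q (fun t => (Y' t.1 - Y t.1) t.2.1 t.2.2) = 0 := by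
    have h3 : extendScalars S q ((fun t => (Y' t.1 - (B t.1).map (algebraMap k S)) t.2.1 t.2.2) -
        fun t => (Y t.1 - (B t.1).map (algebraMap k S)) t.2.1 t.2.2) = 0 := by
      rw [map_sub, hs, hs', sub_zero]
    rw [← h3]
    congr 1
    ext t
    simp only [Pi.sub_apply, Matrix.sub_apply]
    ring
  have h4 : ∀ t, commutatorMap B S (fun t => Z t.1 t.2) t ∈ 𝔪 ^ (j + 1) := by
    let W : p × n × n → S := fun t => ((Y' t.1 - Y t.1) -
      (Z * (B t.1).map (algebraMap k S) - (B t.1).map (algebraMap k S) * Z)) t.2.1 t.2.2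
    have hW : ∀ t, W t ∈ 𝔪 ^ (j + 1) := fun t => key t.1 t.2.1 t.2.2
    have h5 : commutatorMap B S (fun t => Z t.1 t.2) =
        -extendScalars S (commutatorMap B k) (extendScalars S q W) := by
      have h6 : W = (fun t => (Y' t.1 - Y t.1) t.2.1 t.2.2) -
          commutatorMap B S (fun t => Z t.1 t.2) := rfl
      rw [h6, map_sub, h2, zero_sub, map_neg, neg_neg, commutatorMap_eq_extendScalars,
        extendScalars_comp, extendScalars_comp]
      exact congrArg (fun f => extendScalars S f _) hδ.symm
    intro t
    rw [h5]
    have h7 := extendScalars_mem _ (commutatorMap B k) (fun t => extendScalars_mem _ q hW t) t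
    exact (Submodule.neg_mem_iff _).2 h7
  refine ⟨fun i a b => ?_, h4⟩
  have h5 := Ideal.add_mem _ (key i a b) (h4 (i, a, b))
  have h6 : ((Y' i - Y i) -
      (Z * (B i).map (algebraMap k S) - (B i).map (algebraMap k S) * Z)) a b +
      commutatorMap B S (fun t => Z t.1 t.2) (i, a, b) = (Y' i - Y i) a b := by
    exact sub_add_cancel _ _
  rwa [h6] at h5

/-- If the centralizer of `B` lifts to the centralizer of `Y`, conjugate tuples in the slice are
equal. -/
lemma eq_of_inSlice (hδ : commutatorMap B k ∘ₗ q ∘ₗ commutatorMap B k = commutatorMap B k)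
    {Y Y' : p → Matrix n n S} (hY : S.IsDeformationOf B Y) (hY' : S.IsDeformationOf B Y')
    (hs : InSlice B q Y) (hs' : InSlice B q Y') {g : Matrix n n S}
    (hg1 : S.aug.mapMatrix g = 1) (hg : ∀ i, g * Y i = Y' i * g)
    (hend : ∀ C : Matrix n n k, (∀ i, C * B i = B i * C) →
      ∃ H : Matrix n n S, (∀ i, H * Y i = Y i * H) ∧ S.aug.mapMatrix H = C) :
    Y = Y' := by
  -- The projection `1 - q δ` onto the kernel of the commutator map, that is, onto the centralizer
  -- of `B`.
  let ϖ : (n × n → k) →ₗ[k] (n × n → k) := LinearMap.id - q ∘ₗ commutatorMap B k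
  have hϖ : ∀ z, commutatorMap B k (ϖ z) = 0 := fun z => by
    have := DFunLike.congr_fun hδ z
    simp only [LinearMap.comp_apply] at this
    simp [ϖ, this]
  have hc : ∀ t : n × n, ∃ H : Matrix n n S, (∀ i, H * Y i = Y i * H) ∧
      S.aug.mapMatrix H = Matrix.of fun a b => ϖ (Pi.single t 1) (a, b) := fun t => by
    refine hend _ fun i => ?_
    ext a b
    have h := congrFun (hϖ (Pi.single t 1)) (i, a, b)
    have e : (B i).map (algebraMap k k) = B i := by ext; simp
    simp only [commutatorMap, LinearMap.coe_mk, AddHom.coe_mk, e] at h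
    exact sub_eq_zero.1 h
  choose H hHc hHa using hc
  have main : ∀ j : ℕ, ∃ g : Matrix n n S, MatIn (𝔪 ^ (j + 1)) (g - 1) ∧
      ∀ i, g * Y i = Y' i * g := by
    intro j
    induction j with
    | zero =>
      refine ⟨g, ?_, hg⟩
      rw [zero_add, pow_one, matIn_iff, map_sub, hg1, map_one, sub_self]
    | succ j ih =>
      obtain ⟨g, hgj, hg⟩ := ih
      obtain ⟨-, hZ⟩ := conj_step_of_inSlice q hδ hY hY' hs hs' hg hgj
      set Z := g - 1 with hZd
      -- `K` commutes with `Y` and agrees with `ϖ Z` to the next order, while `Z - ϖ Z = q δ Z`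
      -- already has that order. Replacing `g` by `g (1 - K)` therefore gains one order and keeps
      -- the intertwining relation.
      let K : Matrix n n S := ∑ t : n × n, Z t.1 t.2 • H t
      have hKc : ∀ i, K * Y i = Y i * K := fun i => by
        simp only [K, Finset.sum_mul, Finset.mul_sum, Matrix.smul_mul, Matrix.mul_smul, hHc]
      have hK : MatIn (𝔪 ^ (j + 1)) K := fun a b => by
        simp only [K, Matrix.sum_apply, Matrix.smul_apply, smul_eq_mul]
        exact sum_mem fun t _ => Ideal.mul_mem_right _ _ (hgj t.1 t.2)
      have hZK : MatIn (𝔪 ^ (j + 1 + 1)) (Z - K) := by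
        intro a b
        have e1 : extendScalars S ϖ (fun t => Z t.1 t.2) =
            (fun t => Z t.1 t.2) - extendScalars S q (commutatorMap B S fun t => Z t.1 t.2) := by
          rw [commutatorMap_eq_extendScalars, extendScalars_comp]
          simp only [ϖ, extendScalars, map_sub, LinearMap.toMatrix'_id]
          rw [Matrix.map_sub _ (fun a b => map_sub _ a b), map_sub,
            Matrix.map_one _ (map_zero _) (map_one _),
            Matrix.toLin'_one]
          rfl
        have e2 : (Z - K) a b = extendScalars S q (commutatorMap B S fun t => Z t.1 t.2) (a, b) -
            ∑ t : n × n, Z t.1 t.2 * (H t a b - algebraMap k S (ϖ (Pi.single t 1) (a, b))) := by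
          have e3 := congrFun e1 (a, b)
          rw [extendScalars_apply] at e3
          simp only [Pi.sub_apply] at e3
          simp only [Matrix.sub_apply, K, Matrix.sum_apply, Matrix.smul_apply, smul_eq_mul, mul_sub,
            Finset.sum_sub_distrib]
          rw [Finset.sum_congr rfl fun t _ => mul_comm (algebraMap k S (ϖ (Pi.single t 1) (a, b)))
            (Z t.1 t.2)] at e3
          rw [e3]
          ring
        rw [e2]
        refine Ideal.sub_mem _ (extendScalars_mem _ _ hZ _) (sum_mem fun t _ => ?_)
        rw [pow_succ]
        refine Ideal.mul_mem_mul (hgj t.1 t.2) ?_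
        rw [← aug_eq_zero_iff, map_sub, sub_eq_zero]
        have := congrFun (congrFun (hHa t) a) b
        simpa using this
      refine ⟨g * (1 - K), ?_, fun i => ?_⟩
      · have e : g * (1 - K) - 1 = (Z - K) - Z * K := by rw [hZd]; noncomm_ring
        rw [e]
        exact hZK.sub (hgj.mul_pow (hK.mono (Ideal.pow_le_self (by omega))))
      · rw [mul_assoc, sub_mul, one_mul, hKc, ← mul_assoc, ← hg]; noncomm_ring
  funext i
  rw [← sub_eq_zero, ← neg_eq_zero, neg_sub]
  ext a b
  refine S.eq_zero_of_forall_mem_pow fun j => ?_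
  obtain ⟨g, hgj, hg⟩ := main j
  exact Ideal.pow_le_pow_right (by omega)
    ((conj_step_of_inSlice q hδ hY hY' hs hs' hg hgj).1 i a b)

end CompleteLocalAlgebra

end Slice

/-! ### Framed deformations and the existence of versal deformation rings -/

section Chart

open NUModule Lift CompleteLocalAlgebra

variable {k : Type u} [Field k] {A : Type w} [NonUnitalRing A] [Module k A]

/-- Finitely many coordinates on `A` which determine the action on `V` and on all its lifts. -/
structure Chart (V : NUModule k A k) (n p : Type) [DecidableEq p] where
  basis : Module.Basis n k V
  coord : A →ₗ[k] (p → k)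
  gen : p → A
  coord_gen : ∀ i, coord (gen i) = Pi.single i 1
  unit : A
  act_unit : V.act unit = 1
  act_eq_zero : ∀ a, coord a = 0 → V.act a = 0
  lift_act_eq_zero : ∀ (R : CompleteLocalAlgebra k) (L : Lift V R) (a : A),
    coord a = 0 → L.M.act a = 0

lemma CompleteLocalAlgebra.dualNumber_maximalIdeal_sq :
    IsLocalRing.maximalIdeal (dualNumber k) ^ 2 = ⊥ := by
  have hsq : ∀ y ∈ IsLocalRing.maximalIdeal (DualNumber k), TrivSqZeroExt.fst y = 0 := by
    intro y hy
    rw [DualNumber.maximalIdeal_eq_span_singleton_eps, Ideal.mem_span_singleton] at hy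
    exact DualNumber.fst_eq_zero_iff_eps_dvd.2 hy
  have hzero : (IsLocalRing.maximalIdeal (DualNumber k)) ^ 2 = ⊥ := by
    rw [pow_two, eq_bot_iff, Ideal.mul_le]
    intro y hy z hz
    have h1 := hsq y hy
    have h2 := hsq z hz
    rw [Ideal.mem_bot]
    ext <;> simp [h1, h2]
  exact hzero

namespace Chart

variable {V : NUModule k A k} {n p : Type} [Fintype n] [DecidableEq n] [Fintype p] [DecidableEq p]
  (X : Chart V n p)

/-- The action of `a` on `V` in coordinates. -/
noncomputable def mat (a : A) : Matrix n n k := LinearMap.toMatrix X.basis X.basis (V.act a)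

/-- The linear extension of a tuple of matrices along the coordinates. -/
noncomputable def comb {S : Type*} [CommRing S] [Algebra k S] (Y : p → Matrix n n S) :
    A →ₗ[k] Matrix n n S :=
  Fintype.linearCombination k Y ∘ₗ X.coord

lemma comb_apply {S : Type*} [CommRing S] [Algebra k S] (Y : p → Matrix n n S) (a : A) :
    X.comb Y a = ∑ i, X.coord a i • Y i := by
  simp [comb, Fintype.linearCombination_apply]

@[simp] lemma comb_gen {S : Type*} [CommRing S] [Algebra k S] (Y : p → Matrix n n S) (i : p) :
    X.comb Y (X.gen i) = Y i := by
  rw [comb_apply, X.coord_gen, Finset.sum_eq_single i]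
  · simp
  · intro j _ hj; simp [hj]
  · simp

lemma comb_map {S T : Type*} [CommRing S] [Algebra k S] [CommRing T] [Algebra k T]
    (θ : S →ₐ[k] T) (Y : p → Matrix n n S) (a : A) :
    θ.mapMatrix (X.comb Y a) = X.comb (fun i => θ.mapMatrix (Y i)) a := by
  simp only [comb_apply, map_sum, map_smul]

lemma coord_sub_sum (a : A) : X.coord (a - ∑ i, X.coord a i • X.gen i) = 0 := by
  ext j
  simp [X.coord_gen, Pi.single_apply]

lemma act_sum_gen {R : Type u} [CommRing R] [Algebra k R] (M : NUModule k A R)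
    (hM : ∀ a, X.coord a = 0 → M.act a = 0) (a : A) :
    M.act a = ∑ i, algebraMap k R (X.coord a i) • M.act (X.gen i) := by
  have h := hM _ (X.coord_sub_sum a)
  rw [map_sub, map_sum, sub_eq_zero] at h
  rw [h]
  exact Finset.sum_congr rfl fun i _ => M.act_smul _ _

/-- The tuple of matrices of `V`. -/
noncomputable def center (i : p) : Matrix n n k := X.mat (X.gen i)

lemma comb_center (a : A) : X.comb X.center a = X.mat a := by
  rw [comb_apply, mat, X.act_sum_gen V X.act_eq_zero a, map_sum]
  refine Finset.sum_congr rfl fun i _ => ?_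
  rw [map_smul]
  rfl

/-- The tuple of matrices defines a representation. -/
def IsRep {S : Type*} [CommRing S] [Algebra k S] (Y : p → Matrix n n S) : Prop :=
  ∀ a b, X.comb Y (a * b) = X.comb Y a * X.comb Y b

lemma isRep_center : X.IsRep X.center := fun a b => by
  rw [comb_center, comb_center, comb_center, mat, mat, mat, map_mul, Module.End.mul_eq_comp,
    LinearMap.toMatrix_comp X.basis X.basis X.basis]

lemma IsRep.conj {X : Chart V n p} {S : Type*} [CommRing S] [Algebra k S] {Y : p → Matrix n n S}
    (h : X.IsRep Y) (u : (Matrix n n S)ˣ) :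
    X.IsRep fun i => (u : Matrix n n S) * Y i * (↑u⁻¹ : Matrix n n S) := by
  have e : ∀ a, X.comb (fun i => (u : Matrix n n S) * Y i * (↑u⁻¹ : Matrix n n S)) a =
      (u : Matrix n n S) * X.comb Y a * (↑u⁻¹ : Matrix n n S) := fun a => by
    simp only [comb_apply, Finset.mul_sum, Finset.sum_mul, Matrix.mul_smul, Matrix.smul_mul]
  intro a b
  rw [e, e, e, h]
  simp only [mul_assoc, Units.inv_mul_cancel_left]

variable {S : CompleteLocalAlgebra k}

lemma aug_comb {Y : p → Matrix n n S} (hY : S.IsDeformationOf X.center Y) (a : A) :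
    S.aug.mapMatrix (X.comb Y a) = X.mat a := by
  rw [comb_map, ← comb_center]
  congr 2
  exact funext hY

/-- The module given by a tuple of matrices. -/
noncomputable def framedModule {Y : p → Matrix n n S} (hY : S.IsDeformationOf X.center Y)
    (hr : X.IsRep Y) : NUModule k A S where
  carrier := n → S
  act :=
    { toFun := fun a => Matrix.toLin' (X.comb Y a)
      map_mul' := fun a b => by rw [hr, Matrix.toLin'_mul]; rfl
      map_zero' := by rw [map_zero, map_zero]
      map_add' := fun a b => by rw [map_add, map_add] }
  act_smul c a := by
    change Matrix.toLin' (X.comb Y (c • a)) = algebraMap k S c • Matrix.toLin' (X.comb Y a)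
    refine LinearMap.ext fun m => ?_
    change Matrix.mulVec (X.comb Y (c • a)) m = algebraMap k S c • Matrix.mulVec (X.comb Y a) m
    rw [map_smul, ← Matrix.smul_mulVec]
    congr 1
    ext i j
    simp [Algebra.smul_def]
  unital m := by
    refine Submodule.subset_span ⟨X.unit, ?_⟩
    -- The chosen element acts on `V` as the identity, so its matrix is congruent to 1 and hence
    -- invertible.
    have h : IsUnit (X.comb Y X.unit) := by
      refine S.isUnit_of_mapMatrix ?_
      rw [X.aug_comb hY, mat, X.act_unit, LinearMap.toMatrix_one]
    obtain ⟨u, hu⟩ := h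
    refine ⟨Matrix.toLin' (↑u⁻¹ : Matrix n n S) m, ?_⟩
    change Matrix.toLin' (X.comb Y X.unit) _ = m
    rw [← hu, ← LinearMap.comp_apply, ← Matrix.toLin'_mul, Units.mul_inv, Matrix.toLin'_one]
    rfl

/-- The reduction of coordinate vectors. -/
noncomputable def coordRed (S : CompleteLocalAlgebra k) : (n → S) →+ V where
  toFun m := ∑ i, S.aug (m i) • X.basis i
  map_zero' := by simp
  map_add' x y := by simp [add_smul, Finset.sum_add_distrib]

lemma coordRed_apply (m : n → S) : X.coordRed S m = ∑ i, S.aug (m i) • X.basis i := rfl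

lemma coordRed_smul (r : S) (m : n → S) : X.coordRed S (r • m) = S.aug r • X.coordRed S m := by
  simp [coordRed_apply, mul_smul, Finset.smul_sum]

lemma coordRed_single (i : n) : X.coordRed S (Pi.single i 1) = X.basis i := by
  rw [coordRed_apply, Finset.sum_eq_single i]
  · simp
  · intro j _ hj; simp [hj]
  · simp

lemma coordRed_mulVec {Y : p → Matrix n n S} (hY : S.IsDeformationOf X.center Y) (a : A)
    (m : n → S) : X.coordRed S (Matrix.mulVec (X.comb Y a) m) = V.act a (X.coordRed S m) := by
  have h : ∀ i, S.aug (Matrix.mulVec (X.comb Y a) m i) =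
      Matrix.mulVec (X.mat a) (fun j => S.aug (m j)) i := fun i => by
    rw [← X.aug_comb hY]
    simp [Matrix.mulVec, dotProduct]
  have h2 := LinearMap.toMatrix_mulVec_repr X.basis X.basis (V.act a) (X.coordRed S m)
  have h3 : ⇑(X.basis.repr (X.coordRed S m)) = fun j => S.aug (m j) := by
    have h4 := X.basis.equivFun.apply_symm_apply (fun j => S.aug (m j))
    rw [Module.Basis.equivFun_symm_apply] at h4
    exact h4
  rw [h3] at h2
  rw [coordRed_apply]
  simp only [h]
  rw [mat, h2]
  exact X.basis.sum_repr _

/-- The lift given by a tuple of matrices. -/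
noncomputable def framed {Y : p → Matrix n n S} (hY : S.IsDeformationOf X.center Y)
    (hr : X.IsRep Y) : Lift V S :=
  ofRed (X.framedModule hY hr) (Pi.basisFun S n) X.basis (X.coordRed S) X.coordRed_smul
    (X.coordRed_mulVec hY) fun i =>
      (congrArg (X.coordRed S) (Pi.basisFun_apply S n i)).trans (X.coordRed_single i)

lemma framed_red {Y : p → Matrix n n S} (hY : S.IsDeformationOf X.center Y)
    (hr : X.IsRep Y) (m : n → S) :
    (X.framed hY hr).red m = ∑ i, S.aug (m i) • X.basis i :=
  red_ofRed (X.framedModule hY hr) (Pi.basisFun S n) X.basis (X.coordRed S) X.coordRed_smul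
    (X.coordRed_mulVec hY) _ m

variable {R : CompleteLocalAlgebra k}

/-- A semilinear map of coordinate spaces is `x ↦ g θ(x)`, the columns of `g` being the images of
the unit vectors. Compatibility with the reductions means `g ≡ 1`, and equivariance is the
intertwining relation on generators. -/
lemma induces_framed_iff {Y : p → Matrix n n R} (hY : R.IsDeformationOf X.center Y)
    (hr : X.IsRep Y) {Y' : p → Matrix n n S} (hY' : S.IsDeformationOf X.center Y')
    (hr' : X.IsRep Y') (θ : R →ₐ[k] S) :
    Induces θ (X.framed hY hr) (X.framed hY' hr') ↔
      ∃ g : Matrix n n S, S.aug.mapMatrix g = 1 ∧ ∀ i, g * θ.mapMatrix (Y i) = Y' i * g := by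
  constructor
  · rintro ⟨f, hf, hA, hred⟩
    let f' : (n → R) → (n → S) := f
    let g : Matrix n n S := Matrix.of fun i j => f' (Pi.single j 1) i
    have hsum : ∀ (s : Finset n) (h : n → n → R), f' (∑ j ∈ s, h j) = ∑ j ∈ s, f' (h j) :=
      fun s h => map_sum f (fun j => (h j : n → R)) s
    have hfg : ∀ x : n → R, f' x = Matrix.mulVec g (fun j => θ (x j)) := fun x => by
      have hx : x = ∑ j, x j • (Pi.single j (1 : R) : n → R) := by
        ext i; simp [Pi.single_apply]
      conv_lhs => rw [hx]
      rw [hsum]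
      ext i
      rw [Finset.sum_apply, Matrix.mulVec, dotProduct]
      refine Finset.sum_congr rfl fun j _ => ?_
      rw [mul_comm]
      exact congrFun (hf (x j) (Pi.single j 1 : n → R)) i
    refine ⟨g, ?_, fun i => ?_⟩
    · ext i j
      have h := hred (Pi.single j 1 : n → R)
      have h' := (X.framed_red hY' hr' (f' (Pi.single j 1))).symm.trans
        (h.trans (X.framed_red hY hr (Pi.single j 1)))
      have e : ∀ i, S.aug (f' (Pi.single j 1) i) = R.aug ((Pi.single j 1 : n → R) i) := by
        have := X.basis.linearIndependent
        rw [Fintype.linearIndependent_iff] at this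
        intro i
        have h2 := this (fun i => S.aug (f' (Pi.single j 1) i) - R.aug ((Pi.single j 1 : n → R) i))
          (by simp only [sub_smul, Finset.sum_sub_distrib]; rw [h', sub_self]) i
        exact sub_eq_zero.1 h2
      change S.aug (f' (Pi.single j 1) i) = _
      rw [e, Matrix.one_apply]
      by_cases hij : i = j
      · subst hij; simp
      · simp [hij]
    · ext a b
      have h := hA (X.gen i) (Pi.single b 1 : n → R)
      have h' : f' (Matrix.mulVec (X.comb Y (X.gen i)) (Pi.single b 1)) =
          Matrix.mulVec (X.comb Y' (X.gen i)) (f' (Pi.single b 1)) := h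
      rw [comb_gen, comb_gen, hfg] at h'
      have h2 := congrFun h' a
      simp only [Matrix.mulVec_single_one, Matrix.col_apply] at h2
      have h3 : (∑ x, g a x * θ (Y i x b)) = ∑ x, Y' i a x * f' (Pi.single b 1) x := by
        simpa [Matrix.mulVec, dotProduct] using h2
      rw [Matrix.mul_apply, Matrix.mul_apply]
      exact h3
  · rintro ⟨g, hg1, hg⟩
    have hc : ∀ a, g * θ.mapMatrix (X.comb Y a) = X.comb Y' a * g := fun a => by
      rw [comb_map, comb_apply, comb_apply, Finset.mul_sum, Finset.sum_mul]
      exact Finset.sum_congr rfl fun i _ => by rw [Matrix.mul_smul, Matrix.smul_mul, hg]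
    let f : (n → R) →+ (n → S) :=
      { toFun := fun x => Matrix.mulVec g (fun j => θ (x j))
        map_zero' := by ext; simp [Matrix.mulVec, dotProduct]
        map_add' := fun x y => by
          rw [← Matrix.mulVec_add]; congr 1; ext; simp }
    refine ⟨f, fun r m => ?_, fun a m => ?_, fun m => ?_⟩
    · change Matrix.mulVec g (fun j => θ (r * _)) = θ r • Matrix.mulVec g _
      rw [← Matrix.mulVec_smul]
      congr 1
      ext j
      exact map_mul θ r _
    · change Matrix.mulVec g (fun j => θ (Matrix.mulVec (X.comb Y a) m j)) =
        Matrix.mulVec (X.comb Y' a) (Matrix.mulVec g (fun j => θ (m j)))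
      rw [Matrix.mulVec_mulVec, ← hc, ← Matrix.mulVec_mulVec]
      congr 1
      ext j
      simp [Matrix.mulVec, dotProduct]
    · refine (X.framed_red hY' hr' _).trans (Eq.trans ?_ (X.framed_red hY hr m).symm)
      refine Finset.sum_congr rfl fun i _ => ?_
      congr 1
      change S.aug (Matrix.mulVec g (fun j => θ (m j)) i) = R.aug (m i)
      have e : S.aug (Matrix.mulVec g (fun j => θ (m j)) i) =
          Matrix.mulVec (S.aug.mapMatrix g) (fun j => R.aug (m j)) i := by
        simp [Matrix.mulVec, dotProduct, aug_apply]
      rw [e, hg1, Matrix.one_mulVec]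

/-- In a basis lifting that of `V` the action is given by matrices; the coordinate isomorphism and
its inverse provide the two inductions. -/
lemma exists_framed (L : Lift V S) : ∃ (Y : p → Matrix n n S)
    (hY : S.IsDeformationOf X.center Y) (hr : X.IsRep Y),
    Induces (AlgHom.id k S) L (X.framed hY hr) ∧
      Induces (AlgHom.id k S) (X.framed hY hr) L := by
  obtain ⟨b, hb⟩ := L.exists_basis X.basis
  let Y : p → Matrix n n S := fun i => LinearMap.toMatrix b b (L.M.act (X.gen i))
  have hc : ∀ a, X.comb Y a = LinearMap.toMatrix b b (L.M.act a) := fun a => by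
    rw [comb_apply, X.act_sum_gen L.M (X.lift_act_eq_zero S L) a, map_sum]
    refine Finset.sum_congr rfl fun i _ => ?_
    rw [map_smul]
    ext
    simp [Y, Algebra.smul_def]
  have hY : S.IsDeformationOf X.center Y := fun i => by
    ext r j
    change S.aug (LinearMap.toMatrix b b (L.M.act (X.gen i)) r j) = _
    rw [center, mat, LinearMap.toMatrix_apply, LinearMap.toMatrix_apply]
    have h := L.red_act (X.gen i) (b j)
    rw [L.red_sum b, hb] at h
    simp only [hb] at h
    rw [← h]
    simp [Finsupp.single_apply]
  have hr : X.IsRep Y := fun a a' => by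
    rw [hc, hc, hc, map_mul, Module.End.mul_eq_comp, LinearMap.toMatrix_comp b b b]
  have hact : ∀ a m, b.equivFun (L.M.act a m) = Matrix.mulVec (X.comb Y a) (b.equivFun m) :=
    fun a m => by
      rw [hc]
      exact (LinearMap.toMatrix_mulVec_repr b b (L.M.act a) m).symm
  have hred : ∀ m, (X.framed hY hr).red (b.equivFun m) = L.red m := fun m => by
    refine (X.framed_red hY hr _).trans ?_
    rw [L.red_sum b]
    simp only [hb]
    rfl
  refine ⟨Y, hY, hr, ⟨b.equivFun.toLinearMap.toAddMonoidHom, fun r m => map_smul b.equivFun r m,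
    hact, hred⟩, ⟨b.equivFun.symm.toLinearMap.toAddMonoidHom,
    fun r m => map_smul b.equivFun.symm r m, fun a m => ?_, fun m => ?_⟩⟩
  · change b.equivFun.symm (Matrix.mulVec (X.comb Y a) m) = L.M.act a (b.equivFun.symm m)
    rw [LinearEquiv.symm_apply_eq, hact]
    exact congrArg _ (b.equivFun.apply_symm_apply m).symm
  · change L.red (b.equivFun.symm m) = _
    rw [← hred]
    exact congrArg _ (b.equivFun.apply_symm_apply m)

end Chart

/-! ### Construction of the versal deformation -/

/-- Every endomorphism of `V` lifts to every lift of `V`. -/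
def EndomorphismsLift (V : NUModule k A k) : Prop :=
  ∀ (R : CompleteLocalAlgebra k) (L : Lift V R) (f : V →ₗ[k] V), IsHom f →
    ∃ F : L.M →ₗ[R] L.M, IsHom F ∧ ∀ m, L.red (F m) = f (L.red m)

namespace Chart

variable {V : NUModule k A k} {n p : Type} [Fintype n] [DecidableEq n] [Fintype p] [DecidableEq p]
  (X : Chart V n p) {S : CompleteLocalAlgebra k}

/-- A matrix commuting with the tuple of `V` is an endomorphism of `V`. Lifted to the framed module
and read in coordinates, it supplies the input of `eq_of_inSlice`. -/
lemma exists_centralizer_lift (h : EndomorphismsLift V) {Y : p → Matrix n n S}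
    (hY : S.IsDeformationOf X.center Y) (hr : X.IsRep Y) (C : Matrix n n k)
    (hC : ∀ i, C * X.center i = X.center i * C) :
    ∃ H : Matrix n n S, (∀ i, H * Y i = Y i * H) ∧ S.aug.mapMatrix H = C := by
  have hCa : ∀ a, C * X.mat a = X.mat a * C := fun a => by
    rw [← comb_center]
    simp only [comb_apply, Finset.mul_sum, Finset.sum_mul, Matrix.mul_smul, Matrix.smul_mul, hC]
  obtain ⟨F, hF, hFr⟩ := h S (X.framed hY hr) (Matrix.toLin X.basis X.basis C) (fun a m => by
    have h1 : Matrix.toLin X.basis X.basis C ∘ₗ V.act a =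
        V.act a ∘ₗ Matrix.toLin X.basis X.basis C := by
      apply (LinearMap.toMatrix X.basis X.basis).injective
      rw [LinearMap.toMatrix_comp X.basis X.basis X.basis,
        LinearMap.toMatrix_comp X.basis X.basis X.basis, LinearMap.toMatrix_toLin]
      exact hCa a
    exact DFunLike.congr_fun h1 m)
  let F' : (n → S) →ₗ[S] (n → S) := F
  refine ⟨LinearMap.toMatrix' F', fun i => ?_, ?_⟩
  · have h1 : F' ∘ₗ Matrix.toLin' (Y i) = Matrix.toLin' (Y i) ∘ₗ F' := by
      refine LinearMap.ext fun m => ?_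
      have h2 := hF (X.gen i) m
      have h3 : F' (Matrix.mulVec (X.comb Y (X.gen i)) m) =
        Matrix.mulVec (X.comb Y (X.gen i)) (F' m) := h2
      rw [comb_gen] at h3
      exact h3
    apply Matrix.toLin'.injective
    rw [Matrix.toLin'_mul, Matrix.toLin'_mul, Matrix.toLin'_toMatrix', h1]
  · ext i j
    have h1 := hFr (Pi.single j 1 : n → S)
    have h2 := (X.framed_red hY hr (F' (Pi.single j 1))).symm.trans h1
    have h3 : (X.framed hY hr).red (Pi.single j 1 : n → S) = X.basis j := by
      refine (X.framed_red hY hr _).trans ?_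
      simp [Pi.single_apply]
    rw [h3, Matrix.toLin_self] at h2
    have := X.basis.linearIndependent
    rw [Fintype.linearIndependent_iff] at this
    have h4 := this (fun i => S.aug (F' (Pi.single j 1) i) - C i j)
      (by simp only [sub_smul, Finset.sum_sub_distrib]; rw [h2, sub_self]) i
    simpa [LinearMap.toMatrix'_apply] using sub_eq_zero.1 h4

/-- A module with a chart has a versal deformation, which is universal if endomorphisms lift. -/
theorem exists_versal (X : Chart V n p) : ∃ (R : CompleteLocalAlgebra k) (U : Def V R),
    IsVersal V R U ∧
    (EndomorphismsLift V → IsUniversal V R U) := by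
  -- The kernel of `q` is a complement to the image of the commutator map, that is, to the tangent
  -- directions of conjugation.
  obtain ⟨q, hδ, hq⟩ := LinearMap.exists_generalized_inverse (commutatorMap X.center k)
  let gen : p → Matrix n n (MvPolynomial (p × n × n) k) := fun i =>
    (X.center i).map (algebraMap k _) + Matrix.of fun a b => MvPolynomial.X (i, a, b)
  -- The unknowns are the entries of `Y - B`; the equations say that `Y` is a representation and
  -- lies in the slice.
  let rel : Set (MvPolynomial (p × n × n) k) :=
    {f | ∃ a b i j, f = (X.comb gen (a * b) - X.comb gen a * X.comb gen b) i j} ∪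
    {f | ∃ t, f = extendScalars _ q MvPolynomial.X t}
  have hgen : ∀ {T : Type u} [CommRing T] [Algebra k T] (x : p × n × n → T) (i : p),
      (MvPolynomial.aeval x).mapMatrix (gen i) =
        (X.center i).map (algebraMap k T) + Matrix.of fun a b => x (i, a, b) := by
    intro T _ _ x i
    ext a b
    simp [gen]
  have hrel_iff : ∀ {T : Type u} [CommRing T] [Algebra k T] (Y : p → Matrix n n T)
      (x : p × n × n → T),
      (∀ i, Y i = (X.center i).map (algebraMap k T) + Matrix.of fun a b => x (i, a, b)) →
      ((∀ f ∈ rel, MvPolynomial.aeval x f = 0) ↔ X.IsRep Y ∧ InSlice X.center q Y) := by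
    intro T _ _ Y x hY
    have e1 : ∀ a b i j, MvPolynomial.aeval x
        ((X.comb gen (a * b) - X.comb gen a * X.comb gen b) i j) =
        (X.comb Y (a * b) - X.comb Y a * X.comb Y b) i j := fun a b i j => by
      have h1 : (MvPolynomial.aeval x).mapMatrix (X.comb gen (a * b) - X.comb gen a * X.comb gen b)
          = X.comb Y (a * b) - X.comb Y a * X.comb Y b := by
        rw [map_sub, map_mul (MvPolynomial.aeval x).mapMatrix (X.comb gen a) (X.comb gen b),
          comb_map, comb_map, comb_map]
        simp only [hgen, ← hY]
      rw [← h1]; rfl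
    have e2 : ∀ t, MvPolynomial.aeval x (extendScalars _ q MvPolynomial.X t) =
        extendScalars T q (fun t => (Y t.1 - (X.center t.1).map (algebraMap k T)) t.2.1 t.2.2) t :=
      fun t => by
        rw [extendScalars_map]
        refine congrFun (congrArg _ (funext fun t => ?_)) t
        simp [hY]
    constructor
    · intro h
      refine ⟨fun a b => ?_, ?_⟩
      · rw [← sub_eq_zero]
        ext i j
        rw [← e1]
        exact h _ (Or.inl ⟨a, b, i, j, rfl⟩)
      · ext t
        rw [← e2]
        exact h _ (Or.inr ⟨t, rfl⟩)
    · rintro ⟨h1, h2⟩ f (⟨a, b, i, j, rfl⟩ | ⟨t, rfl⟩)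
      · rw [e1, h1, sub_self]; rfl
      · rw [e2, h2]; rfl
  have hY0 : ∀ i, X.center i = (X.center i).map (algebraMap k k) +
      Matrix.of fun a b => (0 : p × n × n → k) (i, a, b) := fun i => by ext; simp
  -- The origin corresponds to the tuple of `V` itself, so all equations have zero constant term.
  obtain ⟨R, x, hx, hxr, hex, huniq⟩ := exists_universal_solution rel (fun f hf => by
    have h0 := (hrel_iff X.center 0 hY0).2 ⟨X.isRep_center, by
      have : (fun t : p × n × n => (X.center t.1 - (X.center t.1).map (algebraMap k k))
          t.2.1 t.2.2) = 0 := by ext t; simp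
      rw [InSlice, this, map_zero]⟩ f hf
    simpa [MvPolynomial.aeval_zero] using h0)
  have isDef : ∀ (T : CompleteLocalAlgebra k) (Y : p → Matrix n n T) (x : p × n × n → T),
      (∀ t, x t ∈ IsLocalRing.maximalIdeal T) →
      (∀ i, Y i = (X.center i).map (algebraMap k T) + Matrix.of fun a b => x (i, a, b)) →
      T.IsDeformationOf X.center Y := fun T Y x hx hY i => by
    ext a b
    have := (T.aug_eq_zero_iff _).2 (hx (i, a, b))
    simp [hY, this]
  let Y : p → Matrix n n R := fun i =>
    (X.center i).map (algebraMap k R) + Matrix.of fun a b => x (i, a, b)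
  have hYd : R.IsDeformationOf X.center Y := isDef R Y x hx fun _ => rfl
  obtain ⟨hYr, hYs⟩ := (hrel_iff Y x fun _ => rfl).1 hxr
  have hθ : ∀ (S : CompleteLocalAlgebra k) (θ : R →ₐ[k] S) (i : p), θ.mapMatrix (Y i) =
      (X.center i).map (algebraMap k S) + Matrix.of fun a b => θ (x (i, a, b)) :=
    fun S θ i => by ext a b; simp [Y]
  have hθm : ∀ (S : CompleteLocalAlgebra k) (θ : R →ₐ[k] S) t,
      θ (x t) ∈ IsLocalRing.maximalIdeal S := fun S θ t => by
    rw [← aug_eq_zero_iff, aug_apply, aug_eq_zero_iff]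
    exact hx t
  have hθs : ∀ (S : CompleteLocalAlgebra k) (θ : R →ₐ[k] S),
      S.IsDeformationOf X.center (fun i => θ.mapMatrix (Y i)) ∧
      X.IsRep (fun i => θ.mapMatrix (Y i)) ∧ InSlice X.center q (fun i => θ.mapMatrix (Y i)) := by
    intro S θ
    refine ⟨isDef S _ (fun t => θ (x t)) (hθm S θ) (hθ S θ),
      (hrel_iff _ (fun t => θ (x t)) (hθ S θ)).1 fun f hf => ?_⟩
    have h1 : MvPolynomial.aeval (fun t => θ (x t)) f = θ (MvPolynomial.aeval x f) := by
      rw [MvPolynomial.comp_aeval_apply]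
    rw [h1, hxr f hf, map_zero]
  have hsurj : ∀ (S : CompleteLocalAlgebra k) (L' : Lift V S),
      ∃ θ : R →ₐ[k] S, Induces θ (X.framed hYd hYr) L' := by
    intro S L'
    obtain ⟨Z, hZ, hZr, -, hZL⟩ := X.exists_framed L'
    -- Once moved into the slice, the framed lift solves the equations and so defines a morphism
    -- from `R`; undoing the conjugation returns the lift.
    obtain ⟨u, hu, hs⟩ := exists_conj_inSlice q hq hZ
    obtain ⟨hz, hzr⟩ : S.IsDeformationOf X.center
      (fun i => (u : Matrix n n S) * Z i * (↑u⁻¹ : Matrix n n S)) ∧ X.IsRep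
      (fun i => (u : Matrix n n S) * Z i * (↑u⁻¹ : Matrix n n S)) := ⟨hZ.conj hu, hZr.conj u⟩
    let z : p × n × n → S := fun t => ((u : Matrix n n S) * Z t.1 * (↑u⁻¹ : Matrix n n S) -
      (X.center t.1).map (algebraMap k S)) t.2.1 t.2.2
    have hzz : ∀ i, (u : Matrix n n S) * Z i * (↑u⁻¹ : Matrix n n S) =
        (X.center i).map (algebraMap k S) + Matrix.of fun a b => z (i, a, b) := fun i => by
      ext a b
      simp [z]
    obtain ⟨θ, h⟩ := hex S z (fun t => hz.matIn t.1 t.2.1 t.2.2)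
      ((hrel_iff _ z hzz).2 ⟨hzr, hs⟩)
    refine ⟨θ, ?_⟩
    have h1 : Induces θ (X.framed hYd hYr) (X.framed hz hzr) :=
      (X.induces_framed_iff hYd hYr hz hzr θ).2 ⟨1, map_one _, fun i => by
        rw [one_mul, mul_one, hzz, hθ]; simp only [h]⟩
    have h2 : Induces (AlgHom.id k S) (X.framed hz hzr) (X.framed hZ hZr) :=
      (X.induces_framed_iff hz hzr hZ hZr _).2 ⟨(↑u⁻¹ : Matrix n n S), S.mapMatrix_inv hu,
        fun i => by
          have e : (AlgHom.id k S).mapMatrix ((u : Matrix n n S) * Z i * (↑u⁻¹ : Matrix n n S)) =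
            (u : Matrix n n S) * Z i * (↑u⁻¹ : Matrix n n S) := by ext; rfl
          rw [e, mul_assoc, Units.inv_mul_cancel_left]⟩
    exact (h1.trans h2).trans hZL
  have hconj : ∀ (S : CompleteLocalAlgebra k) (L' : Lift V S) (θ θ' : R →ₐ[k] S),
      Induces θ (X.framed hYd hYr) L' → Induces θ' (X.framed hYd hYr) L' →
      ∃ g : Matrix n n S, S.aug.mapMatrix g = 1 ∧
        ∀ i, g * θ.mapMatrix (Y i) = θ'.mapMatrix (Y i) * g := by
    intro S L' θ θ' h h'
    obtain ⟨Z, hZ, hZr, hLZ, -⟩ := X.exists_framed L'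
    obtain ⟨g, hg1, hg⟩ := (X.induces_framed_iff hYd hYr hZ hZr _).1 (h.trans hLZ)
    obtain ⟨g', hg1', hg'⟩ := (X.induces_framed_iff hYd hYr hZ hZr _).1 (h'.trans hLZ)
    obtain ⟨u, rfl⟩ := S.isUnit_of_mapMatrix hg1'
    refine ⟨(↑u⁻¹ : Matrix n n S) * g, by rw [map_mul, S.mapMatrix_inv hg1', hg1, one_mul],
      fun i => ?_⟩
    have h1 := hg i
    have h2 := hg' i
    rw [AlgHom.id_comp] at h1 h2
    rw [mul_assoc, h1, ← mul_assoc, ← mul_assoc]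
    congr 1
    rw [Units.inv_mul_eq_iff_eq_mul, ← mul_assoc, h2, mul_assoc, Units.mul_inv, mul_one]
  have heq : ∀ (S : CompleteLocalAlgebra k) (θ θ' : R →ₐ[k] S),
      (fun i => θ.mapMatrix (Y i)) = (fun i => θ'.mapMatrix (Y i)) → θ = θ' := by
    intro S θ θ' h
    refine huniq S θ θ' fun t => ?_
    have h1 := congrFun (congrFun (congrFun h t.1) t.2.1) t.2.2
    simpa [Y] using h1
  refine ⟨R, Quotient.mk _ (X.framed hYd hYr), (isVersal_iff _).2 ⟨hsurj, ?_⟩, fun hend =>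
    (isUniversal_iff _).2 ⟨hsurj, ?_⟩⟩
  · intro L' θ θ' h h'
    obtain ⟨g, hg1, hg⟩ := hconj _ L' θ θ' h h'
    obtain ⟨h1, h2, h3⟩ := hθs _ θ
    obtain ⟨h1', h2', h3'⟩ := hθs _ θ'
    refine heq _ θ θ' ?_
    -- A conjugator congruent to 1 to first order forces agreement to second order, and the square
    -- of the maximal ideal of `k[ε]` is zero.
    have hg' : MatIn (IsLocalRing.maximalIdeal (dualNumber k) ^ 1) (g - 1) := by
      rw [pow_one, matIn_iff, map_sub, hg1, map_one, sub_self]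
    have key := (conj_step_of_inSlice q hδ h1 h1' h3 h3' hg hg').1
    funext i
    rw [← sub_eq_zero, ← neg_eq_zero, neg_sub]
    ext a b : 2
    have h4 := key i a b
    rw [one_add_one_eq_two, dualNumber_maximalIdeal_sq, Ideal.mem_bot] at h4
    exact h4
  · intro S L' θ θ' h h'
    obtain ⟨g, hg1, hg⟩ := hconj _ L' θ θ' h h'
    obtain ⟨h1, h2, h3⟩ := hθs _ θ
    obtain ⟨h1', h2', h3'⟩ := hθs _ θ'
    exact heq _ θ θ' (eq_of_inSlice q hδ h1 h1' h3 h3' hg1 hg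
      (X.exists_centralizer_lift hend h1 h2))

end Chart

end Chart

/-! ### Frobenius systems and traces -/

/-- A Frobenius system on an algebra with local units: dual families `x`, `y` with respect to a
linear form, and a Nakayama automorphism. -/
structure FrobeniusSystem (k : Type u) [Field k] (A : Type w) [NonUnitalRing A] [Module k A]
    (ι : Type*) where
  x : ι → A
  y : ι → A
  form : A →ₗ[k] k
  mu : A ≃ₗ[k] A
  mu_mul : ∀ a b, mu (a * b) = mu a * mu b
  form_mu_mul : ∀ a b, form (mu b * a) = form (a * b)
  finite_x_mul : ∀ a, {s | x s * a ≠ 0}.Finite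
  finite_y_mul : ∀ a, {s | y s * a ≠ 0}.Finite
  finite_mul_y : ∀ a, {s | a * y s ≠ 0}.Finite
  expand_y : ∀ a, a = ∑ᶠ s, form (x s * a) • y s
  expand_x : ∀ a, a = ∑ᶠ s, form (a * y s) • x s
  exists_local_unit : ∀ T : Finset A, ∃ e, e * e = e ∧ ∀ a ∈ T, e * a = a ∧ a * e = a

namespace NUModule

variable {k : Type u} [Field k] {A : Type w} [NonUnitalRing A] [Module k A]
variable {R S T : Type u} [CommRing R] [Algebra k R] [CommRing S] [Algebra k S] [CommRing T]
  [Algebra k T]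

/-- Some element of `A` acts as the identity. -/
def HasUnit (M : NUModule k A R) : Prop := ∃ e, M.act e = 1

/-- An additive map which is linear over the ground field. -/
def IsKLinear {M : NUModule k A R} {N : NUModule k A S} (φ : M →+ N) : Prop :=
  ∀ (c : k) (m : M), φ (algebraMap k R c • m) = algebraMap k S c • φ m

lemma IsSemilinear.isKLinear {M : NUModule k A R} {N : NUModule k A S} {θ : R →ₐ[k] S}
    {φ : M →+ N} (h : IsSemilinear θ φ) : IsKLinear φ := fun c m => by
  rw [h, AlgHom.commutes]

lemma act_mul_apply (M : NUModule k A R) (a b : A) (m : M) :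
    M.act (a * b) m = M.act a (M.act b m) := by rw [map_mul]; rfl

lemma act_sum_smul (M : NUModule k A R) {ι : Type*} (F : Finset ι) (c : ι → k) (z : ι → A) :
    M.act (∑ s ∈ F, c s • z s) = ∑ s ∈ F, algebraMap k R (c s) • M.act (z s) := by
  rw [map_sum]
  exact Finset.sum_congr rfl fun _ _ => M.act_smul _ _

end NUModule

namespace FrobeniusSystem

open NUModule

variable {k : Type u} [Field k] {A : Type w} [NonUnitalRing A] [Module k A] {ι : Type*}
  (𝔉 : FrobeniusSystem k A ι)
variable {R S T : Type u} [CommRing R] [Algebra k R] [CommRing S] [Algebra k S] [CommRing T]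
  [Algebra k T]

/-- A finitely generated module has an element acting as the identity. -/
lemma hasUnit (𝔉 : FrobeniusSystem k A ι) (M : NUModule k A R) [Module.Finite R M] : M.HasUnit := by
  classical
  obtain ⟨G, hG⟩ := Module.Finite.fg_top (R := R) (M := M)
  have h1 : ∀ m : M, ∃ T : Finset A, ∀ e : A, (∀ a ∈ T, e * a = a) → M.act e m = m := by
    intro m
    induction M.unital m using Submodule.span_induction with
    | mem z hz =>
      obtain ⟨a, y, rfl⟩ := hz
      refine ⟨{a}, fun e he => ?_⟩
      rw [← act_mul_apply, he a (Finset.mem_singleton_self a)]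
    | zero => exact ⟨∅, fun e _ => map_zero _⟩
    | add z z' _ _ h h' =>
      obtain ⟨T, hT⟩ := h
      obtain ⟨T', hT'⟩ := h'
      refine ⟨T ∪ T', fun e he => ?_⟩
      rw [map_add, hT e fun a ha => he a (Finset.mem_union_left _ ha),
        hT' e fun a ha => he a (Finset.mem_union_right _ ha)]
    | smul r z _ h =>
      obtain ⟨T, hT⟩ := h
      exact ⟨T, fun e he => by rw [map_smul, hT e he]⟩
  choose T hT using h1
  -- Each generator is a combination of finitely many elements `a y`; a common left unit for all
  -- these `a` fixes it.
  obtain ⟨e, -, he⟩ := 𝔉.exists_local_unit (G.biUnion T)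
  refine ⟨e, ?_⟩
  have h2 : Submodule.span R (G : Set M) ≤ LinearMap.eqLocus (M.act e) 1 := by
    rw [Submodule.span_le]
    intro m hm
    exact hT m e fun a ha => (he a (Finset.mem_biUnion.2 ⟨m, hm, ha⟩)).1
  rw [hG] at h2
  exact LinearMap.ext fun m => h2 (Submodule.mem_top (x := m))

lemma exists_idempotent_unit (𝔉 : FrobeniusSystem k A ι) (M : NUModule k A R) [Module.Finite R M] :
    ∃ e, e * e = e ∧ M.act e = 1 := by
  obtain ⟨e, he⟩ := 𝔉.hasUnit M
  obtain ⟨e', h, h'⟩ := 𝔉.exists_local_unit {e}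
  refine ⟨e', h, ?_⟩
  have h1 := (h' e (Finset.mem_singleton_self e)).1
  have h2 := congrArg M.act h1
  rwa [map_mul, he, mul_one] at h2

/-- If `e` acts as the identity, then `a * e = 0` makes `a` act as zero, and only finitely many
members of the families survive multiplication by `e`. Sums over the families are thus finite on
each such module. -/
lemma exists_finset (M : NUModule k A R) (hM : M.HasUnit) :
    ∃ F : Finset ι, ∀ s ∉ F, M.act (𝔉.x s) = 0 ∧ M.act (𝔉.y s) = 0 := by
  classical
  obtain ⟨e, he⟩ := hM
  refine ⟨(𝔉.finite_x_mul e).toFinset ∪ (𝔉.finite_y_mul e).toFinset, fun s hs => ?_⟩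
  simp only [Finset.mem_union, Set.Finite.mem_toFinset, Set.mem_ofPred_eq, not_or, not_not] at hs
  have h : ∀ a, a * e = 0 → M.act a = 0 := fun a ha => by
    rw [← mul_one (M.act a), ← he, ← map_mul, ha, map_zero]
  exact ⟨h _ hs.1, h _ hs.2⟩

lemma act_expand_y (M : NUModule k A R) (F : Finset ι) (hF : ∀ s ∉ F, M.act (𝔉.y s) = 0) (a : A) :
    M.act a = ∑ s ∈ F, algebraMap k R (𝔉.form (𝔉.x s * a)) • M.act (𝔉.y s) := by
  classical
  have h1 : (Function.support fun s => 𝔉.form (𝔉.x s * a) • 𝔉.y s) ⊆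
      ((𝔉.finite_x_mul a).toFinset ∪ F : Finset ι) := fun s hs => by
    rw [Finset.coe_union]
    refine Or.inl ?_
    rw [Set.Finite.coe_toFinset]
    intro h
    exact hs (by simp [h])
  conv_lhs => rw [𝔉.expand_y a, finsum_eq_sum_of_support_subset _ h1, act_sum_smul]
  refine (Finset.sum_subset Finset.subset_union_right fun s _ hs => ?_).symm
  rw [hF s hs, smul_zero]

lemma act_expand_x (M : NUModule k A R) (F : Finset ι) (hF : ∀ s ∉ F, M.act (𝔉.x s) = 0) (a : A) :
    M.act a = ∑ s ∈ F, algebraMap k R (𝔉.form (a * 𝔉.y s)) • M.act (𝔉.x s) := by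
  classical
  have h1 : (Function.support fun s => 𝔉.form (a * 𝔉.y s) • 𝔉.x s) ⊆
      ((𝔉.finite_mul_y a).toFinset ∪ F : Finset ι) := fun s hs => by
    rw [Finset.coe_union]
    refine Or.inl ?_
    rw [Set.Finite.coe_toFinset]
    intro h
    exact hs (by simp [h])
  conv_lhs => rw [𝔉.expand_x a, finsum_eq_sum_of_support_subset _ h1, act_sum_smul]
  refine (Finset.sum_subset Finset.subset_union_right fun s _ hs => ?_).symm
  rw [hF s hs, smul_zero]

/-- The trace `∑ y_s φ x_s` of an additive map. -/
noncomputable def tr {M : NUModule k A R} {N : NUModule k A S} (φ : M →+ N) : M →+ N :=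
  ∑ᶠ s, (N.act (𝔉.y s)).toAddMonoidHom.comp (φ.comp (M.act (𝔉.x s)).toAddMonoidHom)

section Trace

variable {M : NUModule k A R} {N : NUModule k A S} {P : NUModule k A T}

lemma tr_apply (φ : M →+ N) (F : Finset ι) (hF : ∀ s ∉ F, M.act (𝔉.x s) = 0) (m : M) :
    𝔉.tr φ m = ∑ s ∈ F, N.act (𝔉.y s) (φ (M.act (𝔉.x s) m)) := by
  have h1 : (Function.support fun s =>
      (N.act (𝔉.y s)).toAddMonoidHom.comp (φ.comp (M.act (𝔉.x s)).toAddMonoidHom)) ⊆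
      (F : Set ι) := fun s hs => by
    by_contra h
    refine hs (AddMonoidHom.ext fun m => ?_)
    change N.act (𝔉.y s) (φ (M.act (𝔉.x s) m)) = 0
    rw [hF s h, LinearMap.zero_apply, map_zero, map_zero]
  rw [tr, finsum_eq_sum_of_support_subset _ h1, AddMonoidHom.finsetSum_apply]
  rfl

/-- Expanding one side of each term with the coefficients `c` and collecting them on the other side
amounts to an identity `∑ U_s ⊗ v_s = ∑ u_t ⊗ V_t`, evaluated on a `k`-linear map. The invariance
properties of the trace below reduce to it. -/
lemma sum_swap {κ κ' : Type*} (F : Finset κ) (G : Finset κ') (c : κ' → κ → k) (U : κ → A)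
    (u : κ' → A) (V : κ' → A) (v : κ → A)
    (hU : ∀ s ∈ F, N.act (U s) = ∑ t ∈ G, algebraMap k S (c t s) • N.act (u t))
    (hV : ∀ t ∈ G, M.act (V t) = ∑ s ∈ F, algebraMap k R (c t s) • M.act (v s))
    {φ : M →+ N} (hφ : IsKLinear φ) (m : M) :
    ∑ s ∈ F, N.act (U s) (φ (M.act (v s) m)) = ∑ t ∈ G, N.act (u t) (φ (M.act (V t) m)) := by
  have h1 : ∀ s ∈ F, N.act (U s) (φ (M.act (v s) m)) =
      ∑ t ∈ G, algebraMap k S (c t s) • N.act (u t) (φ (M.act (v s) m)) := fun s hs => by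
    rw [hU s hs, LinearMap.sum_apply]; rfl
  have h2 : ∀ t ∈ G, N.act (u t) (φ (M.act (V t) m)) =
      ∑ s ∈ F, algebraMap k S (c t s) • N.act (u t) (φ (M.act (v s) m)) := fun t ht => by
    rw [hV t ht, LinearMap.sum_apply, map_sum, map_sum]
    refine Finset.sum_congr rfl fun s _ => ?_
    rw [LinearMap.smul_apply, hφ, map_smul]
  rw [Finset.sum_congr rfl h1, Finset.sum_congr rfl h2, Finset.sum_comm]

lemma exists_common_finset (hM : M.HasUnit) (hN : N.HasUnit) :
    ∃ F : Finset ι, (∀ s ∉ F, M.act (𝔉.x s) = 0) ∧ (∀ s ∉ F, N.act (𝔉.x s) = 0) ∧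
      ∀ s ∉ F, N.act (𝔉.y s) = 0 := by
  classical
  obtain ⟨F, hF⟩ := 𝔉.exists_finset M hM
  obtain ⟨G, hG⟩ := 𝔉.exists_finset N hN
  refine ⟨F ∪ G, fun s hs => ?_, fun s hs => ?_, fun s hs => ?_⟩ <;>
    rw [Finset.mem_union, not_or] at hs
  exacts [(hF s hs.1).1, (hG s hs.2).1, (hG s hs.2).2]

/-- The Casimir element is central: `∑ b y_s ⊗ x_s = ∑ y_t ⊗ x_t b`, since both sides have the
coefficients `form (x_t b y_s)` in terms of `y_t ⊗ x_s`. -/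
lemma tr_isEquivariant (hM : M.HasUnit) (hN : N.HasUnit) {φ : M →+ N} (hφ : IsKLinear φ) :
    IsEquivariant (𝔉.tr φ) := by
  intro b m
  obtain ⟨F, hF, -, hF'⟩ := 𝔉.exists_common_finset hM hN
  rw [𝔉.tr_apply φ F hF, 𝔉.tr_apply φ F hF, map_sum]
  simp only [← act_mul_apply]
  symm
  refine sum_swap F F (fun t s => 𝔉.form (𝔉.x t * b * 𝔉.y s)) (fun s => b * 𝔉.y s) 𝔉.y
    (fun t => 𝔉.x t * b) 𝔉.x (fun s _ => ?_) (fun t _ => ?_) hφ m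
  · simp only [mul_assoc]
    exact 𝔉.act_expand_y N F hF' _
  · exact 𝔉.act_expand_x M F hF _

/-- Moving `b` across the inside of the Casimir element costs a Nakayama automorphism: `∑ y_s b ⊗
x_s = ∑ y_t ⊗ mu(b) x_t`. -/
lemma tr_act_comp (hM : M.HasUnit) (hN : N.HasUnit) {φ : M →+ N} (hφ : IsKLinear φ) (b : A) :
    𝔉.tr ((N.act b).toAddMonoidHom.comp φ) =
      𝔉.tr (φ.comp (M.act (𝔉.mu b)).toAddMonoidHom) := by
  ext m
  obtain ⟨F, hF, -, hF'⟩ := 𝔉.exists_common_finset hM hN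
  rw [𝔉.tr_apply _ F hF, 𝔉.tr_apply _ F hF]
  change ∑ s ∈ F, N.act (𝔉.y s) (N.act b (φ (M.act (𝔉.x s) m))) =
    ∑ s ∈ F, N.act (𝔉.y s) (φ (M.act (𝔉.mu b) (M.act (𝔉.x s) m)))
  simp only [← act_mul_apply]
  refine sum_swap F F (fun t s => 𝔉.form (𝔉.x t * 𝔉.y s * b)) (fun s => 𝔉.y s * b) 𝔉.y
    (fun t => 𝔉.mu b * 𝔉.x t) 𝔉.x (fun s _ => ?_) (fun t _ => ?_) hφ m
  · simp only [mul_assoc]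
    exact 𝔉.act_expand_y N F hF' _
  · have h : ∀ s, 𝔉.form (𝔉.x t * 𝔉.y s * b) = 𝔉.form (𝔉.mu b * 𝔉.x t * 𝔉.y s) := fun s => by
      rw [← 𝔉.form_mu_mul, mul_assoc]
    simp only [h]
    exact 𝔉.act_expand_x M F hF _

/-- In terms of the family `x`, the elements `y_s` and `mu(y_t)` have transposed coefficients `form
(y_s y_t)`, so the Casimir element is also `∑ x_t ⊗ mu(y_t)`. This shape is what makes traces
adjoint for the trace form in `trace_ltr_comp`. -/
lemma tr_eq_sum_mu (F : Finset ι) (hF : ∀ s ∉ F, M.act (𝔉.x s) = 0)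
    (hF' : ∀ s ∉ F, N.act (𝔉.x s) = 0) {φ : M →+ N} (hφ : IsKLinear φ) (m : M) :
    𝔉.tr φ m = ∑ s ∈ F, N.act (𝔉.x s) (φ (M.act (𝔉.mu (𝔉.y s)) m)) := by
  rw [𝔉.tr_apply φ F hF]
  refine sum_swap F F (fun t s => 𝔉.form (𝔉.y s * 𝔉.y t)) 𝔉.y 𝔉.x
    (fun t => 𝔉.mu (𝔉.y t)) 𝔉.x (fun s _ => ?_) (fun t _ => ?_) hφ m
  · exact 𝔉.act_expand_x N F hF' _
  · simp only [← 𝔉.form_mu_mul _ (𝔉.y t)]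
    exact 𝔉.act_expand_x M F hF _

lemma tr_comp_left (hM : M.HasUnit) {g : N →+ P} (hg : IsEquivariant g) (φ : M →+ N) :
    𝔉.tr (g.comp φ) = g.comp (𝔉.tr φ) := by
  ext m
  obtain ⟨F, hF⟩ := 𝔉.exists_finset M hM
  rw [𝔉.tr_apply _ F fun s hs => (hF s hs).1, AddMonoidHom.comp_apply,
    𝔉.tr_apply _ F fun s hs => (hF s hs).1, map_sum]
  exact Finset.sum_congr rfl fun s _ => (hg _ _).symm

lemma tr_comp_right (hM : M.HasUnit) (hN : N.HasUnit) {g : M →+ N} (hg : IsEquivariant g)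
    (φ : N →+ P) : 𝔉.tr (φ.comp g) = (𝔉.tr φ).comp g := by
  ext m
  obtain ⟨F, hF, hF', -⟩ := 𝔉.exists_common_finset hM hN
  rw [𝔉.tr_apply _ F hF, AddMonoidHom.comp_apply, 𝔉.tr_apply _ F hF']
  refine Finset.sum_congr rfl fun s _ => ?_
  rw [AddMonoidHom.comp_apply, hg]

lemma tr_add (hM : M.HasUnit) (φ ψ : M →+ N) : 𝔉.tr (φ + ψ) = 𝔉.tr φ + 𝔉.tr ψ := by
  ext m
  obtain ⟨F, hF⟩ := 𝔉.exists_finset M hM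
  have hF' := fun s hs => (hF s hs).1
  simp only [AddMonoidHom.add_apply, 𝔉.tr_apply _ F hF', map_add, Finset.sum_add_distrib]

lemma tr_sub (hM : M.HasUnit) (φ ψ : M →+ N) : 𝔉.tr (φ - ψ) = 𝔉.tr φ - 𝔉.tr ψ := by
  ext m
  obtain ⟨F, hF⟩ := 𝔉.exists_finset M hM
  have hF' := fun s hs => (hF s hs).1
  simp only [AddMonoidHom.sub_apply, 𝔉.tr_apply _ F hF', map_sub, Finset.sum_sub_distrib]

lemma tr_isSemilinear (hM : M.HasUnit) {θ : R →ₐ[k] S} {φ : M →+ N} (hφ : IsSemilinear θ φ) :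
    IsSemilinear θ (𝔉.tr φ) := by
  intro r m
  obtain ⟨F, hF⟩ := 𝔉.exists_finset M hM
  have hF' := fun s hs => (hF s hs).1
  rw [𝔉.tr_apply _ F hF', 𝔉.tr_apply _ F hF', Finset.smul_sum]
  refine Finset.sum_congr rfl fun s _ => ?_
  rw [map_smul, hφ, map_smul]

end Trace

/-! ### Linear traces -/

section LinearTrace

variable {M N P : NUModule k A R}

/-- The trace of a linear map. -/
noncomputable def ltr (φ : M →ₗ[R] N) (hM : M.HasUnit) : M →ₗ[R] N :=
  (𝔉.tr_isSemilinear hM (isSemilinear_linear φ)).toLinear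

lemma ltr_apply (φ : M →ₗ[R] N) (hM : M.HasUnit) (m : M) :
    𝔉.ltr φ hM m = 𝔉.tr φ.toAddMonoidHom m := rfl

lemma ltr_isHom (φ : M →ₗ[R] N) (hM : M.HasUnit) (hN : N.HasUnit) : IsHom (𝔉.ltr φ hM) :=
  𝔉.tr_isEquivariant hM hN (isSemilinear_linear φ).isKLinear

lemma ltr_comp_left (hM : M.HasUnit) {g : N →ₗ[R] P} (hg : IsHom g) (φ : M →ₗ[R] N) :
    𝔉.ltr (g ∘ₗ φ) hM = g ∘ₗ 𝔉.ltr φ hM :=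
  LinearMap.ext fun m =>
    DFunLike.congr_fun (𝔉.tr_comp_left hM (g := g.toAddMonoidHom) hg φ.toAddMonoidHom) m

lemma ltr_comp_right (hM : M.HasUnit) (hN : N.HasUnit) {g : M →ₗ[R] N} (hg : IsHom g)
    (φ : N →ₗ[R] P) : 𝔉.ltr (φ ∘ₗ g) hM = 𝔉.ltr φ hN ∘ₗ g :=
  LinearMap.ext fun m =>
    DFunLike.congr_fun (𝔉.tr_comp_right hM hN (g := g.toAddMonoidHom) hg φ.toAddMonoidHom) m

lemma ltr_add (hM : M.HasUnit) (φ ψ : M →ₗ[R] N) : 𝔉.ltr (φ + ψ) hM = 𝔉.ltr φ hM + 𝔉.ltr ψ hM :=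
  LinearMap.ext fun m =>
    DFunLike.congr_fun (𝔉.tr_add hM φ.toAddMonoidHom ψ.toAddMonoidHom) m

lemma ltr_sub (hM : M.HasUnit) (φ ψ : M →ₗ[R] N) : 𝔉.ltr (φ - ψ) hM = 𝔉.ltr φ hM - 𝔉.ltr ψ hM :=
  LinearMap.ext fun m =>
    DFunLike.congr_fun (𝔉.tr_sub hM φ.toAddMonoidHom ψ.toAddMonoidHom) m

lemma ltr_act_comp (hM : M.HasUnit) (hN : N.HasUnit) (φ : M →ₗ[R] N) (b : A) :
    𝔉.ltr (N.act b ∘ₗ φ) hM = 𝔉.ltr (φ ∘ₗ M.act (𝔉.mu b)) hM :=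
  LinearMap.ext fun m =>
    DFunLike.congr_fun (𝔉.tr_act_comp hM hN (isSemilinear_linear φ).isKLinear b) m

end LinearTrace

/-! ### Projective modules -/

section Projective

variable {V P : NUModule k A k}

/-- A module with an endomorphism of trace one is projective. -/
lemma isProjective_of_ltr [Module.Finite k P] (hP : P.HasUnit) (φ : P →ₗ[k] P)
    (hφ : 𝔉.ltr φ hP = LinearMap.id) : P.IsProjective := by
  refine ⟨inferInstance, fun X Y hX hY g f hg hgs hf => ?_⟩
  have hXu := 𝔉.hasUnit X
  have hYu := 𝔉.hasUnit Y
  -- The linear section is averaged: the trace of `s f φ` is a homomorphism, and `g` and `f` can be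
  -- pulled out of the trace, leaving `f` composed with the trace of `φ`.
  obtain ⟨s, hs⟩ := g.exists_rightInverse_of_surjective (LinearMap.range_eq_top.2 hgs)
  refine ⟨𝔉.ltr (s ∘ₗ f ∘ₗ φ) hP, 𝔉.ltr_isHom _ hP hXu, ?_⟩
  rw [← 𝔉.ltr_comp_left hP hg, ← LinearMap.comp_assoc, hs, LinearMap.id_comp,
    𝔉.ltr_comp_left hP hf, hφ, LinearMap.comp_id]

variable [IsScalarTower k A A] [SMulCommClass k A A]

/-- Right multiplication by `e` has finite rank. -/
lemma exists_left_coordinates (𝔉 : FrobeniusSystem k A ι) (e : A) (he : e * e = e) :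
    ∃ (m : ℕ) (b : Fin m → A) (r : A →ₗ[k] (Fin m → k)), (∀ a, a * e = ∑ i, r a i • b i) ∧
      (∀ a, r (a * e) = r a) ∧ (∀ j, r (b j) = Pi.single j 1) ∧ ∀ j, b j * e = b j := by
  classical
  let f : A →ₗ[k] A := LinearMap.mulRight k e
  have hf : Module.Finite k (LinearMap.range f) := by
    let F := (𝔉.finite_x_mul e).toFinset
    -- Expanding `a` along the family `x` shows that `a * e` is spanned by the finitely many nonzero
    -- `x_s * e`.
    have hle : LinearMap.range f ≤ Submodule.span k ((F.image fun s => 𝔉.x s * e : Finset A) :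
        Set A) := by
      rintro _ ⟨a, rfl⟩
      change a * e ∈ _
      have h1 : (Function.support fun s => 𝔉.form (a * 𝔉.y s) • 𝔉.x s) ⊆
          ((𝔉.finite_mul_y a).toFinset : Finset ι) := fun s hs => by
        rw [Set.Finite.coe_toFinset]
        intro h
        exact hs (by simp [h])
      rw [𝔉.expand_x a, finsum_eq_sum_of_support_subset _ h1, Finset.sum_mul]
      refine sum_mem fun s _ => ?_
      rw [smul_mul_assoc]
      refine Submodule.smul_mem _ _ ?_
      by_cases h : 𝔉.x s * e = 0
      · rw [h]; exact Submodule.zero_mem _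
      · refine Submodule.subset_span ?_
        rw [Finset.coe_image]
        exact ⟨s, by simpa [F] using h, rfl⟩
    have := FiniteDimensional.span_finset k (F.image fun s => 𝔉.x s * e)
    exact Submodule.finiteDimensional_of_le hle
  let B := Module.finBasis k (LinearMap.range f)
  have hfB : ∀ j, (B j : A) * e = B j := fun j => by
    obtain ⟨a, ha⟩ := (B j).2
    rw [← ha]
    change a * e * e = a * e
    rw [mul_assoc, he]
  refine ⟨_, fun i => (B i : A), B.equivFun.toLinearMap ∘ₗ f.rangeRestrict, fun a => ?_,
    fun a => ?_, fun j => ?_, hfB⟩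
  · have h := congrArg Subtype.val (B.sum_equivFun (f.rangeRestrict a))
    rw [Submodule.coe_sum] at h
    exact h.symm
  · have h : f.rangeRestrict (a * e) = f.rangeRestrict a := Subtype.ext (by
      change a * e * e = a * e
      rw [mul_assoc, he])
    change B.equivFun (f.rangeRestrict (a * e)) = B.equivFun (f.rangeRestrict a)
    rw [h]
  · have h : f.rangeRestrict (B j) = B j := Subtype.ext (hfB j)
    change B.equivFun (f.rangeRestrict (B j)) = _
    rw [h]
    ext i
    simp [Pi.single_apply, eq_comm]

/-- Every finite dimensional module is a quotient of one with an endomorphism of trace one. -/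
lemma exists_cover (𝔉 : FrobeniusSystem k A ι) (V : NUModule k A k) [Module.Finite k V] :
    ∃ (F : NUModule k A k) (_ : Module.Finite k F) (hF : F.HasUnit) (π : F →ₗ[k] V)
      (φ : F →ₗ[k] F), IsHom π ∧ Function.Surjective π ∧ 𝔉.ltr φ hF = LinearMap.id := by
  classical
  obtain ⟨e, hee, he⟩ := 𝔉.exists_idempotent_unit V
  obtain ⟨m, b, r, hr, hre, hrb1, hbe⟩ := 𝔉.exists_left_coordinates e hee
  have hrb : ∀ a a' i, ∑ j, r (a * b j) i * r a' j = r (a * a') i := fun a a' i => by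
    rw [← hre (a * a'), mul_assoc, hr a', Finset.mul_sum, map_sum, Finset.sum_apply]
    refine Finset.sum_congr rfl fun j _ => ?_
    rw [mul_smul_comm, map_smul, Pi.smul_apply, smul_eq_mul, mul_comm]
  obtain ⟨e', -, he'⟩ := 𝔉.exists_local_unit (Finset.univ.image b)
  -- The module is `Ae ⊗ V`, written in the coordinates `r` of `Ae`; `el a v` below stands for `ae ⊗
  -- v`.
  let actF : A → (Fin m → V) →ₗ[k] (Fin m → V) := fun a =>
    LinearMap.pi fun i => ∑ j, r (a * b j) i • LinearMap.proj j
  have actF_apply : ∀ a f i, actF a f i = ∑ j, r (a * b j) i • f j := fun a f i => by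
    simp [actF]
  let el : A → V → (Fin m → V) := fun a v i => r a i • v
  have hact_el : ∀ a a' v, actF a (el a' v) = el (a * a') v := fun a a' v => by
    ext i
    rw [actF_apply]
    change ∑ j, r (a * b j) i • (r a' j • v) = r (a * a') i • v
    simp only [smul_smul, ← Finset.sum_smul, hrb]
  have hsum_el : ∀ f : Fin m → V, f = ∑ j, el (b j) (f j) := fun f => by
    ext i
    rw [Finset.sum_apply, Finset.sum_eq_single i]
    · change f i = r (b i) i • f i
      rw [hrb1, Pi.single_eq_same, one_smul]
    · intro j _ hj
      change r (b j) i • f j = 0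
      rw [hrb1, Pi.single_eq_of_ne hj.symm, zero_smul]
    · simp
  have hactmul : ∀ a a' f, actF (a * a') f = actF a (actF a' f) := fun a a' f => by
    rw [hsum_el f]
    simp only [map_sum, hact_el, mul_assoc]
  have hactone : actF e' = 1 := LinearMap.ext fun f => by
    rw [hsum_el f]
    simp only [map_sum, hact_el, Module.End.one_apply]
    refine Finset.sum_congr rfl fun j _ => ?_
    rw [(he' (b j) (Finset.mem_image_of_mem b (Finset.mem_univ j))).1]
  let F : NUModule k A k :=
    { carrier := Fin m → V
      act :=
        { toFun := actF
          map_mul' := fun a a' => LinearMap.ext (hactmul a a')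
          map_zero' := by ext f i; simp [actF]
          map_add' := fun a a' => LinearMap.ext fun f => by
            ext i
            rw [LinearMap.add_apply, Pi.add_apply, actF_apply, actF_apply, actF_apply]
            simp only [add_mul, map_add, Pi.add_apply, add_smul, Finset.sum_add_distrib] }
      act_smul := fun c a => LinearMap.ext fun f => by
        ext i
        change actF (c • a) f i = c • actF a f i
        rw [actF_apply, actF_apply]
        simp only [smul_mul_assoc, map_smul, Pi.smul_apply, Finset.smul_sum, smul_smul, smul_eq_mul]
      unital := fun f => Submodule.subset_span ⟨e', f, by
        change actF e' f = f
        rw [hactone]; rfl⟩ }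
  have hF : F.HasUnit := ⟨e', hactone⟩
  have hFin : Module.Finite k F := inferInstanceAs (Module.Finite k (Fin m → V))
  let π : (Fin m → V) →ₗ[k] V := ∑ j, V.act (b j) ∘ₗ LinearMap.proj j
  have hπ : ∀ a v, π (el a v) = V.act a v := fun a v => by
    have h1 : V.act a = V.act (a * e) := by rw [map_mul, he, mul_one]
    rw [h1, hr, act_sum_smul]
    simp [π, el]
  -- On tensors this is `ae ⊗ v ↦ form (a e) • (e ⊗ v)`. Its trace expands `a e` along the family
  -- `y`, hence is the identity.
  let φ : (Fin m → V) →ₗ[k] (Fin m → V) :=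
    LinearMap.pi fun i => r e i • ∑ j, 𝔉.form (b j) • LinearMap.proj j
  have hφ : ∀ a v, φ (el a v) = 𝔉.form (a * e) • el e v := fun a v => by
    ext i
    rw [hr, map_sum, Pi.smul_apply]
    simp only [φ, el, LinearMap.pi_apply, LinearMap.smul_apply, LinearMap.sum_apply,
      LinearMap.proj_apply, map_smul, smul_eq_mul, smul_smul, ← Finset.sum_smul]
    congr 1
    rw [mul_comm]
    congr 1
    exact Finset.sum_congr rfl fun j _ => mul_comm _ _
  refine ⟨F, hFin, hF, π, φ, fun a f => ?_, fun v => ⟨el e v, by rw [hπ, he]; rfl⟩, ?_⟩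
  · change π (actF a f) = V.act a (π f)
    rw [hsum_el (show Fin m → V from f)]
    simp only [map_sum, hact_el, hπ, act_mul_apply]
  · obtain ⟨G, hG, -, hG'⟩ := 𝔉.exists_common_finset hF hF
    refine LinearMap.ext fun f => ?_
    have key : ∀ j v, 𝔉.ltr (M := F) (N := F) φ hF (el (b j) v) = el (b j) v := fun j v => by
      rw [ltr_apply, 𝔉.tr_apply _ G hG]
      have h1 := DFunLike.congr_fun (𝔉.act_expand_y F G hG' (b j)) (el e v)
      rw [LinearMap.sum_apply] at h1
      have h2 : F.act (b j) (el e v) = el (b j) v := by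
        refine (hact_el _ _ _).trans ?_
        rw [hbe]
      rw [← h2]
      refine Eq.trans ?_ h1.symm
      refine Finset.sum_congr rfl fun s _ => ?_
      change actF (𝔉.y s) (φ (actF (𝔉.x s) (actF (b j) (el e v)))) = 
        𝔉.form (𝔉.x s * b j) • actF (𝔉.y s) (el e v)
      rw [hact_el, hact_el, hφ, map_smul, mul_assoc, mul_assoc, hee, hbe]
    have h3 := hsum_el (show Fin m → V from f)
    have h4 : 𝔉.ltr (M := F) (N := F) φ hF (∑ j, el (b j) (f j) : Fin m → V) =
        (∑ j, el (b j) (f j) : Fin m → V) := by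
      refine (map_sum (𝔉.ltr (M := F) (N := F) φ hF)
        (fun j => (el (b j) (f j) : F)) Finset.univ).trans ?_
      exact Finset.sum_congr rfl fun j _ => key j _
    rw [← h3] at h4
    exact h4

/-- A projective module has an endomorphism of trace one. -/
lemma exists_ltr_eq_id (𝔉 : FrobeniusSystem k A ι) (hP : P.IsProjective) (hu : P.HasUnit) :
    ∃ φ : P →ₗ[k] P, 𝔉.ltr φ hu = LinearMap.id := by
  have := hP.1
  obtain ⟨F, hFin, hF, π, φ, hπ, hπs, hφ⟩ := 𝔉.exists_cover P
  -- A projective module is a retract of its cover, and having an endomorphism of trace one passes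
  -- to retracts.
  obtain ⟨h, hh, he⟩ := hP.2 F P hFin this π LinearMap.id hπ hπs fun _ _ => rfl
  refine ⟨π ∘ₗ φ ∘ₗ h, ?_⟩
  rw [𝔉.ltr_comp_left hu hπ, 𝔉.ltr_comp_right hu hF hh, hφ, LinearMap.id_comp, he]

lemma exists_projective_cover_map (𝔉 : FrobeniusSystem k A ι) (V : NUModule k A k)
    [Module.Finite k V] :
    ∃ (F : NUModule k A k) (π : F →ₗ[k] V), F.IsProjective ∧ IsHom π ∧ Function.Surjective π := by
  obtain ⟨F, hFin, hF, π, φ, hπ, hπs, hφ⟩ := 𝔉.exists_cover V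
  exact ⟨F, π, 𝔉.isProjective_of_ltr hF φ hφ, hπ, hπs⟩

/-- Every finite dimensional module has a chart. -/
lemma exists_chart (𝔉 : FrobeniusSystem k A ι) (V : NUModule k A k) [Module.Finite k V] :
    ∃ n p : ℕ, Nonempty (Chart V (Fin n) (Fin p)) := by
  obtain ⟨e, hee, he⟩ := 𝔉.exists_idempotent_unit V
  obtain ⟨m, b, r, hr, hre, hrb1, hbe⟩ := 𝔉.exists_left_coordinates e hee
  -- Only the corner `eAe` matters for the action on `V` and on its lifts; it is finite dimensional,
  -- and a basis of it supplies the coordinates.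
  let f : A →ₗ[k] A := LinearMap.mulLeft k e ∘ₗ LinearMap.mulRight k e
  have hf : ∀ a, f a = e * (a * e) := fun a => rfl
  have hff : ∀ a, f (f a) = f a := fun a => by
    simp only [hf]
    rw [mul_assoc, mul_assoc, hee, ← mul_assoc, hee]
  have hfin : Module.Finite k (LinearMap.range f) := by
    have hle : LinearMap.range f ≤ Submodule.span k (Set.range fun i => e * b i) := by
      rintro _ ⟨a, rfl⟩
      rw [hf, hr, Finset.mul_sum]
      refine sum_mem fun i _ => ?_
      rw [mul_smul_comm]
      exact Submodule.smul_mem _ _ (Submodule.subset_span ⟨i, rfl⟩)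
    have := FiniteDimensional.span_of_finite k (Set.finite_range fun i => e * b i)
    exact Submodule.finiteDimensional_of_le hle
  let B := Module.finBasis k (LinearMap.range f)
  have hfB : ∀ i, f.rangeRestrict (B i) = B i := fun i => Subtype.ext (by
    obtain ⟨a, ha⟩ := (B i).2
    change f (B i) = B i
    rw [← ha, hff])
  have hzero : ∀ a, B.equivFun (f.rangeRestrict a) = 0 → e * (a * e) = 0 := fun a ha => by
    have h1 : f.rangeRestrict a = 0 := by
      rw [← B.equivFun.map_zero] at ha
      exact B.equivFun.injective ha
    exact congrArg Subtype.val h1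
  have hact : ∀ {R : Type u} [CommRing R] [Algebra k R] (M : NUModule k A R), M.act e = 1 →
      ∀ a, B.equivFun (f.rangeRestrict a) = 0 → M.act a = 0 := by
    intro R _ _ M hM a ha
    have h1 := congrArg M.act (hzero a ha)
    rwa [map_mul, map_mul, hM, one_mul, mul_one, map_zero] at h1
  refine ⟨_, _, ⟨{
    basis := Module.finBasis k V
    coord := B.equivFun.toLinearMap ∘ₗ f.rangeRestrict
    gen := fun i => B i
    coord_gen := fun i => ?_
    unit := e
    act_unit := he
    act_eq_zero := hact V he
    lift_act_eq_zero := fun R L => hact L.M ?_ }⟩⟩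
  · change B.equivFun (f.rangeRestrict (B i)) = _
    rw [hfB]
    ext j
    simp [Pi.single_apply, eq_comm]
  -- On a lift `e` acts as an idempotent reducing to the identity; it is bijective, hence equal to
  -- the identity.
  · have h1 := L.bijective_of_red L (L.M.act e) fun m => by
      rw [L.red_act, he]; rfl
    refine LinearMap.ext fun m => h1.1 ?_
    rw [← act_mul_apply, hee]
    rfl

end Projective

end FrobeniusSystem

/-! ### The Frobenius system of the repetitive algebra -/

namespace RepetitiveAlgebra

variable {k : Type u} [Field k] {Λ : Type v} [Ring Λ] [Algebra k Λ]

@[simp] lemma alg_smul (c : k) (x : RepetitiveAlgebra k Λ) (i : ℤ) :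
    (c • x).alg i = c • x.alg i := rfl

@[simp] lemma dual_smul (c : k) (x : RepetitiveAlgebra k Λ) (i : ℤ) :
    (c • x).dual i = c • x.dual i := rfl

instance : IsScalarTower k (RepetitiveAlgebra k Λ) (RepetitiveAlgebra k Λ) where
  smul_assoc c x y := by
    ext i
    · simp
    · simp

instance : SMulCommClass k (RepetitiveAlgebra k Λ) (RepetitiveAlgebra k Λ) where
  smul_comm c x y := by
    ext i
    · simp
    · simp

/-- The element with a single component in `Λ`. -/
noncomputable def ofAlg (i : ℤ) (l : Λ) : RepetitiveAlgebra k Λ := (Finsupp.single i l, 0)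

/-- The element with a single component in `DΛ`. -/
noncomputable def ofDual (i : ℤ) (φ : Module.Dual k Λ) : RepetitiveAlgebra k Λ :=
  (0, Finsupp.single i φ)

lemma alg_ofAlg (i : ℤ) (l : Λ) (n : ℤ) :
    (ofAlg i l : RepetitiveAlgebra k Λ).alg n = if n = i then l else 0 := by
  rw [show (ofAlg i l : RepetitiveAlgebra k Λ).alg n = Finsupp.single i l n from rfl,
    Finsupp.single_apply]
  simp only [eq_comm]

@[simp] lemma dual_ofAlg (i : ℤ) (l : Λ) (n : ℤ) :
    (ofAlg i l : RepetitiveAlgebra k Λ).dual n = 0 := rfl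

@[simp] lemma alg_ofDual (i : ℤ) (φ : Module.Dual k Λ) (n : ℤ) : (ofDual i φ).alg n = 0 := rfl

lemma dual_ofDual (i : ℤ) (φ : Module.Dual k Λ) (n : ℤ) :
    (ofDual i φ).dual n = if n = i then φ else 0 := by
  rw [show (ofDual i φ).dual n = Finsupp.single i φ n from rfl, Finsupp.single_apply]
  simp only [eq_comm]

/-- The component in `DΛ` as a linear map. -/
noncomputable def dualLinear (n : ℤ) : RepetitiveAlgebra k Λ →ₗ[k] Module.Dual k Λ where
  toFun x := x.dual n
  map_add' _ _ := rfl
  map_smul' _ _ := rfl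

/-- The component in `Λ` as a linear map. -/
noncomputable def algLinear (n : ℤ) : RepetitiveAlgebra k Λ →ₗ[k] Λ where
  toFun x := x.alg n
  map_add' _ _ := rfl
  map_smul' _ _ := rfl

lemma finite_dual (x : RepetitiveAlgebra k Λ) : {i | x.dual i ≠ 0}.Finite :=
  x.2.support.finite_toSet.subset fun _ h => Finsupp.mem_support_iff.2 h

lemma finite_alg (x : RepetitiveAlgebra k Λ) : {i | x.alg i ≠ 0}.Finite :=
  x.1.support.finite_toSet.subset fun _ h => Finsupp.mem_support_iff.2 h

/-- The indices `i` such that a component of `x` of index `i` or `i - 1` is non-zero. -/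
lemma exists_window (x : RepetitiveAlgebra k Λ) : ∃ N : Finset ℤ, ∀ i ∉ N,
    x.alg i = 0 ∧ x.alg (i - 1) = 0 ∧ x.dual i = 0 ∧ x.dual (i - 1) = 0 := by
  classical
  let F := x.finite_alg.toFinset ∪ x.finite_dual.toFinset
  -- The translate takes care of the components of index `i - 1`.
  refine ⟨F ∪ F.image (· + 1), fun i hi => ?_⟩
  rw [Finset.mem_union, not_or] at hi
  have h : ∀ j, j ∉ F → x.alg j = 0 ∧ x.dual j = 0 := fun j hj => by
    simpa [F] using hj
  have h1 : i - 1 ∉ F := fun h1 => hi.2 (Finset.mem_image.2 ⟨_, h1, by omega⟩)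
  exact ⟨(h i hi.1).1, (h _ h1).1, (h i hi.1).2, (h _ h1).2⟩

/-- The symmetrizing form `(a, φ) ↦ ∑ φ_i(1)`. -/
noncomputable def form : RepetitiveAlgebra k Λ →ₗ[k] k :=
  Finsupp.lsum k (fun _ : ℤ => LinearMap.applyₗ (1 : Λ)) ∘ₗ
    LinearMap.snd k (ℤ →₀ Λ) (ℤ →₀ Module.Dual k Λ)

lemma form_apply (x : RepetitiveAlgebra k Λ) : form x = ∑ᶠ i, x.dual i 1 := by
  have h : (Function.support fun i => x.dual i 1) ⊆ (x.2.support : Set ℤ) := fun i hi => by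
    refine Finsupp.mem_support_iff.2 fun h => hi ?_
    change x.2 i 1 = 0
    rw [h]; rfl
  rw [finsum_eq_sum_of_support_subset _ h]
  rfl

/-- The shift of the repetitive algebra. -/
noncomputable def shift : RepetitiveAlgebra k Λ ≃ₗ[k] RepetitiveAlgebra k Λ :=
  LinearEquiv.prodCongr (Finsupp.domLCongr (Equiv.addRight (1 : ℤ)))
    (Finsupp.domLCongr (Equiv.addRight (1 : ℤ)))

@[simp] lemma alg_shift (x : RepetitiveAlgebra k Λ) (i : ℤ) : (shift x).alg i = x.alg (i - 1) :=
  rfl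

@[simp] lemma dual_shift (x : RepetitiveAlgebra k Λ) (i : ℤ) :
    (shift x).dual i = x.dual (i - 1) := rfl

lemma form_mul (x y : RepetitiveAlgebra k Λ) :
    form (x * y) = ∑ᶠ i, y.dual i (x.alg (i + 1)) + ∑ᶠ i, x.dual i (y.alg i) := by
  rw [form_apply, ← finsum_add_distrib]
  · simp
  · exact y.finite_dual.subset fun i hi h => hi (by simp [h])
  · exact x.finite_dual.subset fun i hi h => hi (by simp [h])

lemma form_ofAlg_mul (i : ℤ) (l : Λ) (x : RepetitiveAlgebra k Λ) :
    form (ofAlg i l * x) = x.dual (i - 1) l := by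
  rw [form_mul, finsum_eq_single _ (i - 1)]
  · simp [alg_ofAlg]
  · intro n hn
    rw [alg_ofAlg, if_neg (by omega), map_zero]

lemma form_ofDual_mul (i : ℤ) (φ : Module.Dual k Λ) (x : RepetitiveAlgebra k Λ) :
    form (ofDual i φ * x) = φ (x.alg i) := by
  rw [form_mul, finsum_eq_single (fun n => (ofDual i φ).dual n (x.alg n)) i]
  · simp [dual_ofDual]
  · intro n hn
    rw [dual_ofDual, if_neg hn]; rfl

lemma form_mul_ofAlg (i : ℤ) (l : Λ) (x : RepetitiveAlgebra k Λ) :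
    form (x * ofAlg i l) = x.dual i l := by
  rw [form_mul, finsum_eq_single (fun n => x.dual n ((ofAlg i l : RepetitiveAlgebra k Λ).alg n)) i]
  · simp [alg_ofAlg]
  · intro n hn
    rw [alg_ofAlg, if_neg hn, map_zero]

lemma form_mul_ofDual (i : ℤ) (φ : Module.Dual k Λ) (x : RepetitiveAlgebra k Λ) :
    form (x * ofDual i φ) = φ (x.alg (i + 1)) := by
  rw [form_mul, finsum_eq_single _ i]
  · simp [dual_ofDual]
  · intro n hn
    rw [dual_ofDual, if_neg hn]; rfl

/-- The two sums of `form_mul` trade places up to moving the indices by one, so the shift is the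
Nakayama automorphism of the form. -/
lemma form_shift_mul (x y : RepetitiveAlgebra k Λ) : form (shift y * x) = form (x * y) := by
  rw [form_mul, form_mul, add_comm]
  congr 1
  · rw [← finsum_comp_equiv (Equiv.addRight (1 : ℤ))]
    simp
  · simp

section Family

variable {d : ℕ} (b : Module.Basis (Fin d) k Λ)

/-- The first of the dual families. -/
noncomputable def leftFamily : (ℤ × Fin d) ⊕ (ℤ × Fin d) → RepetitiveAlgebra k Λ
  | Sum.inl (i, j) => ofAlg i (b j)
  | Sum.inr (i, j) => ofDual i (b.coord j)

/-- The second of the dual families. -/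
noncomputable def rightFamily : (ℤ × Fin d) ⊕ (ℤ × Fin d) → RepetitiveAlgebra k Λ
  | Sum.inl (i, j) => ofDual (i - 1) (b.coord j)
  | Sum.inr (i, j) => ofAlg i (b j)

/-- This gives the local finiteness of the dual families: for an index outside the window of `x`,
all the products entering the Frobenius system vanish. -/
lemma mul_eq_zero_of_window {x : RepetitiveAlgebra k Λ} {i : ℤ}
    (h : x.alg i = 0 ∧ x.alg (i - 1) = 0 ∧ x.dual i = 0 ∧ x.dual (i - 1) = 0) (l : Λ)
    (φ : Module.Dual k Λ) :
    ofAlg i l * x = 0 ∧ ofDual i φ * x = 0 ∧ ofDual (i - 1) φ * x = 0 ∧ x * ofAlg i l = 0 ∧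
      x * ofDual (i - 1) φ = 0 := by
  obtain ⟨h1, h2, h3, h4⟩ := h
  refine ⟨?_, ?_, ?_, ?_, ?_⟩
  · ext n : 1
    · rw [alg_mul, alg_ofAlg]
      split_ifs with hn
      · subst hn; simp [h1]
      · simp
    · rw [dual_mul, alg_ofAlg, dual_ofAlg]
      split_ifs with hn
      · rw [show n = i - 1 by omega, h4]; ext; simp
      · ext; simp
  · ext n : 1
    · simp
    · rw [dual_mul, alg_ofDual, dual_ofDual]
      split_ifs with hn
      · subst hn; ext; simp [h1]
      · ext; simp
  · ext n : 1
    · simp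
    · rw [dual_mul, alg_ofDual, dual_ofDual]
      split_ifs with hn
      · subst hn; ext; simp [h2]
      · ext; simp
  · ext n : 1
    · rw [alg_mul, alg_ofAlg]
      split_ifs with hn
      · subst hn; simp [h1]
      · simp
    · rw [dual_mul, alg_ofAlg, dual_ofAlg]
      split_ifs with hn
      · subst hn; rw [h3]; ext; simp
      · ext; simp
  · ext n : 1
    · simp
    · rw [dual_mul, alg_ofDual, dual_ofDual]
      split_ifs with hn
      · subst hn; ext; simp [h1]
      · ext; simp

lemma finite_of_window (N : Finset ℤ)
    {p : (ℤ × Fin d) ⊕ (ℤ × Fin d) → Prop}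
    (h : ∀ i ∉ N, ∀ j, ¬ p (Sum.inl (i, j)) ∧ ¬ p (Sum.inr (i, j))) :
    ∀ s, p s → s ∈ (N ×ˢ Finset.univ).disjSum (N ×ˢ (Finset.univ : Finset (Fin d))) := by
  rintro (⟨i, j⟩ | ⟨i, j⟩) hp
  · rw [Finset.inl_mem_disjSum, Finset.mem_product]
    refine ⟨?_, Finset.mem_univ _⟩
    by_contra hi
    exact (h i hi j).1 hp
  · rw [Finset.inr_mem_disjSum, Finset.mem_product]
    refine ⟨?_, Finset.mem_univ _⟩
    by_contra hi
    exact (h i hi j).2 hp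

lemma sum_coord_smul (φ : Module.Dual k Λ) : ∑ j, φ (b j) • b.coord j = φ := by
  refine b.ext fun i => ?_
  simp

/-- Components in `Λ` are expanded in `b` and those in `DΛ` in the dual basis. The coefficients are
values of the form, so this becomes both expansions required of a Frobenius system. -/
lemma eq_sum_components (x : RepetitiveAlgebra k Λ) (N N' : Finset ℤ) (hN : ∀ i ∉ N, x.alg i = 0)
    (hN' : ∀ i ∉ N', x.dual i = 0) :
    x = ∑ i ∈ N, ∑ j, b.coord j (x.alg i) • ofAlg i (b j) +
      ∑ i ∈ N', ∑ j, x.dual i (b j) • ofDual i (b.coord j) := by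
  refine RepetitiveAlgebra.ext (fun n => ?_) fun n => ?_
  · refine Eq.trans ?_ (map_add (algLinear (k := k) (Λ := Λ) n) _ _).symm
    have h1 : ∀ i ∈ N, ∑ j, algLinear n (b.coord j (x.alg i) • ofAlg i (b j) :
        RepetitiveAlgebra k Λ) = if n = i then x.alg n else 0 := fun i _ => by
      simp only [map_smul]
      change ∑ j, b.coord j (x.alg i) • (ofAlg i (b j) : RepetitiveAlgebra k Λ).alg n = _
      simp only [alg_ofAlg]
      split_ifs with h
      · subst h
        exact (b.sum_repr (x.alg n))
      · simp
    have h2 : ∑ i ∈ N', ∑ j, algLinear n (x.dual i (b j) • ofDual i (b.coord j)) = 0 :=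
      Finset.sum_eq_zero fun i _ => Finset.sum_eq_zero fun j _ => by
        rw [map_smul]
        exact smul_zero _
    rw [map_sum, map_sum]
    simp only [map_sum]
    rw [Finset.sum_congr rfl h1, Finset.sum_ite_eq, h2, add_zero]
    split_ifs with h
    · rfl
    · exact hN n h
  · refine Eq.trans ?_ (map_add (dualLinear (k := k) (Λ := Λ) n) _ _).symm
    have h1 : ∀ i ∈ N', ∑ j, dualLinear n (x.dual i (b j) • ofDual i (b.coord j)) =
        if n = i then x.dual n else 0 := fun i _ => by
      simp only [map_smul]
      change ∑ j, x.dual i (b j) • (ofDual i (b.coord j)).dual n = _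
      simp only [dual_ofDual]
      split_ifs with h
      · subst h
        exact sum_coord_smul b _
      · simp
    have h2 : ∑ i ∈ N, ∑ j, dualLinear n (b.coord j (x.alg i) • ofAlg i (b j) :
        RepetitiveAlgebra k Λ) = 0 :=
      Finset.sum_eq_zero fun i _ => Finset.sum_eq_zero fun j _ => by
        rw [map_smul]
        exact smul_zero _
    rw [map_sum, map_sum]
    simp only [map_sum]
    rw [Finset.sum_congr rfl h1, Finset.sum_ite_eq, h2, zero_add]
    split_ifs with h
    · rfl
    · exact hN' n h

/-- The local unit is the sum of the identities of the copies of `Λ` indexed by the windows of the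
elements of `T`. -/
lemma exists_local_unit (T : Finset (RepetitiveAlgebra k Λ)) :
    ∃ e : RepetitiveAlgebra k Λ, e * e = e ∧ ∀ a ∈ T, e * a = a ∧ a * e = a := by
  classical
  choose N hN using fun x : RepetitiveAlgebra k Λ => x.exists_window
  let M := T.biUnion N
  let e : RepetitiveAlgebra k Λ :=
    (Finsupp.onFinset M (fun i => if i ∈ M then (1 : Λ) else 0) (by
      intro i h
      by_contra h'
      exact h (if_neg h')), 0)
  have h1 : ∀ i, e.alg i = if i ∈ M then 1 else 0 := fun _ => rfl
  have h2 : ∀ i, e.dual i = 0 := fun _ => rfl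
  refine ⟨e, ?_, fun a ha => ?_⟩
  · ext i
    · rw [alg_mul, h1]; split_ifs <;> simp
    · simp [h2]
  · have h3 : ∀ i ∉ M, a.alg i = 0 ∧ a.alg (i - 1) = 0 ∧ a.dual i = 0 ∧ a.dual (i - 1) = 0 :=
      fun i hi => hN a i fun h => hi (Finset.mem_biUnion.2 ⟨a, ha, h⟩)
    constructor
    · ext i z
      · rw [alg_mul, h1]
        split_ifs with h
        · simp
        · simp [(h3 i h).1]
      · rw [dual_mul, h1, h2]
        split_ifs with h
        · simp
        · have := (h3 _ h).2.2.2
          rw [add_sub_cancel_right] at this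
          simp [this]
    · ext i z
      · rw [alg_mul, h1]
        split_ifs with h
        · simp
        · simp [(h3 i h).1]
      · rw [dual_mul, h1, h2]
        split_ifs with h
        · simp
        · simp [(h3 i h).2.2.1]

/-- The Frobenius system of the repetitive algebra. -/
noncomputable def frobeniusSystem :
    FrobeniusSystem k (RepetitiveAlgebra k Λ) ((ℤ × Fin d) ⊕ (ℤ × Fin d)) where
  x := leftFamily b
  y := rightFamily b
  form := form
  mu := shift
  mu_mul x y := by
    ext i
    · simp
    · simp [add_sub_cancel_right, show i - 1 + 1 = i + 1 - 1 by ring]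
  form_mu_mul x y := form_shift_mul x y
  finite_x_mul a := by
    obtain ⟨N, hN⟩ := a.exists_window
    refine (Finset.finite_toSet _).subset (finite_of_window N fun i hi j => ?_)
    have h := mul_eq_zero_of_window (hN i hi) (b j) (b.coord j)
    exact ⟨not_not.2 h.1, not_not.2 h.2.1⟩
  finite_y_mul a := by
    obtain ⟨N, hN⟩ := a.exists_window
    refine (Finset.finite_toSet _).subset (finite_of_window N fun i hi j => ?_)
    have h := mul_eq_zero_of_window (hN i hi) (b j) (b.coord j)
    exact ⟨not_not.2 h.2.2.1, not_not.2 h.1⟩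
  finite_mul_y a := by
    obtain ⟨N, hN⟩ := a.exists_window
    refine (Finset.finite_toSet _).subset (finite_of_window N fun i hi j => ?_)
    have h := mul_eq_zero_of_window (hN i hi) (b j) (b.coord j)
    exact ⟨not_not.2 h.2.2.2.2, not_not.2 h.2.2.2.1⟩
  expand_y a := by
    obtain ⟨N, hN⟩ := a.exists_window
    have h : (Function.support fun s => form (leftFamily b s * a) • rightFamily b s) ⊆
        (((N ×ˢ Finset.univ).disjSum (N ×ˢ Finset.univ) :
          Finset ((ℤ × Fin d) ⊕ (ℤ × Fin d))) : Set ((ℤ × Fin d) ⊕ (ℤ × Fin d))) := by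
      refine finite_of_window N fun i hi j => ?_
      have h := mul_eq_zero_of_window (hN i hi) (b j) (b.coord j)
      constructor
      · simp [leftFamily, h.1]
      · simp [leftFamily, h.2.1]
    rw [finsum_eq_sum_of_support_subset _ h, Finset.sum_disjSum, Finset.sum_product,
      Finset.sum_product]
    simp only [leftFamily, rightFamily, form_ofAlg_mul, form_ofDual_mul]
    -- The element paired with `ofAlg i` is `ofDual (i - 1)`, so the dual components are indexed by
    -- `N` moved down by one.
    have h1 := eq_sum_components b a N (N.image (· - 1)) (fun i hi => (hN i hi).1) fun i hi => by
      have h2 : i + 1 ∉ N := fun h => hi (Finset.mem_image.2 ⟨_, h, by omega⟩)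
      simpa using (hN _ h2).2.2.2
    rw [Finset.sum_image fun _ _ _ _ h => by simpa using h, add_comm] at h1
    exact h1
  expand_x a := by
    obtain ⟨N, hN⟩ := a.exists_window
    have h : (Function.support fun s => form (a * rightFamily b s) • leftFamily b s) ⊆
        (((N ×ˢ Finset.univ).disjSum (N ×ˢ Finset.univ) :
          Finset ((ℤ × Fin d) ⊕ (ℤ × Fin d))) : Set ((ℤ × Fin d) ⊕ (ℤ × Fin d))) := by
      refine finite_of_window N fun i hi j => ?_
      have h := mul_eq_zero_of_window (hN i hi) (b j) (b.coord j)
      constructor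
      · simp [rightFamily, h.2.2.2.2]
      · simp [rightFamily, h.2.2.2.1]
    rw [finsum_eq_sum_of_support_subset _ h, Finset.sum_disjSum, Finset.sum_product,
      Finset.sum_product]
    simp only [leftFamily, rightFamily, form_mul_ofAlg, form_mul_ofDual, sub_add_cancel]
    exact eq_sum_components b a N N (fun i hi => (hN i hi).1) fun i hi => (hN i hi).2.2.1
  exists_local_unit := exists_local_unit

end Family

end RepetitiveAlgebra

/-! ### Equivalent deformation functors -/

section DeformationEquivalence

open NUModule Lift

variable {k : Type u} [Field k] {A : Type w} [NonUnitalRing A] [Module k A]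

/-- A correspondence between lifts which identifies the deformation functors of `V` and `W`. -/
def DeformationEquivalent (V W : NUModule k A k) : Prop :=
  ∃ rel : ∀ R : CompleteLocalAlgebra k, Lift V R → Lift W R → Prop,
    (∀ R L, ∃ L', rel R L L') ∧ (∀ R L', ∃ L, rel R L L') ∧
    ∀ (R S : CompleteLocalAlgebra k) (θ : R →ₐ[k] S) (L₁ : Lift V R) (L₁' : Lift W R)
      (L₂ : Lift V S) (L₂' : Lift W S), rel R L₁ L₁' → rel S L₂ L₂' →
      (Induces θ L₁ L₂ ↔ Induces θ L₁' L₂')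

namespace DeformationEquivalent

variable {V W X : NUModule k A k}

lemma symm (h : DeformationEquivalent V W) : DeformationEquivalent W V := by
  obtain ⟨rel, h1, h2, h3⟩ := h
  exact ⟨fun R L L' => rel R L' L, h2, h1, fun R S θ L₁ L₁' L₂ L₂' h h' =>
    (h3 R S θ _ _ _ _ h h').symm⟩

lemma trans (h : DeformationEquivalent V W) (h' : DeformationEquivalent W X) :
    DeformationEquivalent V X := by
  obtain ⟨rel, h1, h2, h3⟩ := h
  obtain ⟨rel', h1', h2', h3'⟩ := h'
  refine ⟨fun R L L' => ∃ M, rel R L M ∧ rel' R M L', fun R L => ?_, fun R L' => ?_, ?_⟩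
  · obtain ⟨M, hM⟩ := h1 R L
    obtain ⟨L', hL⟩ := h1' R M
    exact ⟨L', M, hM, hL⟩
  · obtain ⟨M, hM⟩ := h2' R L'
    obtain ⟨L, hL⟩ := h2 R M
    exact ⟨L, M, hL, hM⟩
  · rintro R S θ L₁ L₁' L₂ L₂' ⟨M, ha, hb⟩ ⟨M', ha', hb'⟩
    exact (h3 R S θ _ _ _ _ ha ha').trans (h3' R S θ _ _ _ _ hb hb')

/-- Universality is expressed by existence and uniqueness in `Induces`, and the correspondence
reaches every lift on either side, so the same ring serves both modules. -/
lemma exists_isUniversal (h : DeformationEquivalent V W) {R : CompleteLocalAlgebra k} {U : Def V R}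
    (hU : IsUniversal V R U) : ∃ U' : Def W R, IsUniversal W R U' := by
  obtain ⟨rel, h1, h2, h3⟩ := h
  induction U using Quotient.inductionOn with
  | h L =>
    obtain ⟨ha, hb⟩ := (isUniversal_iff L).1 hU
    obtain ⟨L', hL⟩ := h1 R L
    refine ⟨Quotient.mk _ L', (isUniversal_iff L').2 ⟨fun S M' => ?_, fun S M' θ θ' h h' => ?_⟩⟩
    · obtain ⟨M, hM⟩ := h2 S M'
      obtain ⟨θ, hθ⟩ := ha S M
      exact ⟨θ, (h3 R S θ _ _ _ _ hL hM).1 hθ⟩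
    · obtain ⟨M, hM⟩ := h2 S M'
      exact hb S M θ θ' ((h3 R S θ _ _ _ _ hL hM).2 h) ((h3 R S θ' _ _ _ _ hL hM).2 h')

/-- Universality and the deformation ring are transported along equivalences. -/
lemma isUniversal_and_nonempty_algEquiv (h : DeformationEquivalent V W)
    (hV : ∃ (R₀ : CompleteLocalAlgebra k) (U₀ : Def V R₀), IsUniversal V R₀ U₀)
    {R : CompleteLocalAlgebra k} {U : Def V R} (hU : IsVersal V R U)
    {R' : CompleteLocalAlgebra k} {U' : Def W R'} (hU' : IsVersal W R' U') :
    IsUniversal W R' U' ∧ Nonempty (R' ≃ₐ[k] R) := by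
  obtain ⟨R₀, U₀, h₀⟩ := hV
  obtain ⟨U₀', h₀'⟩ := h.exists_isUniversal h₀
  obtain ⟨e⟩ := hU'.nonempty_algEquiv h₀'.isVersal
  obtain ⟨e'⟩ := h₀.isVersal.nonempty_algEquiv hU
  exact ⟨hU'.isUniversal h₀', ⟨e.trans e'⟩⟩

end DeformationEquivalent

/-! ### Twisting and isomorphisms -/

/-- The module twisted by an automorphism of the algebra. -/
def NUModule.twist {R : Type u} [CommRing R] [Algebra k R] (M : NUModule k A R) (μ : A ≃ₗ[k] A)
    (hμ : ∀ a b, μ (a * b) = μ a * μ b) : NUModule k A R where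
  carrier := M
  act :=
    { toFun := fun a => M.act (μ a)
      map_mul' := fun a b => by rw [hμ, map_mul]
      map_zero' := by rw [map_zero, map_zero]
      map_add' := fun a b => by rw [map_add, map_add] }
  act_smul c a := by
    change M.act (μ (c • a)) = algebraMap k R c • M.act (μ a)
    rw [map_smul, M.act_smul]
  unital m := by
    refine Submodule.span_mono ?_ (M.unital m)
    rintro _ ⟨a, y, rfl⟩
    refine ⟨μ.symm a, y, ?_⟩
    change M.act (μ (μ.symm a)) y = _
    rw [LinearEquiv.apply_symm_apply]

lemma Lift.exists_twist {V W : NUModule k A k} (μ : A ≃ₗ[k] A)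
    (hμ : ∀ a b, μ (a * b) = μ a * μ b) (t : V ≃ₗ[k] W)
    (ht : ∀ a v, t (V.act (μ a) v) = W.act a (t v)) {R : CompleteLocalAlgebra k} (L : Lift V R) :
    ∃ (L' : Lift W R) (T : L.M ≃ₗ[R] L'.M), (∀ a m, T (L.M.act (μ a) m) = L'.M.act a (T m)) ∧
      ∀ m, L'.red (T m) = t (L.red m) := by
  classical
  have := L.finite_of_lift
  obtain ⟨b, hb⟩ := L.exists_basis (Module.finBasis k V)
  let L' : Lift W R := ofRed (L.M.twist μ hμ) b ((Module.finBasis k V).map t)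
    (t.toLinearMap.toAddMonoidHom.comp L.red)
    (fun r m => by
      change t (L.red (r • (show L.M from m))) = _
      rw [L.red_smul, map_smul]; rfl)
    (fun a m => (congrArg t (L.red_act (μ a) m)).trans (ht a (L.red m)))
    (fun i => by
      change t (L.red (b i)) = _
      rw [hb]; rfl)
  exact ⟨L', LinearEquiv.refl R L.M, fun _ _ => rfl, fun m =>
    red_ofRed (L.M.twist μ hμ) _ _ _ _ _ _ m⟩

/-- Modules which are isomorphic up to a twist have equivalent deformation functors. -/
lemma DeformationEquivalent.of_twist {V W : NUModule k A k} (μ : A ≃ₗ[k] A)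
    (hμ : ∀ a b, μ (a * b) = μ a * μ b) (t : V ≃ₗ[k] W)
    (ht : ∀ a v, t (V.act (μ a) v) = W.act a (t v)) : DeformationEquivalent V W := by
  refine ⟨fun R L L' => ∃ T : L.M ≃ₗ[R] L'.M, (∀ a m, T (L.M.act (μ a) m) = L'.M.act a (T m)) ∧
      ∀ m, L'.red (T m) = t (L.red m), fun R L => exists_twist μ hμ t ht L, fun R L' => ?_, ?_⟩
  · obtain ⟨L, T, hT, hr⟩ := exists_twist (V := W) (W := V) μ.symm (fun a b => by
      rw [LinearEquiv.symm_apply_eq, hμ, LinearEquiv.apply_symm_apply,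
        LinearEquiv.apply_symm_apply]) t.symm (fun a v => by
      rw [LinearEquiv.symm_apply_eq]
      have := ht (μ.symm a) (t.symm v)
      rw [LinearEquiv.apply_symm_apply, LinearEquiv.apply_symm_apply] at this
      exact this.symm) L'
    refine ⟨L, T.symm, fun a m => ?_, fun m => ?_⟩
    · rw [LinearEquiv.symm_apply_eq]
      have := hT (μ a) (T.symm m)
      rw [LinearEquiv.symm_apply_apply, LinearEquiv.apply_symm_apply] at this
      exact this.symm
    · have := hr (T.symm m)
      rw [LinearEquiv.apply_symm_apply] at this
      rw [this, LinearEquiv.apply_symm_apply]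
  · rintro R S θ L₁ L₁' L₂ L₂' ⟨T₁, hT₁, hr₁⟩ ⟨T₂, hT₂, hr₂⟩
    constructor
    · rintro ⟨f, hf, hA, hr⟩
      refine ⟨(T₂.toLinearMap.toAddMonoidHom.comp f).comp T₁.symm.toLinearMap.toAddMonoidHom,
        fun r m => ?_, fun a m => ?_, fun m => ?_⟩
      · change T₂ (f (T₁.symm (r • m))) = θ r • T₂ (f (T₁.symm m))
        rw [map_smul, hf, map_smul]
      · change T₂ (f (T₁.symm (L₁'.M.act a m))) = L₂'.M.act a (T₂ (f (T₁.symm m)))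
        have h1 : T₁.symm (L₁'.M.act a m) = L₁.M.act (μ a) (T₁.symm m) := by
          rw [LinearEquiv.symm_apply_eq, hT₁, LinearEquiv.apply_symm_apply]
        rw [h1, hA, hT₂]
      · change L₂'.red (T₂ (f (T₁.symm m))) = L₁'.red m
        rw [hr₂, hr, ← hr₁, LinearEquiv.apply_symm_apply]
    · rintro ⟨f, hf, hA, hr⟩
      refine ⟨(T₂.symm.toLinearMap.toAddMonoidHom.comp f).comp T₁.toLinearMap.toAddMonoidHom,
        fun r m => ?_, fun a m => ?_, fun m => ?_⟩
      · change T₂.symm (f (T₁ (r • m))) = θ r • T₂.symm (f (T₁ m))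
        rw [map_smul, hf, map_smul]
      · change T₂.symm (f (T₁ (L₁.M.act a m))) = L₂.M.act a (T₂.symm (f (T₁ m)))
        have h1 := hT₁ (μ.symm a) m
        have h2 := hT₂ (μ.symm a) (T₂.symm (f (T₁ m)))
        rw [LinearEquiv.apply_symm_apply] at h1 h2
        rw [h1, LinearEquiv.symm_apply_eq, hA, h2, LinearEquiv.apply_symm_apply]
      · change L₂.red (T₂.symm (f (T₁ m))) = L₁.red m
        apply t.injective
        rw [← hr₂, LinearEquiv.apply_symm_apply, hr, hr₁]

lemma DeformationEquivalent.of_iso {V W : NUModule k A k} (t : V ≃ₗ[k] W)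
    (ht : IsHom t.toLinearMap) : DeformationEquivalent V W :=
  of_twist (LinearEquiv.refl k A) (fun _ _ => rfl) t ht

/-! ### Constructions of lifts -/

namespace CompleteLocalAlgebra

/-- The ground field. -/
def ground (k : Type u) [Field k] : CompleteLocalAlgebra k where
  carrier := k
  isAdicComplete := by
    rw [IsLocalRing.maximalIdeal_eq_bot]
    infer_instance
  residue_bijective := ⟨(algebraMap k _).injective, fun y => by
    obtain ⟨x, rfl⟩ := IsLocalRing.residue_surjective y
    exact ⟨x, rfl⟩⟩

end CompleteLocalAlgebra

namespace Lift

/-- The module is a lift of itself over `k`, which is then extended along `k → R`. -/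
lemma nonempty (V : NUModule k A k) [Module.Finite k V] (R : CompleteLocalAlgebra k) :
    Nonempty (Lift V R) := by
  have h : ∀ c : k, (CompleteLocalAlgebra.ground k).aug c = c := fun c =>
    (CompleteLocalAlgebra.ground k).aug.commutes c
  let L₀ : Lift V (CompleteLocalAlgebra.ground k) :=
    ofRed (R := CompleteLocalAlgebra.ground k) V (Module.finBasis k V) (Module.finBasis k V)
      (AddMonoidHom.id V) (fun r m => (congrArg (fun c : k => c • (show V from m)) (h r)).symm)
      (fun _ _ => rfl) fun _ => rfl
  exact ⟨L₀.map (Algebra.ofId k R)⟩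

variable {V W X : NUModule k A k} {R S : CompleteLocalAlgebra k}

/-- A family which reduces to a basis is a basis. -/
lemma exists_basis_eq (L : Lift V R) {ι : Type*} [Fintype ι] (v : Module.Basis ι k V)
    (m : ι → L.M) (hm : ∀ i, L.red (m i) = v i) : ∃ b : Module.Basis ι R L.M, ∀ i, b i = m i := by
  classical
  obtain ⟨b, hb⟩ := L.exists_basis v
  let f : L.M →ₗ[R] L.M := b.constr ℕ m
  have hfb : ∀ i, f (b i) = m i := fun i => b.constr_basis ℕ m i
  have hf : ∀ z, L.red (f z) = L.red z := fun z => by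
    conv_lhs => rw [← b.sum_repr z]
    rw [map_sum, map_sum, L.red_sum b z]
    refine Finset.sum_congr rfl fun i _ => ?_
    rw [map_smul, L.red_smul, hfb, hm, hb]
  exact ⟨b.map (equivOfRed L L f hf), fun i => hfb i⟩

/-- This serves to correct maps satisfying an identity only after reduction; the correction reduces
to the identity and respects homomorphisms. -/
lemma exists_mul_inv (L : Lift V R) (f : L.M →ₗ[R] L.M) (hf : ∀ m, L.red (f m) = L.red m) :
    ∃ g : L.M →ₗ[R] L.M, f ∘ₗ g = LinearMap.id ∧ g ∘ₗ f = LinearMap.id ∧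
      (∀ m, L.red (g m) = L.red m) ∧ (IsHom f → IsHom g) := by
  let e := equivOfRed L L f hf
  refine ⟨e.symm.toLinearMap, LinearMap.ext fun m => e.apply_symm_apply m,
    LinearMap.ext fun m => e.symm_apply_apply m, red_equivOfRed_symm L L f hf, fun hA a m => ?_⟩
  change e.symm (L.M.act a m) = L.M.act a (e.symm m)
  rw [LinearEquiv.symm_apply_eq]
  refine Eq.trans ?_ (hA a (e.symm m)).symm
  exact congrArg _ (e.apply_symm_apply m).symm

/-- The lift cut out by an idempotent. -/
lemma exists_of_idempotent (L : Lift W R) (hL : L.M.HasUnit) (ε : L.M →ₗ[R] L.M)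
    (hε : ∀ m, ε (ε m) = ε m)
    (hmul : ∀ a b m, ε (L.M.act a (ε (L.M.act b (ε m)))) = ε (L.M.act a (L.M.act b (ε m))))
    (i : X →ₗ[k] W) (q : W →ₗ[k] X) (hqi : ∀ x, q (i x) = x)
    (hred : ∀ m, L.red (ε m) = i (q (L.red m))) (hact : ∀ a x, q (W.act a (i x)) = X.act a x) :
    ∃ (L' : Lift X R) (j : L'.M →ₗ[R] L.M) (p : L.M →ₗ[R] L'.M), (∀ m, p (j m) = m) ∧
      (∀ m, j (p m) = ε m) ∧ (∀ m, L.red (j m) = i (L'.red m)) ∧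
      (∀ m, L'.red (p m) = q (L.red m)) ∧ ∀ a m, L'.M.act a m = p (L.M.act a (j m)) := by
  classical
  have hfin := L.finite_of_lift
  have hXfin : Module.Finite k X := Module.Finite.of_surjective q fun x => ⟨i x, hqi x⟩
  let K := LinearMap.range ε
  let p₀ : L.M →ₗ[R] K := ε.rangeRestrict
  have hK : ∀ m : K, ε m = m := by
    rintro ⟨_, m, rfl⟩
    exact hε m
  have hp₀ : ∀ m : K, p₀ m = m := fun m => Subtype.ext (hK m)
  -- `A` acts on the range of `ε` by compression. The hypothesis `hmul` makes this multiplicative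
  -- both when the range of `ε` is invariant and when its kernel is, so submodules and quotients are
  -- treated alike.
  let N : NUModule k A R :=
    { carrier := K
      act :=
        { toFun := fun a => p₀ ∘ₗ L.M.act a ∘ₗ K.subtype
          map_mul' := fun a b => LinearMap.ext fun m => Subtype.ext (by
            change ε (L.M.act (a * b) m) = ε (L.M.act a (ε (L.M.act b m)))
            have h := hmul a b m
            rw [hK] at h
            rw [h, act_mul_apply])
          map_zero' := by rw [map_zero, LinearMap.zero_comp, LinearMap.comp_zero]
          map_add' := fun a b => by rw [map_add, LinearMap.add_comp, LinearMap.comp_add] }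
      act_smul := fun c a => by
        change p₀ ∘ₗ L.M.act (c • a) ∘ₗ K.subtype = algebraMap k R c • _
        rw [L.M.act_smul, LinearMap.smul_comp, LinearMap.comp_smul]
        rfl
      unital := fun m => by
        obtain ⟨e, he⟩ := hL
        refine Submodule.subset_span ⟨e, m, ?_⟩
        change p₀ (L.M.act e (m : L.M)) = m
        rw [he]
        exact hp₀ m }
  let red' : K →+ X := (q.toAddMonoidHom.comp L.red).comp K.subtype.toAddMonoidHom
  have hred' : ∀ m : K, red' m = q (L.red m) := fun _ => rfl
  have hired : ∀ m : K, i (red' m) = L.red m := fun m => by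
    rw [hred', ← hred, hK]
  let x := Module.finBasis k X
  let y := Module.finBasis k (LinearMap.ker q)
  have hcompl : IsCompl (LinearMap.range i) (LinearMap.ker q) := by
    rw [isCompl_iff, disjoint_iff, codisjoint_iff]
    constructor
    · rw [eq_bot_iff]
      rintro _ ⟨⟨z, rfl⟩, hz⟩
      have hz' : q (i z) = 0 := hz
      rw [hqi] at hz'
      rw [hz', map_zero]
      exact Submodule.zero_mem _
    · rw [eq_top_iff]
      intro z _
      rw [show z = i (q z) + (z - i (q z)) by abel]
      refine Submodule.add_mem_sup ⟨q z, rfl⟩ ?_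
      rw [LinearMap.mem_ker, map_sub, hqi, sub_self]
  have hinj : Function.Injective i := fun z z' h => by
    rw [← hqi z, h, hqi]
  -- A basis adapted to `W = i(X) ⊕ ker q`. Its two parts are lifted into the range and the kernel
  -- of `ε`, and the first part becomes a basis of the range.
  let w : Module.Basis (_ ⊕ _) k W :=
    ((x.map (LinearEquiv.ofInjective i hinj)).prod y).map (Submodule.prodEquivOfIsCompl _ _ hcompl)
  have hwl : ∀ a, w (Sum.inl a) = i (x a) := fun a => by
    simp [w, Submodule.coe_prodEquivOfIsCompl']
  have hwr : ∀ a, w (Sum.inr a) = y a := fun a => by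
    simp [w, Submodule.coe_prodEquivOfIsCompl']
  choose l hl using fun a => L.red_surjective (w a)
  let m : _ ⊕ _ → L.M := Sum.elim (fun a => ε (l (Sum.inl a)))
    (fun a => l (Sum.inr a) - ε (l (Sum.inr a)))
  obtain ⟨b, hb⟩ := L.exists_basis_eq w m (by
    rintro (a | a)
    · change L.red (ε _) = _
      rw [hred, hl, hwl, hqi]
    · change L.red (l _ - ε _) = _
      rw [map_sub, hred, hl, hwr, (y a).2, map_zero, sub_zero])
  let m' : Fin _ → K := fun a => ⟨ε (l (Sum.inl a)), ⟨_, rfl⟩⟩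
  have hm' : ∀ a, (m' a : L.M) = b (Sum.inl a) := fun a => (hb (Sum.inl a)).symm
  have hli : LinearIndependent R m' := by
    apply LinearIndependent.of_comp K.subtype
    have h : K.subtype ∘ m' = b ∘ Sum.inl := funext hm'
    rw [h]
    exact b.linearIndependent.comp _ Sum.inl_injective
  have hsp : ⊤ ≤ Submodule.span R (Set.range m') := by
    intro z _
    have h1 : p₀ (z : L.M) = z := hp₀ z
    rw [← h1, ← b.sum_repr (z : L.M), map_sum]
    refine sum_mem fun a _ => ?_
    rw [map_smul]
    refine Submodule.smul_mem _ _ ?_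
    rcases a with a | a
    · have h2 : p₀ (b (Sum.inl a)) = m' a := by
        rw [← hm']; exact hp₀ _
      rw [h2]
      exact Submodule.subset_span ⟨a, rfl⟩
    · have h2 : p₀ (b (Sum.inr a)) = 0 := Subtype.ext (by
        rw [hb]
        change ε (l _ - ε (l _)) = 0
        rw [map_sub, hε, sub_self])
      rw [h2]
      exact Submodule.zero_mem _
  let bK : Module.Basis _ R K := Module.Basis.mk hli hsp
  let L' : Lift X R := ofRed N bK x red'
    (fun r z => by
      change q (L.red (r • (z : K) : K)) = _
      rw [Submodule.coe_smul, L.red_smul, map_smul]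
      rfl)
    (fun a z => by
      change q (L.red (ε (L.M.act a ((show K from z) : L.M)))) = X.act a (red' z)
      rw [hred, hqi, L.red_act, ← hired, hact])
    (fun a => by
      change red' (Module.Basis.mk hli hsp a) = x a
      rw [Module.Basis.mk_apply]
      change q (L.red (ε (l (Sum.inl a)))) = x a
      rw [hred, hqi, hl, hwl, hqi])
  have hL' : ∀ z : K, L'.red z = q (L.red z) := fun z => red_ofRed N _ _ _ _ _ _ z
  refine ⟨L', K.subtype, p₀, hp₀, fun _ => rfl, fun z => ?_, fun z => ?_, fun _ _ => rfl⟩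
  · refine (hired z).symm.trans (congrArg i ?_)
    exact (hL' z).symm
  · refine (hL' (p₀ z)).trans ?_
    change q (L.red (ε z)) = _
    rw [hred, hqi]

end Lift

end DeformationEquivalence

/-! ### Equivalences of deformation functors from Frobenius systems -/

/-- Every endomorphism is a scalar up to a homomorphism factoring through a projective module. -/
def NUModule.IsStablyScalar {k : Type u} [Field k] {A : Type w} [NonUnitalRing A] [Module k A]
    (V : NUModule k A k) : Prop :=
  ∀ f : V →ₗ[k] V, NUModule.IsHom f →
    ∃ c : k, NUModule.FactorsThroughProjective (f - c • LinearMap.id)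

namespace NUModule

variable {k : Type u} [Field k] {A : Type w} [NonUnitalRing A] [Module k A]

lemma isStablyScalar_of_stableEnd {V : NUModule k A k} (h : Nonempty (V.StableEnd ≃ₐ[k] k)) :
    V.IsStablyScalar := by
  obtain ⟨e⟩ := h
  intro f hf
  let f' : V.endAlgebra := ⟨f, hf⟩
  let x : V.StableEnd := Ideal.Quotient.mk (projectiveIdeal V) f'
  have h1 : x = algebraMap k V.StableEnd (e x) := by
    apply e.injective
    rw [AlgEquiv.commutes]
    rfl
  have h2 : algebraMap k V.StableEnd (e x) =
      Ideal.Quotient.mk (projectiveIdeal V) (algebraMap k V.endAlgebra (e x)) := rfl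
  rw [h2, Ideal.Quotient.mk_eq_mk_iff_sub_mem] at h1
  refine ⟨e x, ?_⟩
  have h3 : FactorsThroughProjective ((f' - algebraMap k V.endAlgebra (e x) : V.endAlgebra) :
    Module.End k V) := h1
  exact h3

lemma not_factors_id_of_stableEnd {V : NUModule k A k} (h : Nonempty (V.StableEnd ≃ₐ[k] k)) :
    ¬ FactorsThroughProjective (LinearMap.id : V →ₗ[k] V) := by
  obtain ⟨e⟩ := h
  intro h1
  have h2 : (1 : V.endAlgebra) ∈ projectiveIdeal V := h1
  have h3 : (Ideal.Quotient.mk (projectiveIdeal V) 1 : V.StableEnd) = 0 :=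
    Ideal.Quotient.eq_zero_iff_mem.2 h2
  rw [map_one] at h3
  have h4 := congrArg e h3
  rw [map_one, map_zero] at h4
  exact one_ne_zero h4

lemma IsHom.comp {R : Type u} [CommRing R] [Algebra k R] {M N P : NUModule k A R} {g : N →ₗ[R] P}
    {f : M →ₗ[R] N} (hg : IsHom g) (hf : IsHom f) : IsHom (g ∘ₗ f) := fun a m => by
  rw [LinearMap.comp_apply, hf, hg]; rfl

lemma IsHom.sub {R : Type u} [CommRing R] [Algebra k R] {M N : NUModule k A R} {g f : M →ₗ[R] N}
    (hg : IsHom g) (hf : IsHom f) : IsHom (g - f) := fun a m => by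
  rw [LinearMap.sub_apply, hg, hf, LinearMap.sub_apply, map_sub]

lemma IsHom.id {R : Type u} [CommRing R] [Algebra k R] (M : NUModule k A R) :
    IsHom (LinearMap.id : M →ₗ[R] M) := fun _ _ => rfl

lemma IsHom.smul {M N : NUModule k A k} {f : M →ₗ[k] N} (hf : IsHom f) (c : k) :
    IsHom (c • f) := fun a m => by
  rw [LinearMap.smul_apply, hf, LinearMap.smul_apply, map_smul]

lemma isHom_inl (M N : NUModule k A k) :
    IsHom (M := M) (N := M.prod N) (LinearMap.inl k M N) := fun a m => by
  change (M.act a m, (0 : N)) = (M.act a m, N.act a 0)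
  rw [map_zero]

lemma isHom_inr (M N : NUModule k A k) :
    IsHom (M := N) (N := M.prod N) (LinearMap.inr k M N) := fun a m => by
  change ((0 : M), N.act a m) = (M.act a 0, N.act a m)
  rw [map_zero]

lemma isHom_fst (M N : NUModule k A k) :
    IsHom (M := M.prod N) (N := M) (LinearMap.fst k M N) := fun _ _ => rfl

lemma isHom_snd (M N : NUModule k A k) :
    IsHom (M := M.prod N) (N := N) (LinearMap.snd k M N) := fun _ _ => rfl

instance (M N : NUModule k A k) [Module.Finite k M] [Module.Finite k N] :
    Module.Finite k (M.prod N) := inferInstanceAs (Module.Finite k (M × N))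

end NUModule

namespace FrobeniusSystem

open NUModule Lift

variable {k : Type u} [Field k] {A : Type w} [NonUnitalRing A] [Module k A] {ι : Type*}
  (𝔉 : FrobeniusSystem k A ι)

section Stable

variable [IsScalarTower k A A] [SMulCommClass k A A] {V W P : NUModule k A k}

/-- Higman's criterion. The identity of a projective module is a trace, and homomorphisms can be
moved out of a trace. Conversely, lift `ψ` linearly to a projective module mapping onto `W`; the
trace of this lift provides the factorization. -/
lemma factorsThroughProjective_iff (hV : V.HasUnit) [Module.Finite k W] (f : V →ₗ[k] W) :
    FactorsThroughProjective f ↔ ∃ ψ : V →ₗ[k] W, f = 𝔉.ltr ψ hV := by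
  constructor
  · rintro ⟨P, g, h, hP, hg, hh, rfl⟩
    have := hP.1
    have hPu := 𝔉.hasUnit P
    obtain ⟨φ, hφ⟩ := 𝔉.exists_ltr_eq_id hP hPu
    refine ⟨h ∘ₗ φ ∘ₗ g, ?_⟩
    rw [𝔉.ltr_comp_left hV hh, 𝔉.ltr_comp_right hV hPu hg, hφ, LinearMap.id_comp]
  · rintro ⟨ψ, rfl⟩
    obtain ⟨F, π, hF, hπ, hπs⟩ := 𝔉.exists_projective_cover_map W
    have := hF.1
    obtain ⟨s, hs⟩ := π.exists_rightInverse_of_surjective (LinearMap.range_eq_top.2 hπs)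
    refine ⟨F, 𝔉.ltr (s ∘ₗ ψ) hV, π, hF, 𝔉.ltr_isHom _ hV (𝔉.hasUnit F), hπ, ?_⟩
    rw [← 𝔉.ltr_comp_left hV hπ, ← LinearMap.comp_assoc, hs, LinearMap.id_comp]

lemma exists_eq_ltr_of_target (hV : V.HasUnit) (hP : P.IsProjective) (f : V →ₗ[k] P) (hf :
    IsHom f) :
    ∃ ψ : V →ₗ[k] P, f = 𝔉.ltr ψ hV := by
  have := hP.1
  exact (𝔉.factorsThroughProjective_iff hV f).1 ⟨P, f, LinearMap.id, hP, hf, IsHom.id P, rfl⟩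

lemma exists_eq_ltr_of_source (hu : P.HasUnit) [Module.Finite k V] (hP : P.IsProjective)
    (f : P →ₗ[k] V) (hf : IsHom f) : ∃ ψ : P →ₗ[k] V, f = 𝔉.ltr ψ hu :=
  (𝔉.factorsThroughProjective_iff hu f).1 ⟨P, LinearMap.id, f, hP, IsHom.id P, hf, rfl⟩

end Stable

section LiftTrace

variable {V W P : NUModule k A k} {R S : CompleteLocalAlgebra k}

lemma hasUnit_lift (𝔉 : FrobeniusSystem k A ι) (L : Lift V R) : L.M.HasUnit := by
  have := L.finite
  exact 𝔉.hasUnit L.M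

/-- Reduction maps are equivariant, so they can be moved through a trace on either side. -/
lemma red_tr (L : Lift V R) (L' : Lift W S) (hV : V.HasUnit) (ψ : L.M →+ L'.M) (g : V →ₗ[k] W)
    (h : ∀ m, L'.red (ψ m) = g (L.red m)) (m : L.M) :
    L'.red (𝔉.tr ψ m) = 𝔉.ltr g hV (L.red m) := by
  have hu := 𝔉.hasUnit_lift L
  have h1 : L'.red.comp ψ = g.toAddMonoidHom.comp L.red := AddMonoidHom.ext h
  have h2 := 𝔉.tr_comp_left hu L'.red_isEquivariant ψ
  rw [h1, 𝔉.tr_comp_right hu hV L.red_isEquivariant g.toAddMonoidHom] at h2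
  exact (DFunLike.congr_fun h2 m).symm

/-- A trace lifts to an equivariant semilinear map between lifts. -/
lemma exists_equivariant (θ : R →ₐ[k] S) (L : Lift V R) (L' : Lift W S) (hV : V.HasUnit)
    (ψ : V →ₗ[k] W) : ∃ f : L.M →+ L'.M, IsSemilinear θ f ∧ IsEquivariant f ∧
      ∀ m, L'.red (f m) = 𝔉.ltr ψ hV (L.red m) := by
  obtain ⟨f, hf, hr⟩ := exists_semilinear θ L L' ψ
  exact ⟨𝔉.tr f, 𝔉.tr_isSemilinear (𝔉.hasUnit_lift L) hf,
    𝔉.tr_isEquivariant (𝔉.hasUnit_lift L) (𝔉.hasUnit_lift L') hf.isKLinear,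
    𝔉.red_tr L L' hV f ψ hr⟩

lemma exists_isHom (L : Lift V R) (L' : Lift W R) (hV : V.HasUnit) (ψ : V →ₗ[k] W) :
    ∃ f : L.M →ₗ[R] L'.M, IsHom f ∧ ∀ m, L'.red (f m) = 𝔉.ltr ψ hV (L.red m) := by
  obtain ⟨f, hf, hA, hr⟩ := 𝔉.exists_equivariant (AlgHom.id k R) L L' hV ψ
  exact ⟨hf.toLinear, hA, hr⟩

variable [IsScalarTower k A A] [SMulCommClass k A A]

/-- Every linear map lifts, hence so does its trace; scalars lift as well, and an endomorphism of a
stably scalar module is a scalar plus a trace. -/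
lemma endomorphismsLift (𝔉 : FrobeniusSystem k A ι) (h : V.IsStablyScalar) [Module.Finite k V] :
    EndomorphismsLift V := by
  intro R L f hf
  obtain ⟨c, hc⟩ := h f hf
  have hV := 𝔉.hasUnit V
  obtain ⟨ψ, hψ⟩ := (𝔉.factorsThroughProjective_iff hV _).1 hc
  obtain ⟨F, hF, hr⟩ := 𝔉.exists_isHom L L hV ψ
  refine ⟨algebraMap k R c • LinearMap.id + F, fun a m => ?_, fun m => ?_⟩
  · rw [LinearMap.add_apply, LinearMap.add_apply, hF, map_add]
    simp
  · rw [LinearMap.add_apply, map_add, hr, ← hψ, LinearMap.smul_apply, LinearMap.id_apply,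
      L.red_smul, CompleteLocalAlgebra.aug_algebraMap, LinearMap.sub_apply, LinearMap.smul_apply,
      LinearMap.id_apply]
    abel

/-- A lift of a projective module has an endomorphism of trace one. -/
lemma exists_lift_ltr_eq_id (hP : P.IsProjective) (hu : P.HasUnit) (L : Lift P R) :
    ∃ (Ψ : L.M →ₗ[R] L.M) (φ : P →ₗ[k] P), 𝔉.ltr Ψ (𝔉.hasUnit_lift L) = LinearMap.id ∧
      𝔉.ltr φ hu = LinearMap.id ∧ ∀ m, L.red (Ψ m) = φ (L.red m) := by
  obtain ⟨φ, hφ⟩ := 𝔉.exists_ltr_eq_id hP hu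
  obtain ⟨Ψ, hΨ⟩ := exists_linear L L φ
  have hL := 𝔉.hasUnit_lift L
  -- The trace of a linear lift of `φ` is the identity only after reduction. Precomposing with its
  -- inverse, a homomorphism, normalizes the trace.
  obtain ⟨g, hg1, hg2, hgr, hgA⟩ := L.exists_mul_inv (𝔉.ltr Ψ hL) fun m => by
    rw [ltr_apply, 𝔉.red_tr L L hu _ φ hΨ, hφ]; rfl
  refine ⟨Ψ ∘ₗ g, φ, ?_, hφ, fun m => ?_⟩
  · rw [𝔉.ltr_comp_right hL hL (hgA (𝔉.ltr_isHom Ψ hL hL)), hg1]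
  · rw [LinearMap.comp_apply, hΨ, hgr]

end LiftTrace

section Equivalences

variable [IsScalarTower k A A] [SMulCommClass k A A] {V P K : NUModule k A k}

/-- Adding a projective summand does not change the deformation functor. -/
theorem deformationEquivalent_prod (𝔉 : FrobeniusSystem k A ι) [Module.Finite k V] (hP :
    P.IsProjective) :
    DeformationEquivalent V (V.prod P) := by
  have hPf := hP.1
  have hPu := 𝔉.hasUnit P
  have hVu := 𝔉.hasUnit V
  have hWu := 𝔉.hasUnit (V.prod P)
  obtain ⟨ψ, hψ⟩ := 𝔉.exists_eq_ltr_of_target hWu hP _ (isHom_snd V P)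
  obtain ⟨χ, hχ⟩ := 𝔉.exists_eq_ltr_of_source hPu hP _ (isHom_inr V P)
  -- Lifts correspond when the inclusion and the projection of the summand `V` lift to homomorphisms
  -- between them.
  refine ⟨fun R L L' => ∃ (J : L.M →ₗ[R] L'.M) (π : L'.M →ₗ[R] L.M), IsHom J ∧ IsHom π ∧
    (∀ m, L'.red (J m) = LinearMap.inl k V P (L.red m)) ∧
    ∀ m, L.red (π m) = LinearMap.fst k V P (L'.red m), fun R L => ?_, fun R L' => ?_, ?_⟩
  · classical
    obtain ⟨LP⟩ := Lift.nonempty P R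
    obtain ⟨b, hb⟩ := L.exists_basis (Module.finBasis k V)
    obtain ⟨b', hb'⟩ := LP.exists_basis (Module.finBasis k P)
    let N : NUModule k A R :=
      { carrier := L.M × LP.M
        act :=
          { toFun := fun a => (L.M.act a).prodMap (LP.M.act a)
            map_mul' := fun a b => by ext <;> simp
            map_zero' := by ext <;> simp
            map_add' := fun a b => by ext <;> simp }
        act_smul := fun c a => by
          change (L.M.act (c • a)).prodMap (LP.M.act (c • a)) =
            algebraMap k R c • (L.M.act a).prodMap (LP.M.act a)
          rw [act_smul, act_smul]
          rfl
        unital := (L.M.prod LP.M).unital }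
    have hbb : ∀ i, (L.red.prodMap LP.red) ((b.prod b') i) =
        ((Module.finBasis k V).prod (Module.finBasis k P)) i := by
      rintro (i | i) <;> exact Prod.ext (by simp [hb]) (by simp [hb'])
    let L' : Lift (V.prod P) R := ofRed N (b.prod b') ((Module.finBasis k V).prod
        (Module.finBasis k P)) (L.red.prodMap LP.red)
      (fun r m => Prod.ext (L.red_smul r m.1) (LP.red_smul r m.2))
      (fun a m => Prod.ext (L.red_act a m.1) (LP.red_act a m.2))
      hbb
    have hr : ∀ m : L.M × LP.M, L'.red m = (L.red m.1, LP.red m.2) := fun m =>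
      red_ofRed N _ _ _ _ _ _ m
    refine ⟨L', LinearMap.inl R L.M LP.M, LinearMap.fst R L.M LP.M, fun a m => ?_, fun a m => rfl,
      fun m => ?_, fun m => ?_⟩
    · change (L.M.act a m, (0 : LP.M)) = (L.M.act a m, LP.M.act a 0)
      rw [map_zero]
    · refine (hr _).trans ?_
      change (L.red m, LP.red 0) = (L.red m, 0)
      rw [map_zero]
    · exact (congrArg Prod.fst (hr m)).symm
  · obtain ⟨LP⟩ := Lift.nonempty P R
    obtain ⟨Q, hQ, hQr⟩ := 𝔉.exists_isHom L' LP hWu ψ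
    obtain ⟨I, hI, hIr⟩ := 𝔉.exists_isHom LP L' hPu χ
    rw [← hψ] at hQr
    rw [← hχ] at hIr
    obtain ⟨g, hg1, hg2, hgr, hgA⟩ := LP.exists_mul_inv (Q ∘ₗ I) fun m => by
      rw [LinearMap.comp_apply, hQr, hIr]; rfl
    have hg := hgA (hQ.comp hI)
    have hQI : ∀ z, Q (I (g z)) = z := fun z => DFunLike.congr_fun hg1 z
    -- The inclusion and the projection of `P` are traces, hence lift. Corrected by `g` they give an
    -- idempotent endomorphism `E`, and `1 - E` cuts out the lift of `V`.
    let E : L'.M →ₗ[R] L'.M := I ∘ₗ g ∘ₗ Q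
    have hE : IsHom E := hI.comp (hg.comp hQ)
    have hEE : ∀ m, E (E m) = E m := fun m => by
      change I (g (Q (I (g (Q m))))) = I (g (Q m))
      rw [hQI]
    have hEr : ∀ m, L'.red (E m) = LinearMap.inr k V P (LinearMap.snd k V P (L'.red m)) :=
      fun m => by
        change L'.red (I (g (Q m))) = _
        rw [hIr, hgr, hQr]
        rfl
    have hεA : IsHom (LinearMap.id - E) := (IsHom.id L'.M).sub hE
    have hεε : ∀ m, (LinearMap.id - E : L'.M →ₗ[R] L'.M) ((LinearMap.id - E : L'.M →ₗ[R] L'.M) m) =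
        (LinearMap.id - E : L'.M →ₗ[R] L'.M) m := fun m => by
      change (m - E m) - E (m - E m) = m - E m
      rw [map_sub, hEE, sub_self, sub_zero]
    obtain ⟨L, j, p, hpj, hjp, hjr, hpr, hact⟩ := L'.exists_of_idempotent (X := V)
      (𝔉.hasUnit_lift L') (LinearMap.id - E) hεε
      (fun a b m => by rw [hεA b, hεε])
      (LinearMap.inl k V P) (LinearMap.fst k V P) (fun _ => rfl)
      (fun m => by
        rw [LinearMap.sub_apply, LinearMap.id_apply, map_sub, hEr]
        exact Prod.ext (sub_zero _) (sub_self _))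
      (fun a x => rfl)
    have hp : ∀ m, p ((LinearMap.id - E : L'.M →ₗ[R] L'.M) m) = p m := fun m => by
      rw [← hjp, hpj]
    have hj : ∀ m, (LinearMap.id - E : L'.M →ₗ[R] L'.M) (j m) = j m := fun m => by
      rw [← hjp, hpj]
    refine ⟨L, j, p, fun a m => ?_, fun a m => ?_, hjr, hpr⟩
    · rw [hact, hjp, hεA, hj]
    · rw [hact, hjp, ← hεA, hp]
  · rintro R S θ L₁ L₁' L₂ L₂' ⟨J₁, π₁, hJ₁, hπ₁, hJr₁, hπr₁⟩ ⟨J₂, π₂, hJ₂, hπ₂, hJr₂, hπr₂⟩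
    constructor
    · rintro ⟨f, hf, hA, hr⟩
      have hinr : IsHom (M := V.prod P) (N := V.prod P)
          (LinearMap.inr k V P ∘ₗ LinearMap.snd k V P) :=
        IsHom.comp (N := P) (isHom_inr V P) (isHom_snd V P)
      obtain ⟨η, hη⟩ := (𝔉.factorsThroughProjective_iff (W := V.prod P) hWu
        (LinearMap.inr k V P ∘ₗ LinearMap.snd k V P)).1
          ⟨P, LinearMap.snd k V P, LinearMap.inr k V P, hP, isHom_snd V P, isHom_inr V P, rfl⟩
      obtain ⟨g, hg, hgA, hgr⟩ := 𝔉.exists_equivariant θ L₁' L₂' hWu η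
      rw [← hη] at hgr
      -- The term `J₂ f π₁` accounts only for the summand `V`; the trace `g` lifts the projection
      -- onto `P`, so that the sum reduces to the identity.
      refine ⟨(J₂.toAddMonoidHom.comp (f.comp π₁.toAddMonoidHom)) + g, fun r m => ?_,
        fun a m => ?_, fun m => ?_⟩
      · change J₂ (f (π₁ (r • m))) + g (r • m) = θ r • (J₂ (f (π₁ m)) + g m)
        rw [map_smul, hf, map_smul, hg, smul_add]
      · change J₂ (f (π₁ (L₁'.M.act a m))) + g (L₁'.M.act a m) =
          L₂'.M.act a (J₂ (f (π₁ m)) + g m)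
        rw [hπ₁, hA, hJ₂, hgA, map_add]
      · change L₂'.red (J₂ (f (π₁ m)) + g m) = _
        rw [map_add, hJr₂, hr, hπr₁, hgr]
        exact Prod.ext (add_zero _) (zero_add _)
    · rintro ⟨f, hf, hA, hr⟩
      refine ⟨π₂.toAddMonoidHom.comp (f.comp J₁.toAddMonoidHom), fun r m => ?_,
        fun a m => ?_, fun m => ?_⟩
      · change π₂ (f (J₁ (r • m))) = θ r • π₂ (f (J₁ m))
        rw [map_smul, hf, map_smul]
      · change π₂ (f (J₁ (L₁.M.act a m))) = L₂.M.act a (π₂ (f (J₁ m)))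
        rw [hJ₁, hA, hπ₂]
      · change L₂.red (π₂ (f (J₁ m))) = _
        rw [hπr₂, hr, hJr₁]; rfl

end Equivalences

end FrobeniusSystem

/-! ### Syzygies and deformation functors -/

section Exact

open NUModule Lift

variable {k : Type u} [Field k] {A : Type w} [NonUnitalRing A] [Module k A]

/-- A short exact sequence of vector spaces splits. -/
lemma LinearMap.exists_splitting {E F G : Type*} [AddCommGroup E] [Module k E] [AddCommGroup F]
    [Module k F] [AddCommGroup G] [Module k G] (i : E →ₗ[k] F) (p : F →ₗ[k] G)
    (hi : Function.Injective i) (hip : LinearMap.range i = LinearMap.ker p)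
    (hp : Function.Surjective p) :
    ∃ (r : F →ₗ[k] E) (s : G →ₗ[k] F), (∀ x, r (i x) = x) ∧ (∀ x, p (s x) = x) ∧
      ∀ x, i (r x) + s (p x) = x := by
  obtain ⟨s, hs⟩ := p.exists_rightInverse_of_surjective (LinearMap.range_eq_top.2 hp)
  have hs' : ∀ x, p (s x) = x := fun x => DFunLike.congr_fun hs x
  have hmem : ∀ x, (LinearMap.id - s ∘ₗ p : F →ₗ[k] F) x ∈ LinearMap.range i := fun x => by
    rw [hip, LinearMap.mem_ker]
    simp [hs']
  let r : F →ₗ[k] E := (LinearEquiv.ofInjective i hi).symm.toLinearMap ∘ₗ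
    (LinearMap.id - s ∘ₗ p : F →ₗ[k] F).codRestrict (LinearMap.range i) hmem
  have hr : ∀ x, i (r x) = x - s (p x) := fun x => by
    have h := LinearEquiv.apply_symm_apply (LinearEquiv.ofInjective i hi)
      ((LinearMap.id - s ∘ₗ p : F →ₗ[k] F).codRestrict (LinearMap.range i) hmem x)
    exact congrArg Subtype.val h
  refine ⟨r, s, fun x => hi ?_, hs', fun x => by rw [hr]; abel⟩
  have h : i x ∈ LinearMap.ker p := hip ▸ ⟨x, rfl⟩
  rw [hr, LinearMap.mem_ker.1 h, map_zero, sub_zero]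

variable {K P V : NUModule k A k} {i : K →ₗ[k] P} {p : P →ₗ[k] V}

/-- A linear splitting of `K → P → V` is lifted and corrected by inverses until `ρ I = 1` and `Q S =
1` hold exactly. A complex of lifts over this sequence is thus automatically split exact over `R`.
-/
lemma Lift.exists_splitting {R : CompleteLocalAlgebra k} (hi : Function.Injective i)
    (hip : LinearMap.range i = LinearMap.ker p) (hp : Function.Surjective p)
    {L : Lift V R} {LP : Lift P R} {L' : Lift K R} {I : L'.M →ₗ[R] LP.M} {Q : LP.M →ₗ[R] L.M}
    (hQI : ∀ m, Q (I m) = 0) (hI : ∀ m, LP.red (I m) = i (L'.red m))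
    (hQ : ∀ m, L.red (Q m) = p (LP.red m)) :
    ∃ (ρ : LP.M →ₗ[R] L'.M) (S : L.M →ₗ[R] LP.M), (∀ m, ρ (I m) = m) ∧ (∀ m, Q (S m) = m) ∧
      (∀ m, I (ρ m) + S (Q m) = m) ∧ ∀ m, L.red m = 0 → LP.red (S m) = 0 := by
  obtain ⟨r, s, hri, hps, hrs⟩ := LinearMap.exists_splitting i p hi hip hp
  obtain ⟨S₀, hS₀⟩ := exists_linear L LP s
  obtain ⟨ρ₀, hρ₀⟩ := exists_linear LP L' r
  obtain ⟨g, hg1, -, hgr, -⟩ := L.exists_mul_inv (Q ∘ₗ S₀) fun m => by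
    rw [LinearMap.comp_apply, hQ, hS₀, hps]
  obtain ⟨h, -, hh2, hhr, -⟩ := L'.exists_mul_inv (ρ₀ ∘ₗ I) fun m => by
    rw [LinearMap.comp_apply, hρ₀, hI, hri]
  let S := S₀ ∘ₗ g
  have hS : ∀ m, Q (S m) = m := fun m => DFunLike.congr_fun hg1 m
  let ρ := h ∘ₗ ρ₀ ∘ₗ (LinearMap.id - S ∘ₗ Q)
  have hρI : ∀ m, ρ (I m) = m := fun m => by
    change h (ρ₀ (I m - S (Q (I m)))) = m
    rw [hQI, map_zero, sub_zero]
    exact DFunLike.congr_fun hh2 m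
  have hρS : ∀ m, ρ (S m) = 0 := fun m => by
    change h (ρ₀ (S m - S (Q (S m)))) = 0
    rw [hS, sub_self, map_zero, map_zero]
  have hrsz : ∀ x, r (x - s (p x)) = r x := fun x => by
    have h1 := hrs x
    rw [← eq_sub_iff_add_eq] at h1
    rw [← h1, hri]
  refine ⟨ρ, S, hρI, hS, fun m => ?_, fun m hm => by
    change LP.red (S₀ (g m)) = 0
    rw [hS₀, hgr, hm, map_zero]⟩
  -- `T` is idempotent, and injective because it reduces to the identity; hence it is the identity.
  let T : LP.M →ₗ[R] LP.M := I ∘ₗ ρ + S ∘ₗ Q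
  have hT : ∀ m, LP.red (T m) = LP.red m := fun m => by
    change LP.red (I (h (ρ₀ (m - S₀ (g (Q m))))) + S₀ (g (Q m))) = _
    rw [map_add, hI, hhr, hρ₀, map_sub, hS₀, hgr, hQ, hrsz, hrs]
  have hinj := (bijective_of_red LP LP T hT).1
  change T m = m
  apply hinj
  change I (ρ (I (ρ m) + S (Q m))) + S (Q (I (ρ m) + S (Q m))) = I (ρ m) + S (Q m)
  rw [map_add, map_add, hρI, hρS, map_add, map_zero, add_zero, hQI, hS, zero_add]

end Exact

namespace FrobeniusSystem

open NUModule Lift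

variable {k : Type u} [Field k] {A : Type w} [NonUnitalRing A] [Module k A] {ι : Type*}
variable [IsScalarTower k A A] [SMulCommClass k A A] {K P V : NUModule k A k}

/-- The kernel of a surjection from a projective module has an equivalent deformation functor. -/
theorem deformationEquivalent_kernel (𝔉 : FrobeniusSystem k A ι) (hP : P.IsProjective)
    {i : K →ₗ[k] P} {p : P →ₗ[k] V}
    (hiA : IsHom i) (hpA : IsHom p) (hi : Function.Injective i)
    (hip : LinearMap.range i = LinearMap.ker p) (hp : Function.Surjective p) :
    DeformationEquivalent V K := by
  have hPf := hP.1
  have hVf : Module.Finite k V := Module.Finite.of_surjective p hp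
  have hKf : Module.Finite k K := Module.Finite.of_injective i hi
  have hPu := 𝔉.hasUnit P
  have hVu := 𝔉.hasUnit V
  have hKu := 𝔉.hasUnit K
  have hpi : ∀ x, p (i x) = 0 := fun x => by
    have h : i x ∈ LinearMap.ker p := hip ▸ ⟨x, rfl⟩
    exact h
  obtain ⟨ψ, hψ⟩ := 𝔉.exists_eq_ltr_of_target hKu hP i hiA
  obtain ⟨χ, hχ⟩ := 𝔉.exists_eq_ltr_of_source hPu hP p hpA
  obtain ⟨r, s, hri, hps, hrs⟩ := LinearMap.exists_splitting i p hi hip hp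
  -- Lifts correspond when they are the ends of a complex of lifts reducing to `K → P → V`.
  refine ⟨fun R L L' => ∃ (LP : Lift P R) (I : L'.M →ₗ[R] LP.M) (Q : LP.M →ₗ[R] L.M), IsHom I ∧
    IsHom Q ∧ (∀ m, Q (I m) = 0) ∧ (∀ m, LP.red (I m) = i (L'.red m)) ∧
    ∀ m, L.red (Q m) = p (LP.red m), fun R L => ?_, fun R L' => ?_, ?_⟩
  · obtain ⟨LP⟩ := Lift.nonempty P R
    obtain ⟨Q, hQ, hQr⟩ := 𝔉.exists_isHom LP L hPu χ
    rw [← hχ] at hQr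
    obtain ⟨S₀, hS₀⟩ := exists_linear L LP s
    obtain ⟨g, hg1, -, hgr, -⟩ := L.exists_mul_inv (Q ∘ₗ S₀) fun m => by
      rw [LinearMap.comp_apply, hQr, hS₀, hps]
    have hS : ∀ m, Q (S₀ (g m)) = m := fun m => DFunLike.congr_fun hg1 m
    -- A linear projection onto the kernel of the homomorphism `Q`, so that the compressed action is
    -- a restriction.
    let ε : LP.M →ₗ[R] LP.M := LinearMap.id - S₀ ∘ₗ g ∘ₗ Q
    have hε : ∀ m, ε m = m - S₀ (g (Q m)) := fun _ => rfl
    have hQε : ∀ m, Q (ε m) = 0 := fun m => by rw [hε, map_sub, hS, sub_self]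
    have hεQ : ∀ m, Q m = 0 → ε m = m := fun m h => by
      rw [hε, h, map_zero, map_zero, sub_zero]
    obtain ⟨L', j, q, hqj, hjq, hjr, hqr, hact⟩ := LP.exists_of_idempotent (X := K)
      (𝔉.hasUnit_lift LP) ε (fun m => hεQ _ (hQε m))
      (fun a b m => by
        rw [hεQ (LP.M.act b (ε m)) (by rw [hQ, hQε, map_zero])])
      i r hri
      (fun m => by
        rw [hε, map_sub, hS₀, hgr, hQr, sub_eq_iff_eq_add]
        exact (hrs _).symm)
      (fun a x => by rw [← hiA, hri])
    have hj : ∀ m, Q (j m) = 0 := fun m => by rw [← hqj m, hjq, hQε]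
    refine ⟨L', LP, j, Q, fun a m => ?_, hQ, hj, hjr, hQr⟩
    rw [hact, hjq, hεQ]
    rw [hQ, hj, map_zero]
  · obtain ⟨LP⟩ := Lift.nonempty P R
    obtain ⟨I, hI, hIr⟩ := 𝔉.exists_isHom L' LP hKu ψ
    rw [← hψ] at hIr
    obtain ⟨ρ₀, hρ₀⟩ := exists_linear LP L' r
    obtain ⟨g, -, hg2, hgr, -⟩ := L'.exists_mul_inv (ρ₀ ∘ₗ I) fun m => by
      rw [LinearMap.comp_apply, hρ₀, hIr, hri]
    have hρ : ∀ m, g (ρ₀ (I m)) = m := fun m => DFunLike.congr_fun hg2 m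
    -- A linear projection whose kernel is the image of `I`, so that its range models the cokernel.
    let ε : LP.M →ₗ[R] LP.M := LinearMap.id - I ∘ₗ g ∘ₗ ρ₀
    have hε : ∀ m, ε m = m - I (g (ρ₀ m)) := fun _ => rfl
    have hεI : ∀ m, ε (I m) = 0 := fun m => by rw [hε, hρ, sub_self]
    have hεa : ∀ a m, ε (LP.M.act a (ε m)) = ε (LP.M.act a m) := fun a m => by
      rw [hε m, map_sub, map_sub, ← hI, hεI, sub_zero]
    have hεε : ∀ m, ε (ε m) = ε m := fun m => by
      rw [hε m, map_sub, hεI, sub_zero, hε]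
    obtain ⟨L, j, q, hqj, hjq, hjr, hqr, hact⟩ := LP.exists_of_idempotent (X := V)
      (𝔉.hasUnit_lift LP) ε hεε
      (fun a b m => hεa a _) s p hps
      (fun m => by
        rw [hε, map_sub, hIr, hgr, hρ₀, sub_eq_iff_eq_add, add_comm]
        exact (hrs _).symm)
      (fun a x => by rw [hpA, hps])
    have hqε : ∀ m, q (ε m) = q m := fun m => by rw [← hjq, hqj]
    refine ⟨L, LP, I, q, hI, fun a m => ?_, fun m => ?_, hIr, hqr⟩
    · rw [hact, hjq, ← hqε (LP.M.act a (ε m)), hεa, hqε]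
    · rw [← hqε, hεI, map_zero]
  · rintro R S θ L₁ L₁' L₂ L₂' ⟨P₁, I₁, Q₁, hI₁, hQ₁, hQI₁, hIr₁, hQr₁⟩
      ⟨P₂, I₂, Q₂, hI₂, hQ₂, hQI₂, hIr₂, hQr₂⟩
    obtain ⟨ρ₁, S₁, hρI₁, hQS₁, h1₁, -⟩ := Lift.exists_splitting hi hip hp hQI₁ hIr₁ hQr₁
    obtain ⟨ρ₂, S₂, hρI₂, hQS₂, h1₂, hS₂⟩ := Lift.exists_splitting hi hip hp hQI₂ hIr₂ hQr₂
    obtain ⟨g₀, hg₀, hgr₀⟩ := exists_semilinear θ P₁ P₂ LinearMap.id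
    simp only [LinearMap.id_apply] at hgr₀
    have hu₁ := 𝔉.hasUnit_lift P₁
    have hu₂ := 𝔉.hasUnit_lift P₂
    constructor
    · rintro ⟨f, hf, hA, hr⟩
      obtain ⟨Ψ, φ, hΨ, hφ, hΨr⟩ := 𝔉.exists_lift_ltr_eq_id hP hPu P₁
      -- A semilinear map covering `f`: the discrepancy `Q₂ g₀ - f Q₁` is lifted by `S₂` and
      -- subtracted. Its reduction vanishes, so that of `g` is unchanged.
      let g : P₁.M →+ P₂.M := g₀ - S₂.toAddMonoidHom.comp
        (Q₂.toAddMonoidHom.comp g₀ - f.comp Q₁.toAddMonoidHom)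
      have hg : ∀ m, g m = g₀ m - S₂ (Q₂ (g₀ m) - f (Q₁ m)) := fun _ => rfl
      have hgs : IsSemilinear θ g := fun c m => by
        rw [hg, hg, hg₀, map_smul, map_smul, hf, ← smul_sub, map_smul, smul_sub]
      have hQg : ∀ m, Q₂ (g m) = f (Q₁ m) := fun m => by
        rw [hg, map_sub, hQS₂]; abel
      have hgr : ∀ m, P₂.red (g m) = P₁.red m := fun m => by
        rw [hg, map_sub, hS₂, sub_zero, hgr₀]
        rw [map_sub, hQr₂, hr, hQr₁, hgr₀, sub_self]
      have hgΨ : IsSemilinear θ (g.comp Ψ.toAddMonoidHom) := fun c m => by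
        change g (Ψ (c • m)) = θ c • g (Ψ m)
        rw [map_smul, hgs]
      -- Averaging with `Ψ` makes the map equivariant and keeps `Q₂ F = f Q₁`, because equivariant
      -- maps leave the trace and `Ψ` has trace one. Then `F` restricts to the kernels.
      let F := 𝔉.tr (g.comp Ψ.toAddMonoidHom)
      have hFs : IsSemilinear θ F := 𝔉.tr_isSemilinear hu₁ hgΨ
      have hFA : IsEquivariant F := 𝔉.tr_isEquivariant hu₁ hu₂ hgΨ.isKLinear
      have hFr : ∀ m, P₂.red (F m) = P₁.red m := fun m => by
        rw [𝔉.red_tr P₁ P₂ hPu _ φ (fun m => ?_), hφ]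
        · rfl
        · change P₂.red (g (Ψ m)) = _
          rw [hgr, hΨr]
      have hQF : ∀ m, Q₂ (F m) = f (Q₁ m) := by
        have h1 : Q₂.toAddMonoidHom.comp (g.comp Ψ.toAddMonoidHom) =
            (f.comp Q₁.toAddMonoidHom).comp Ψ.toAddMonoidHom :=
          AddMonoidHom.ext fun m => hQg _
        have h2 := 𝔉.tr_comp_left hu₁ (g := Q₂.toAddMonoidHom) hQ₂ (g.comp Ψ.toAddMonoidHom)
        rw [h1, 𝔉.tr_comp_left hu₁ (g := f.comp Q₁.toAddMonoidHom)
          (IsEquivariant.comp hA hQ₁) Ψ.toAddMonoidHom] at h2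
        intro m
        have h3 := DFunLike.congr_fun h2 m
        have h4 : 𝔉.tr Ψ.toAddMonoidHom m = m := DFunLike.congr_fun hΨ m
        change f (Q₁ (𝔉.tr Ψ.toAddMonoidHom m)) = Q₂ (F m) at h3
        rw [h4] at h3
        exact h3.symm
      have hI₂inj : Function.Injective I₂ := fun x y h => by rw [← hρI₂ x, h, hρI₂]
      have hIρ : ∀ m, I₂ (ρ₂ (F (I₁ m))) = F (I₁ m) := fun m => by
        have h1 := h1₂ (F (I₁ m))
        rwa [hQF, hQI₁, map_zero, map_zero, add_zero] at h1
      refine ⟨ρ₂.toAddMonoidHom.comp (F.comp I₁.toAddMonoidHom), fun c m => ?_, fun a m => ?_,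
        fun m => ?_⟩
      · change ρ₂ (F (I₁ (c • m))) = θ c • ρ₂ (F (I₁ m))
        rw [map_smul, hFs, map_smul]
      · change ρ₂ (F (I₁ (L₁'.M.act a m))) = L₂'.M.act a (ρ₂ (F (I₁ m)))
        apply hI₂inj
        rw [hI₂, hIρ, hIρ, hI₁, hFA]
      · change L₂'.red (ρ₂ (F (I₁ m))) = L₁'.red m
        apply hi
        rw [← hIr₂, hIρ, hFr, hIr₁]
    · rintro ⟨f, hf, hA, hr⟩
      obtain ⟨Ψ, φ, hΨ, hφ, hΨr⟩ := 𝔉.exists_lift_ltr_eq_id hP hPu P₂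
      -- Dually, `g₀` is corrected along the retraction `ρ₁` so that it extends `f`.
      let g : P₁.M →+ P₂.M := g₀ - (g₀.comp I₁.toAddMonoidHom - I₂.toAddMonoidHom.comp f).comp
        ρ₁.toAddMonoidHom
      have hg : ∀ m, g m = g₀ m - (g₀ (I₁ (ρ₁ m)) - I₂ (f (ρ₁ m))) := fun _ => rfl
      have hgs : IsSemilinear θ g := fun c m => by
        rw [hg, hg, hg₀, map_smul, map_smul, hf, hg₀, map_smul]
        simp only [smul_sub]
      have hgI : ∀ m, g (I₁ m) = I₂ (f m) := fun m => by
        rw [hg, hρI₁, sub_sub_cancel]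
      have hgr : ∀ m, P₂.red (g m) = P₁.red m := fun m => by
        rw [hg, map_sub, map_sub, hgr₀, hgr₀, hIr₁, hIr₂, hr, sub_self, sub_zero]
      have hΨg : IsSemilinear θ (Ψ.toAddMonoidHom.comp g) := fun c m => by
        change Ψ (g (c • m)) = θ c • Ψ (g m)
        rw [hgs, map_smul]
      let F := 𝔉.tr (Ψ.toAddMonoidHom.comp g)
      have hFs : IsSemilinear θ F := 𝔉.tr_isSemilinear hu₁ hΨg
      have hFA : IsEquivariant F := 𝔉.tr_isEquivariant hu₁ hu₂ hΨg.isKLinear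
      have hFr : ∀ m, P₂.red (F m) = P₁.red m := fun m => by
        rw [𝔉.red_tr P₁ P₂ hPu _ φ (fun m => ?_), hφ]
        · rfl
        · change P₂.red (Ψ (g m)) = _
          rw [hΨr, hgr]
      have hFI : ∀ m, F (I₁ m) = I₂ (f m) := by
        have h1 : (Ψ.toAddMonoidHom.comp g).comp I₁.toAddMonoidHom =
            Ψ.toAddMonoidHom.comp (I₂.toAddMonoidHom.comp f) :=
          AddMonoidHom.ext fun m => congrArg Ψ (hgI m)
        have h2 := 𝔉.tr_comp_right (𝔉.hasUnit_lift L₁') hu₁ (g := I₁.toAddMonoidHom) hI₁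
          (Ψ.toAddMonoidHom.comp g)
        rw [h1, 𝔉.tr_comp_right (𝔉.hasUnit_lift L₁') hu₂ (g := I₂.toAddMonoidHom.comp f)
          (IsEquivariant.comp hI₂ hA) Ψ.toAddMonoidHom] at h2
        intro m
        have h3 := DFunLike.congr_fun h2 m
        have h4 : 𝔉.tr Ψ.toAddMonoidHom (I₂ (f m)) = I₂ (f m) := DFunLike.congr_fun hΨ _
        change 𝔉.tr Ψ.toAddMonoidHom (I₂ (f m)) = F (I₁ m) at h3
        rw [h4] at h3
        exact h3.symm
      -- `Q₂ F` vanishes on the image of `I₁`. The map induced on the quotient therefore does not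
      -- depend on the linear section `S₁`, and this makes it equivariant.
      have hQFS : ∀ m, Q₂ (F (S₁ (Q₁ m))) = Q₂ (F m) := fun m => by
        conv_rhs => rw [← h1₁ m]
        rw [map_add, map_add, hFI, hQI₂, zero_add]
      refine ⟨Q₂.toAddMonoidHom.comp (F.comp S₁.toAddMonoidHom), fun c m => ?_, fun a m => ?_,
        fun m => ?_⟩
      · change Q₂ (F (S₁ (c • m))) = θ c • Q₂ (F (S₁ m))
        rw [map_smul, hFs, map_smul]
      · change Q₂ (F (S₁ (L₁.M.act a m))) = L₂.M.act a (Q₂ (F (S₁ m)))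
        rw [← hQS₁ m, ← hQ₁, hQFS, hFA, hQ₂, hQS₁]
      · change L₂.red (Q₂ (F (S₁ m))) = L₁.red m
        rw [hQr₂, hFr, ← hQr₁, hQS₁]

end FrobeniusSystem

/-! ### The category of modules -/

namespace NUModule

section Category

variable {k : Type u} [Field k] {A : Type w} [NonUnitalRing A] [Module k A]
variable {K M N P X Y Z Q V W : NUModule k A k}

lemma IsHom.exists_factor_mono {i : K →ₗ[k] M} {f : X →ₗ[k] M} (hi : IsHom i)
    (hinj : Function.Injective i) (hf : IsHom f) (h : ∀ x, f x ∈ LinearMap.range i) :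
    ∃ f' : X →ₗ[k] K, IsHom f' ∧ i ∘ₗ f' = f := by
  let f' : X →ₗ[k] K := (LinearEquiv.ofInjective i hinj).symm.toLinearMap ∘ₗ
    f.codRestrict (LinearMap.range i) h
  have hf' : ∀ x, i (f' x) = f x := fun x => congrArg Subtype.val
    (LinearEquiv.apply_symm_apply (LinearEquiv.ofInjective i hinj)
      (f.codRestrict (LinearMap.range i) h x))
  refine ⟨f', fun a x => hinj ?_, LinearMap.ext hf'⟩
  rw [hf', hf, hi, hf']

lemma IsHom.exists_factor_epi {q : M →ₗ[k] Q} {f : M →ₗ[k] X} (hq : IsHom q)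
    (hs : Function.Surjective q) (hf : IsHom f) (h : ∀ m, q m = 0 → f m = 0) :
    ∃ f' : Q →ₗ[k] X, IsHom f' ∧ f' ∘ₗ q = f := by
  obtain ⟨s, hs'⟩ := q.exists_rightInverse_of_surjective (LinearMap.range_eq_top.2 hs)
  have h1 : ∀ m, f (s (q m)) = f m := fun m => by
    rw [← sub_eq_zero, ← map_sub]
    refine h _ ?_
    rw [map_sub, sub_eq_zero]
    exact DFunLike.congr_fun hs' (q m)
  refine ⟨f ∘ₗ s, fun a x => ?_, LinearMap.ext h1⟩
  obtain ⟨m, rfl⟩ := hs x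
  rw [← hq, LinearMap.comp_apply, h1, LinearMap.comp_apply, h1, hf]

lemma exists_sub (hM : M.HasUnit) (S : Submodule k M) (h : ∀ (a : A), ∀ x ∈ S, M.act a x ∈ S) :
    ∃ (K : NUModule k A k) (i : K →ₗ[k] M), IsHom i ∧ Function.Injective i ∧
      LinearMap.range i = S := by
  obtain ⟨e, he⟩ := hM
  let K : NUModule k A k :=
    { carrier := S
      act :=
        { toFun := fun a => (M.act a).restrict (h a)
          map_mul' := fun a b => LinearMap.ext fun x => Subtype.ext (M.act_mul_apply a b x)
          map_zero' := LinearMap.ext fun x => Subtype.ext (by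
            change M.act 0 x = 0
            rw [map_zero]; rfl)
          map_add' := fun a b => LinearMap.ext fun x => Subtype.ext (by
            change M.act (a + b) x = M.act a x + M.act b x
            rw [map_add]; rfl) }
      act_smul := fun c a => LinearMap.ext fun x => Subtype.ext (by
        change M.act (c • a) x = algebraMap k k c • M.act a x
        rw [M.act_smul]; rfl)
      unital := fun m => Submodule.subset_span ⟨e, m, Subtype.ext (by
        change M.act e m = m
        rw [he]; rfl)⟩ }
  exact ⟨K, S.subtype, fun _ _ => rfl, S.injective_subtype, S.range_subtype⟩

lemma exists_quot (S : Submodule k M) (h : ∀ (a : A), ∀ x ∈ S, M.act a x ∈ S) :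
    ∃ (Q : NUModule k A k) (q : M →ₗ[k] Q), IsHom q ∧ Function.Surjective q ∧
      LinearMap.ker q = S := by
  let Q : NUModule k A k :=
    { carrier := M ⧸ S
      act :=
        { toFun := fun a => S.mapQ S (M.act a) (h a)
          map_mul' := fun a b => Submodule.linearMap_qext _ <| LinearMap.ext fun x =>
            congrArg S.mkQ (M.act_mul_apply a b x)
          map_zero' := Submodule.linearMap_qext _ <| LinearMap.ext fun x => by
            change S.mkQ (M.act 0 x) = 0
            rw [map_zero]; rfl
          map_add' := fun a b => Submodule.linearMap_qext _ <| LinearMap.ext fun x => by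
            change S.mkQ (M.act (a + b) x) = S.mkQ (M.act a x) + S.mkQ (M.act b x)
            rw [map_add]; rfl }
      act_smul := fun c a => Submodule.linearMap_qext _ <| LinearMap.ext fun x => by
        change S.mkQ (M.act (c • a) x) = algebraMap k k c • S.mkQ (M.act a x)
        rw [M.act_smul]; rfl
      unital := fun m => by
        obtain ⟨m, rfl⟩ := S.mkQ_surjective m
        have h1 := Submodule.mem_map_of_mem (f := S.mkQ) (M.unital m)
        rw [Submodule.map_span] at h1
        refine Submodule.span_mono ?_ h1
        rintro _ ⟨_, ⟨a, y, rfl⟩, rfl⟩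
        exact ⟨a, S.mkQ y, rfl⟩ }
  exact ⟨Q, S.mkQ, fun _ _ => rfl, S.mkQ_surjective, S.ker_mkQ⟩

lemma IsHom.exists_kernel (hM : M.HasUnit) {f : M →ₗ[k] N} (hf : IsHom f) :
    ∃ (K : NUModule k A k) (i : K →ₗ[k] M), IsHom i ∧ Function.Injective i ∧
      LinearMap.range i = LinearMap.ker f :=
  exists_sub hM _ fun a x hx => by
    rw [LinearMap.mem_ker] at hx ⊢
    rw [hf, hx, map_zero]

lemma IsHom.exists_image (hN : N.HasUnit) {f : M →ₗ[k] N} (hf : IsHom f) :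
    ∃ (K : NUModule k A k) (i : K →ₗ[k] N), IsHom i ∧ Function.Injective i ∧
      LinearMap.range i = LinearMap.range f :=
  exists_sub hN _ fun a x hx => by
    obtain ⟨y, rfl⟩ := hx
    exact ⟨M.act a y, hf a y⟩

lemma IsHom.symm {e : M ≃ₗ[k] N} (he : IsHom e.toLinearMap) : IsHom e.symm.toLinearMap :=
  fun a n => e.injective (by
    have h := he a (e.symm n)
    change e (M.act a (e.symm n)) = N.act a (e (e.symm n)) at h
    rw [LinearEquiv.apply_symm_apply] at h
    change e (e.symm (N.act a n)) = e (M.act a (e.symm n))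
    rw [h, LinearEquiv.apply_symm_apply])

lemma IsHom.exists_inverse {f : M →ₗ[k] N} (hf : IsHom f) (hb : Function.Bijective f) :
    ∃ g : N →ₗ[k] M, IsHom g ∧ g ∘ₗ f = LinearMap.id ∧ f ∘ₗ g = LinearMap.id := by
  let e := LinearEquiv.ofBijective f hb
  have he : IsHom e.toLinearMap := hf
  exact ⟨e.symm.toLinearMap, he.symm, LinearMap.ext e.symm_apply_apply,
    LinearMap.ext e.apply_symm_apply⟩

lemma IsHom.pow {f : Module.End k M} (hf : IsHom (M := M) (N := M) f) (n : ℕ) :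
    IsHom (M := M) (N := M) (f ^ n) := by
  induction n with
  | zero => exact IsHom.id M
  | succ n ih => rw [pow_succ]; exact ih.comp hf

lemma IsProjective.of_retract (hP : P.IsProjective) {i : X →ₗ[k] P} {q : P →ₗ[k] X}
    (hi : IsHom i) (hq : IsHom q) (h : q ∘ₗ i = LinearMap.id) : X.IsProjective := by
  have := hP.1
  refine ⟨Module.Finite.of_surjective q fun x => ⟨i x, DFunLike.congr_fun h x⟩,
    fun M N hM hN g f hg hgs hf => ?_⟩
  obtain ⟨l, hl, hl'⟩ := hP.2 M N hM hN g (f ∘ₗ q) hg hgs (hf.comp hq)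
  refine ⟨l ∘ₗ i, hl.comp hi, ?_⟩
  rw [← LinearMap.comp_assoc, hl', LinearMap.comp_assoc, h, LinearMap.comp_id]

lemma isProjective_of_factors_id
    (h : FactorsThroughProjective (LinearMap.id : X →ₗ[k] X)) : X.IsProjective := by
  obtain ⟨P, g, f, hP, hg, hf, e⟩ := h
  exact hP.of_retract hg hf e.symm

lemma FactorsThroughProjective.comp_left {f : M →ₗ[k] N} (h : FactorsThroughProjective f)
    {g : N →ₗ[k] X} (hg : IsHom g) : FactorsThroughProjective (g ∘ₗ f) := by
  obtain ⟨P, a, b, hP, ha, hb, rfl⟩ := h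
  exact ⟨P, a, g ∘ₗ b, hP, ha, hg.comp hb, rfl⟩

lemma FactorsThroughProjective.comp_right {f : M →ₗ[k] N} (h : FactorsThroughProjective f)
    {g : X →ₗ[k] M} (hg : IsHom g) : FactorsThroughProjective (f ∘ₗ g) := by
  obtain ⟨P, a, b, hP, ha, hb, rfl⟩ := h
  exact ⟨P, a ∘ₗ g, b, hP, ha.comp hg, hb, rfl⟩

lemma FactorsThroughProjective.smul {f : M →ₗ[k] N} (h : FactorsThroughProjective f) (c : k) :
    FactorsThroughProjective (c • f) := by
  have h1 := h.comp_left ((IsHom.id N).smul c)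
  rwa [LinearMap.smul_comp, LinearMap.id_comp] at h1

lemma FactorsThroughProjective.exists_lift [Module.Finite k N] [Module.Finite k P]
    {f : M →ₗ[k] N} (hf : FactorsThroughProjective f) {q : P →ₗ[k] N} (hq : IsHom q)
    (hs : Function.Surjective q) : ∃ g : M →ₗ[k] P, IsHom g ∧ q ∘ₗ g = f := by
  obtain ⟨Q, a, b, hQ, ha, hb, rfl⟩ := hf
  obtain ⟨c, hc, hc'⟩ := hQ.2 P N inferInstance inferInstance q b hq hs hb
  exact ⟨c ∘ₗ a, hc.comp ha, by rw [← LinearMap.comp_assoc, hc']⟩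

/-- A direct sum decomposition into submodules. -/
lemma exists_decomposition (hM : M.HasUnit) {S T : Submodule k M}
    (hS : ∀ (a : A), ∀ x ∈ S, M.act a x ∈ S) (hT : ∀ (a : A), ∀ x ∈ T, M.act a x ∈ T)
    (h : IsCompl S T) : ∃ (X Y : NUModule k A k) (i : X →ₗ[k] M) (j : Y →ₗ[k] M)
      (e : X.prod Y ≃ₗ[k] M), IsHom i ∧ IsHom j ∧ Function.Injective i ∧ Function.Injective j ∧
        LinearMap.range i = S ∧ LinearMap.range j = T ∧ IsHom e.toLinearMap ∧
        ∀ x y, e ((x, y) : X × Y) = i x + j y := by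
  obtain ⟨X, i, hi, hii, hiS⟩ := exists_sub hM S hS
  obtain ⟨Y, j, hj, hji, hjT⟩ := exists_sub hM T hT
  let f : X × Y →ₗ[k] M := i.coprod j
  have hf : ∀ x y, f (x, y) = i x + j y := fun x y => LinearMap.coprod_apply ..
  have hb : Function.Bijective f := by
    constructor
    · rw [← LinearMap.ker_eq_bot, LinearMap.ker_coprod_of_disjoint_range _ _
        (by rw [hiS, hjT]; exact h.disjoint), LinearMap.ker_eq_bot.2 hii,
        LinearMap.ker_eq_bot.2 hji, Submodule.prod_bot]
    · rw [← LinearMap.range_eq_top, LinearMap.range_coprod, hiS, hjT]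
      exact h.codisjoint.eq_top
  refine ⟨X, Y, i, j, LinearEquiv.ofBijective f hb, hi, hj, hii, hji, hiS, hjT, ?_, hf⟩
  rintro a ⟨x, y⟩
  change f (X.act a x, Y.act a y) = M.act a (f (x, y))
  rw [hf, hf, hi, hj, map_add]

/-- A retract has a complement. -/
lemma exists_complement (hM : M.HasUnit) {i : X →ₗ[k] M} {q : M →ₗ[k] X} (hi : IsHom i)
    (hq : IsHom q) (h : q ∘ₗ i = LinearMap.id) :
    ∃ (Z : NUModule k A k) (j : Z →ₗ[k] M) (r : M →ₗ[k] Z) (e : X.prod Z ≃ₗ[k] M),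
      IsHom j ∧ IsHom r ∧ r ∘ₗ i = 0 ∧ r ∘ₗ j = LinearMap.id ∧ IsHom e.toLinearMap := by
  have h' : ∀ x, q (i x) = x := fun x => DFunLike.congr_fun h x
  obtain ⟨Z, j, hj, hji, hjq⟩ := hq.exists_kernel hM
  have hqj : ∀ z, q (j z) = 0 := fun z => by
    have h1 : j z ∈ LinearMap.ker q := hjq ▸ ⟨z, rfl⟩
    exact h1
  obtain ⟨r, hr, hr'⟩ := hj.exists_factor_mono (f := LinearMap.id - i ∘ₗ q) hji
    ((IsHom.id M).sub (hi.comp hq)) fun x => by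
      rw [hjq, LinearMap.mem_ker, LinearMap.sub_apply, map_sub]
      change q x - q (i (q x)) = 0
      rw [h', sub_self]
  have hjr : ∀ m, j (r m) = m - i (q m) := fun m => DFunLike.congr_fun hr' m
  have hri : ∀ x, r (i x) = 0 := fun x => hji (by rw [hjr, h', sub_self, map_zero])
  have hrj : ∀ z, r (j z) = z := fun z => hji (by rw [hjr, hqj, map_zero, sub_zero])
  let e : X.prod Z ≃ₗ[k] M := LinearEquiv.ofLinearMap (i.coprod j) (q.prod r)
    (LinearMap.ext fun m => by
      change i (q m) + j (r m) = m
      rw [hjr]; abel)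
    (LinearMap.ext fun z => by
      change (q (i z.1 + j z.2), r (i z.1 + j z.2)) = z
      rw [map_add, map_add, h', hqj, hri, hrj, add_zero, zero_add]
      rfl)
  refine ⟨Z, j, r, e, hj, hr, LinearMap.ext hri, LinearMap.ext hrj, ?_⟩
  rintro a ⟨x, z⟩
  change i (X.act a x) + j (Z.act a z) = M.act a (i x + j z)
  rw [hi, hj, map_add]

/-- Fitting's lemma for a high power of `f`. The exponent is nonzero so that the kernel and the
image of the power compare with those of `f`. -/
lemma exists_fitting (hM : M.HasUnit) [Module.Finite k M] {f : Module.End k M}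
    (hf : IsHom (M := M) (N := M) f) : ∃ (n : ℕ) (X Y : NUModule k A k) (i : X →ₗ[k] M)
      (j : Y →ₗ[k] M) (e : X.prod Y ≃ₗ[k] M), n ≠ 0 ∧ IsHom i ∧ IsHom j ∧
        LinearMap.range i = LinearMap.ker (f ^ n) ∧ LinearMap.range j = LinearMap.range (f ^ n) ∧
        Function.Injective j ∧ IsHom e.toLinearMap ∧ ∀ x y, e ((x, y) : X × Y) = i x + j y := by
  obtain ⟨n, hn, hc⟩ := ((Filter.eventually_ge_atTop 1).and
    f.eventually_isCompl_ker_pow_range_pow).exists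
  have hfn := hf.pow n
  obtain ⟨X, Y, i, j, e, hi, hj, -, hji, hiS, hjT, he, he'⟩ := exists_decomposition hM
    (S := LinearMap.ker (f ^ n)) (T := LinearMap.range (f ^ n))
    (fun a x hx => by
      rw [LinearMap.mem_ker] at hx ⊢
      rw [hfn, hx, map_zero])
    (fun a x hx => by
      obtain ⟨y, rfl⟩ := hx
      exact ⟨M.act a y, hfn a y⟩) hc
  exact ⟨n, X, Y, i, j, e, by omega, hi, hj, hiS, hjT, hji, he, he'⟩

lemma IsIndecomposable.nilpotent_or_bijective (hV : V.IsIndecomposable) (hu : V.HasUnit)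
    [Module.Finite k V] {f : Module.End k V} (hf : IsHom (M := V) (N := V) f) :
    IsNilpotent f ∨ Function.Bijective f := by
  obtain ⟨n, X, Y, i, j, e, hn, hi, hj, hiS, hjT, -, he, he'⟩ := exists_fitting hu hf
  rcases hV.2 X Y e.symm he.symm with h | h
  · right
    have h1 : LinearMap.ker (f ^ n) = ⊥ := by
      rw [← hiS, LinearMap.range_eq_bot]
      exact LinearMap.ext fun x => by rw [Subsingleton.elim x 0, map_zero, map_zero]
    have h2 : Function.Injective f := by
      rw [← LinearMap.ker_eq_bot, eq_bot_iff, ← h1]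
      intro x hx
      obtain ⟨m, rfl⟩ := Nat.exists_eq_succ_of_ne_zero hn
      rw [LinearMap.mem_ker] at hx ⊢
      rw [pow_succ, Module.End.mul_apply, hx, map_zero]
    exact ⟨h2, LinearMap.injective_iff_surjective.1 h2⟩
  · left
    refine ⟨n, LinearMap.range_eq_bot.1 ?_⟩
    rw [← hjT, LinearMap.range_eq_bot]
    exact LinearMap.ext fun x => by rw [Subsingleton.elim x 0, map_zero, map_zero]

/-- A projective module twisted by an automorphism is projective. -/
lemma IsProjective.of_twist (hP : P.IsProjective) (μ : A ≃ₗ[k] A)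
    (hμ : ∀ a b, μ (a * b) = μ a * μ b) (t : P ≃ₗ[k] Q)
    (ht : ∀ a v, t (P.act (μ a) v) = Q.act a (t v)) : Q.IsProjective := by
  have := hP.1
  have hμ' : ∀ a b, μ.symm (a * b) = μ.symm a * μ.symm b := fun a b =>
    μ.injective (by rw [hμ]; simp only [LinearEquiv.apply_symm_apply])
  have ht' : ∀ a v, t (P.act a v) = Q.act (μ.symm a) (t v) := fun a v => by
    rw [← ht, LinearEquiv.apply_symm_apply]
  refine ⟨Module.Finite.equiv t, fun X Y hX hY g f hg hgs hf => ?_⟩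
  obtain ⟨h, hh, e⟩ := hP.2 (X.twist μ.symm hμ') (Y.twist μ.symm hμ') hX hY g
    (f ∘ₗ t.toLinearMap) (fun a x => hg (μ.symm a) x) hgs (fun a x => by
      change f (t (P.act a x)) = Y.act (μ.symm a) (f (t x))
      rw [ht', hf])
  have e' : ∀ x, g (h x) = f (t x) := fun x => DFunLike.congr_fun e x
  have hh' : ∀ a x, h (P.act a x) = X.act (μ.symm a) (h x) := hh
  refine ⟨(show P →ₗ[k] X from h) ∘ₗ t.symm.toLinearMap, fun a x => ?_, LinearMap.ext fun x => ?_⟩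
  · change h (t.symm (Q.act a x)) = X.act a (h (t.symm x))
    have h1 : t.symm (Q.act a x) = P.act (μ a) (t.symm x) := by
      rw [LinearEquiv.symm_apply_eq, ht, LinearEquiv.apply_symm_apply]
    rw [h1]
    refine (hh' _ _).trans ?_
    rw [LinearEquiv.symm_apply_apply]
  · change g (h (t.symm x)) = f x
    refine (e' _).trans ?_
    rw [LinearEquiv.apply_symm_apply]

lemma IsStablyScalar.of_twist (hV : V.IsStablyScalar) (μ : A ≃ₗ[k] A)
    (hμ : ∀ a b, μ (a * b) = μ a * μ b) (t : V ≃ₗ[k] W)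
    (ht : ∀ a v, t (V.act (μ a) v) = W.act a (t v)) : W.IsStablyScalar := by
  intro f hf
  obtain ⟨c, P, g, h, hP, hg, hh, e⟩ := hV (t.symm.toLinearMap ∘ₗ f ∘ₗ t.toLinearMap) fun a v => by
    obtain ⟨a, rfl⟩ := μ.surjective a
    change t.symm (f (t (V.act (μ a) v))) = V.act (μ a) (t.symm (f (t v)))
    rw [LinearEquiv.symm_apply_eq, ht, ht, hf, LinearEquiv.apply_symm_apply]
  have e' : ∀ v, t.symm (f (t v)) - c • v = h (g v) := fun v => DFunLike.congr_fun e v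
  have ht' : ∀ a w, t.symm (W.act a w) = V.act (μ a) (t.symm w) := fun a w => by
    rw [LinearEquiv.symm_apply_eq, ht, LinearEquiv.apply_symm_apply]
  refine ⟨c, P.twist μ hμ, (show V →ₗ[k] P.twist μ hμ from g) ∘ₗ t.symm.toLinearMap,
    t.toLinearMap ∘ₗ (show P.twist μ hμ →ₗ[k] V from h),
    hP.of_twist μ hμ (LinearEquiv.refl k P) fun _ _ => rfl, fun a w => ?_, fun a p => ?_,
    LinearMap.ext fun w => ?_⟩
  · change g (t.symm (W.act a w)) = P.act (μ a) (g (t.symm w))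
    rw [ht', hg]
  · change t (h (P.act (μ a) p)) = W.act a (t (h p))
    exact (congrArg t (hh (μ a) p)).trans (ht a (h p))
  · change f w - c • w = t (h (g (t.symm w)))
    rw [← e', map_sub, map_smul, LinearEquiv.apply_symm_apply, LinearEquiv.apply_symm_apply]

end Category

end NUModule

/-! ### Stable endomorphisms and syzygies -/

namespace FrobeniusSystem

open NUModule

variable {k : Type u} [Field k] {A : Type w} [NonUnitalRing A] [Module k A] {ι : Type*}
  (𝔉 : FrobeniusSystem k A ι)
variable {K M N P V W : NUModule k A k}

lemma ltr_smul (hM : M.HasUnit) (c : k) (φ : M →ₗ[k] N) :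
    𝔉.ltr (c • φ) hM = c • 𝔉.ltr φ hM := by
  have h := 𝔉.ltr_comp_right hM hM ((IsHom.id M).smul c) φ
  simpa only [LinearMap.comp_smul, LinearMap.comp_id] using h

variable [IsScalarTower k A A] [SMulCommClass k A A]

lemma factorsThroughProjective_add (𝔉 : FrobeniusSystem k A ι) [Module.Finite k M]
    [Module.Finite k N] {f g : M →ₗ[k] N} (hf : FactorsThroughProjective f)
    (hg : FactorsThroughProjective g) : FactorsThroughProjective (f + g) := by
  have hM := 𝔉.hasUnit M
  rw [𝔉.factorsThroughProjective_iff hM] at *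
  obtain ⟨φ, rfl⟩ := hf
  obtain ⟨ψ, rfl⟩ := hg
  exact ⟨φ + ψ, (𝔉.ltr_add hM φ ψ).symm⟩

/-- An injective homomorphism out of a projective module splits. -/
lemma isSplitMono_of_isProjective (𝔉 : FrobeniusSystem k A ι) (hP : P.IsProjective)
    [Module.Finite k M] {f : P →ₗ[k] M} (hf : IsHom f) (hi : Function.Injective f) :
    IsSplitMono f := by
  have := hP.1
  have hPu := 𝔉.hasUnit P
  have hMu := 𝔉.hasUnit M
  obtain ⟨φ, hφ⟩ := 𝔉.exists_ltr_eq_id hP hPu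
  obtain ⟨r, hr⟩ := f.exists_leftInverse_of_injective (LinearMap.ker_eq_bot.2 hi)
  refine ⟨𝔉.ltr (φ ∘ₗ r) hMu, 𝔉.ltr_isHom _ hMu hPu, ?_⟩
  rw [← 𝔉.ltr_comp_right hPu hMu hf, LinearMap.comp_assoc, hr, LinearMap.comp_id, hφ]

/-- An endomorphism `f` of `K` extends to `F` on `P` and induces `g` on `V`. When `g - c` factors
through a projective it lifts to `G : V → P`, and `F - c - G p` takes values in `K`. This gives a
map `P → K` whose restriction to `K` is `f - c`. -/
lemma isStablyScalar_kernel (𝔉 : FrobeniusSystem k A ι) (hV : V.IsStablyScalar)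
    (hP : P.IsProjective) {i : K →ₗ[k] P} {p : P →ₗ[k] V} (hiA : IsHom i) (hpA : IsHom p)
    (hi : Function.Injective i) (hip : LinearMap.range i = LinearMap.ker p)
    (hp : Function.Surjective p) : K.IsStablyScalar := by
  have := hP.1
  have : Module.Finite k V := Module.Finite.of_surjective p hp
  have : Module.Finite k K := Module.Finite.of_injective i hi
  have hPu := 𝔉.hasUnit P
  have hKu := 𝔉.hasUnit K
  have hpi : p ∘ₗ i = 0 := LinearMap.ext fun x => by
    have h : i x ∈ LinearMap.ker p := hip ▸ ⟨x, rfl⟩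
    exact h
  intro f hf
  obtain ⟨ψ, hψ⟩ := 𝔉.exists_eq_ltr_of_target hKu hP i hiA
  obtain ⟨r, hr⟩ := i.exists_leftInverse_of_injective (LinearMap.ker_eq_bot.2 hi)
  -- As `i` is the trace of `ψ`, averaging `ψ f r` yields a homomorphism with `F i = i f`.
  let F : P →ₗ[k] P := 𝔉.ltr (ψ ∘ₗ f ∘ₗ r) hPu
  have hF : IsHom F := 𝔉.ltr_isHom _ hPu hPu
  have hFi : F ∘ₗ i = i ∘ₗ f := by
    have h : (ψ ∘ₗ f ∘ₗ r) ∘ₗ i = ψ ∘ₗ f := by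
      rw [LinearMap.comp_assoc, LinearMap.comp_assoc, hr, LinearMap.comp_id]
    rw [← 𝔉.ltr_comp_right hKu hPu hiA, h, 𝔉.ltr_comp_right hKu hKu hf, ← hψ]
  obtain ⟨g, hg, hgp⟩ := hpA.exists_factor_epi (f := p ∘ₗ F) hp (hpA.comp hF) fun m hm => by
    have h : m ∈ LinearMap.range i := hip ▸ hm
    obtain ⟨x, rfl⟩ := h
    have h1 := DFunLike.congr_fun hFi x
    change F (i x) = i (f x) at h1
    rw [LinearMap.comp_apply, h1]
    exact DFunLike.congr_fun hpi (f x)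
  obtain ⟨c, hc⟩ := hV g hg
  obtain ⟨G, hG, hpG⟩ := hc.exists_lift hpA hp
  obtain ⟨H, hH, hiH⟩ := hiA.exists_factor_mono (f := F - c • LinearMap.id - G ∘ₗ p) hi
    ((hF.sub ((IsHom.id P).smul c)).sub (hG.comp hpA)) fun m => by
      rw [hip, LinearMap.mem_ker]
      have h1 := DFunLike.congr_fun hgp m
      have h2 := DFunLike.congr_fun hpG (p m)
      change g (p m) = p (F m) at h1
      change p (G (p m)) = g (p m) - c • p m at h2
      change p (F m - c • m - G (p m)) = 0
      rw [map_sub, map_sub, h2, h1, map_smul, sub_self]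
  refine ⟨c, P, i, H, hP, hiA, hH, LinearMap.ext fun x => hi ?_⟩
  have h1 := DFunLike.congr_fun hiH (i x)
  have h2 := DFunLike.congr_fun hFi x
  have h3 := DFunLike.congr_fun hpi x
  change i (H (i x)) = F (i x) - c • i x - G (p (i x)) at h1
  change F (i x) = i (f x) at h2
  change p (i x) = 0 at h3
  change i (f x - c • x) = i (H (i x))
  rw [h1, h2, h3, map_zero, sub_zero, map_sub, map_smul]

/-- Every finite dimensional module has a syzygy. -/
theorem exists_isSyzygy (𝔉 : FrobeniusSystem k A ι) (V : NUModule k A k) [Module.Finite k V] :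
    ∃ K : NUModule k A k, K.IsSyzygy V := by
  classical
  -- A surjection from a projective module of least dimension turns out to be a projective cover.
  have hex : ∃ d, ∃ (P : NUModule k A k) (p : P →ₗ[k] V), P.IsProjective ∧ IsHom p ∧
      Function.Surjective p ∧ Module.finrank k P = d := by
    obtain ⟨P, p, hP, hp, hs⟩ := 𝔉.exists_projective_cover_map V
    exact ⟨_, P, p, hP, hp, hs, rfl⟩
  obtain ⟨P, p, hP, hp, hs, hd⟩ := Nat.find_spec hex
  have hmin : ∀ (Q : NUModule k A k) (q : Q →ₗ[k] V), Q.IsProjective → IsHom q →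
      Function.Surjective q → Module.finrank k P ≤ Module.finrank k Q := fun Q q h1 h2 h3 => by
    rw [hd]
    exact Nat.find_min' hex ⟨Q, q, h1, h2, h3, rfl⟩
  have := hP.1
  have hPu := 𝔉.hasUnit P
  obtain ⟨K, i, hi, hii, hip⟩ := hp.exists_kernel hPu
  refine ⟨K, P, p, i, ⟨hP, hp, hs, fun S hS hSp => ?_⟩, hi, hii, hip⟩
  obtain ⟨X, a, ha, hai, haS⟩ := exists_sub hPu S hS
  have : Module.Finite k X := Module.Finite.of_injective a hai
  have hpa : Function.Surjective (p ∘ₗ a) := fun v => by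
    obtain ⟨m, rfl⟩ := hs v
    have h1 : m ∈ S ⊔ LinearMap.ker p := hSp ▸ Submodule.mem_top
    obtain ⟨y, hy, z, hz, rfl⟩ := Submodule.mem_sup.1 h1
    rw [← haS] at hy
    obtain ⟨x, rfl⟩ := hy
    refine ⟨x, ?_⟩
    rw [map_add, LinearMap.mem_ker.1 hz, add_zero]
    rfl
  -- Lifting `p` through the supplement `S` gives `f` with `p f = p` and image in `S`. By Fitting's
  -- lemma the image of a power of `f` is a summand of `P`, still mapping onto `V`; minimality makes
  -- it all of `P`.
  obtain ⟨b, hb, hb'⟩ := hP.2 X V inferInstance inferInstance (p ∘ₗ a) p (hp.comp ha) hpa hp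
  let f : Module.End k P := a ∘ₗ b
  have hf : IsHom (M := P) (N := P) f := ha.comp hb
  have hpf : ∀ n m, p ((f ^ n) m) = p m := fun n => by
    induction n with
    | zero => exact fun _ => rfl
    | succ n ih => intro m; rw [pow_succ, Module.End.mul_apply, ih]; exact DFunLike.congr_fun hb' m
  obtain ⟨n, Y, Z, y, z, e, hn, hy, hz, -, hzr, hzi, he, he'⟩ := exists_fitting hPu hf
  have hZ : Z.IsProjective := hP.of_retract (i := z)
    (q := LinearMap.snd k Y Z ∘ₗ e.symm.toLinearMap) hz
    (IsHom.comp (isHom_snd Y Z) he.symm) (LinearMap.ext fun x => by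
      have h1 : e ((0, x) : Y × Z) = z x := by rw [he', map_zero, zero_add]
      have h2 : e.symm (z x) = ((0, x) : Y × Z) := by
        rw [← h1]; exact e.symm_apply_apply _
      change (e.symm (z x) : Y × Z).2 = x
      rw [h2])
  have hpz : Function.Surjective (p ∘ₗ z) := fun v => by
    obtain ⟨m, rfl⟩ := hs v
    have h1 : (f ^ n) m ∈ LinearMap.range z := hzr ▸ ⟨m, rfl⟩
    obtain ⟨x, hx⟩ := h1
    exact ⟨x, by rw [LinearMap.comp_apply, hx, hpf]⟩
  have h1 := hmin Z (p ∘ₗ z) hZ (hp.comp hz) hpz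
  rw [← LinearMap.finrank_range_of_inj hzi] at h1
  have h2 : LinearMap.range z = ⊤ :=
    Submodule.eq_top_of_finrank_eq (le_antisymm (Submodule.finrank_le _) h1)
  rw [eq_top_iff, ← h2, hzr, ← haS]
  rintro _ ⟨m, rfl⟩
  obtain ⟨n, rfl⟩ := Nat.exists_eq_succ_of_ne_zero hn
  rw [pow_succ', Module.End.mul_apply]
  exact ⟨b ((f ^ n) m), rfl⟩

end FrobeniusSystem

/-! ### Trace forms on spaces of linear maps -/

section TraceForm

variable {k : Type*} [Field k] {X W : Type*} [AddCommGroup X] [Module k X] [Module.Finite k X]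
  [AddCommGroup W] [Module k W]

lemma LinearMap.eq_zero_of_trace_comp_eq_zero (g : W →ₗ[k] X)
    (h : ∀ φ : X →ₗ[k] W, LinearMap.trace k X (g ∘ₗ φ) = 0) : g = 0 := by
  refine LinearMap.ext fun w => (Module.forall_dual_apply_eq_zero_iff k _).1 fun ξ => ?_
  -- Rank one maps are enough: the trace of `g` composed with `x ↦ ξ(x) w` is `ξ (g w)`.
  have h1 : g ∘ₗ ξ.smulRight w = dualTensorHom k X X (ξ ⊗ₜ g w) := LinearMap.ext fun x => by
    rw [LinearMap.comp_apply, LinearMap.smulRight_apply, map_smul, dualTensorHom_apply]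
  rw [← h (ξ.smulRight w), h1, LinearMap.trace_eq_contract_apply, contractLeft_apply]

/-- The map sending `g` to the functional `φ ↦ trace (g φ)` is injective, and its source and target
have equal finite dimension. -/
lemma LinearMap.exists_trace_comp_eq [Module.Finite k W] (l : (X →ₗ[k] W) →ₗ[k] k) :
    ∃ g : W →ₗ[k] X, ∀ φ, l φ = LinearMap.trace k X (g ∘ₗ φ) := by
  let Φ : (W →ₗ[k] X) →ₗ[k] Module.Dual k (X →ₗ[k] W) :=
    { toFun := fun g => LinearMap.trace k X ∘ₗ LinearMap.compRight k g
      map_add' := fun g g' => LinearMap.ext fun φ => by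
        change LinearMap.trace k X ((g + g') ∘ₗ φ) =
          LinearMap.trace k X (g ∘ₗ φ) + LinearMap.trace k X (g' ∘ₗ φ)
        rw [LinearMap.add_comp, map_add]
      map_smul' := fun c g => LinearMap.ext fun φ => by
        change LinearMap.trace k X ((c • g) ∘ₗ φ) = c • LinearMap.trace k X (g ∘ₗ φ)
        rw [LinearMap.smul_comp, map_smul] }
  have hΦ : ∀ g φ, Φ g φ = LinearMap.trace k X (g ∘ₗ φ) := fun _ _ => rfl
  have hi : Function.Injective Φ := by
    rw [← LinearMap.ker_eq_bot, LinearMap.ker_eq_bot']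
    intro g hg
    exact g.eq_zero_of_trace_comp_eq_zero fun φ => by rw [← hΦ, hg]; rfl
  have hd : Module.finrank k (W →ₗ[k] X) = Module.finrank k (Module.Dual k (X →ₗ[k] W)) := by
    rw [Subspace.dual_finrank_eq, Module.finrank_linearMap, Module.finrank_linearMap, mul_comm]
  obtain ⟨g, hg⟩ := (LinearMap.injective_iff_surjective_of_finrank_eq_finrank hd).1 hi l
  exact ⟨g, fun φ => by rw [← hg, hΦ]⟩

end TraceForm

/-! ### Almost split sequences -/

namespace NUModule

section AlmostSplit

variable {k : Type u} [Field k] {A : Type w} [NonUnitalRing A] [Module k A]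
variable {E E' T T' V X : NUModule k A k}

/-- A right almost split map with source of smallest dimension is right minimal. -/
lemma exists_minimal_right_almost_split (hE : ∀ E : NUModule k A k, Module.Finite k E → E.HasUnit)
    (h : ∃ (E : NUModule k A k) (g : E →ₗ[k] V), Module.Finite k E ∧ IsRightAlmostSplit g) :
    ∃ (E : NUModule k A k) (g : E →ₗ[k] V), Module.Finite k E ∧ IsRightAlmostSplit g ∧
      ∀ w : E →ₗ[k] E, IsHom w → g ∘ₗ w = g → Function.Bijective w := by
  classical
  have hex : ∃ d, ∃ (E : NUModule k A k) (g : E →ₗ[k] V), Module.Finite k E ∧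
      IsRightAlmostSplit g ∧ Module.finrank k E = d := by
    obtain ⟨E, g, h1, h2⟩ := h
    exact ⟨_, E, g, h1, h2, rfl⟩
  obtain ⟨E, g, hEf, ⟨hg, hgs, hl⟩, hd⟩ := Nat.find_spec hex
  refine ⟨E, g, hEf, ⟨hg, hgs, hl⟩, fun w hw hgw => ?_⟩
  -- The restriction of `g` to the image of `w` is again right almost split, so minimality of the
  -- dimension makes `w` surjective.
  obtain ⟨Y, j, hj, hji, hjr⟩ := hw.exists_image (hE E hEf)
  have : Module.Finite k Y := Module.Finite.of_injective j hji
  obtain ⟨w', hw', hjw⟩ := hj.exists_factor_mono hji hw fun x => hjr ▸ ⟨x, rfl⟩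
  have h1 : IsRightAlmostSplit (g ∘ₗ j) := by
    refine ⟨hg.comp hj, ?_, fun X x hX hx hxs => ?_⟩
    · rintro ⟨s, hs, hs'⟩
      exact hgs ⟨j ∘ₗ s, hj.comp hs, by rw [← LinearMap.comp_assoc, hs']⟩
    · obtain ⟨y, hy, rfl⟩ := hl X x hX hx hxs
      refine ⟨w' ∘ₗ y, hw'.comp hy, ?_⟩
      rw [LinearMap.comp_assoc, ← LinearMap.comp_assoc y w' j, hjw, ← LinearMap.comp_assoc, hgw]
  have h2 : Module.finrank k E ≤ Module.finrank k Y := by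
    rw [hd]
    exact Nat.find_min' hex ⟨Y, g ∘ₗ j, this, h1, rfl⟩
  rw [← LinearMap.finrank_range_of_inj hji, hjr] at h2
  have h3 : Function.Surjective w := LinearMap.range_eq_top.1
    (Submodule.eq_top_of_finrank_eq (le_antisymm (Submodule.finrank_le _) h2))
  exact ⟨LinearMap.injective_iff_surjective.2 h3, h3⟩

section Sequence

variable [Module.Finite k E] {f : T →ₗ[k] E} {g : E →ₗ[k] V}

/-- The kernel of a right minimal right almost split map is left almost split. -/
lemma isLeftAlmostSplit_of_minimal (hf : IsHom f) (hfi : Function.Injective f)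
    (hfg : LinearMap.range f = LinearMap.ker g) (hgs : Function.Surjective g)
    (hg : IsRightAlmostSplit g)
    (hmin : ∀ w : E →ₗ[k] E, IsHom w → g ∘ₗ w = g → Function.Bijective w) :
    IsLeftAlmostSplit f := by
  have hgf : ∀ t, g (f t) = 0 := fun t => by
    have h : f t ∈ LinearMap.ker g := hfg ▸ ⟨t, rfl⟩
    exact h
  have hmem : ∀ m, g m = 0 → ∃ t, f t = m := fun m hm => by
    have h : m ∈ LinearMap.range f := hfg ▸ hm
    exact h
  have : Module.Finite k T := Module.Finite.of_injective f hfi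
  obtain ⟨hgA, hgsp, hgl⟩ := hg
  refine ⟨hf, ?_, fun X y hX hy hys => ?_⟩
  · rintro ⟨r, hr, hrf⟩
    have hrf' : ∀ t, r (f t) = t := fun t => DFunLike.congr_fun hrf t
    obtain ⟨s, hs, hsg⟩ := hgA.exists_factor_epi (f := LinearMap.id - f ∘ₗ r) hgs
      ((IsHom.id E).sub (hf.comp hr)) fun m hm => by
        obtain ⟨t, rfl⟩ := hmem m hm
        change f t - f (r (f t)) = 0
        rw [hrf', sub_self]
    refine hgsp ⟨s, hs, LinearMap.ext fun v => ?_⟩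
    obtain ⟨m, rfl⟩ := hgs v
    have h1 := DFunLike.congr_fun hsg m
    change s (g m) = m - f (r m) at h1
    change g (s (g m)) = g m
    rw [h1, map_sub, hgf, sub_zero]
  -- `Q` is the pushout of `y` and `f`: it contains `X` through `a`, with quotient map `p` onto `V`.
  · let d : T →ₗ[k] X.prod E := LinearMap.prod y (-f)
    have hd : ∀ t, d t = ((y t, -f t) : X × E) := fun _ => rfl
    obtain ⟨Q, q, hq, hqs, hqk⟩ := exists_quot (M := X.prod E) (LinearMap.range d)
      fun a x hx => by
        obtain ⟨t, rfl⟩ := hx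
        refine ⟨T.act a t, ?_⟩
        change (y (T.act a t), -f (T.act a t)) = (X.act a (y t), E.act a (-f t))
        rw [hy, hf, map_neg]
    have : Module.Finite k Q := Module.Finite.of_surjective q hqs
    let a : X →ₗ[k] Q := q ∘ₗ LinearMap.inl k X E
    let b : E →ₗ[k] Q := q ∘ₗ LinearMap.inr k X E
    have ha : IsHom a := hq.comp (isHom_inl X E)
    have hb : IsHom b := hq.comp (isHom_inr X E)
    have hqab : ∀ x m, q ((x, m) : X × E) = a x + b m := fun x m => by
      change _ = q ((x, 0) : X × E) + q ((0, m) : X × E)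
      have h : ((x, m) : X × E) = (x, 0) + (0, m) := by simp
      exact (congrArg q h).trans (map_add q _ _)
    have hker : ∀ x m, a x + b m = 0 → ∃ t, y t = x ∧ -f t = m := fun x m h => by
      rw [← hqab] at h
      have h1 : ((x, m) : X × E) ∈ LinearMap.range d := hqk ▸ h
      obtain ⟨t, ht⟩ := h1
      exact ⟨t, congrArg Prod.fst ht, congrArg Prod.snd ht⟩
    have hab : ∀ t, a (y t) = b (f t) := fun t => by
      have h1 : d t ∈ LinearMap.ker q := hqk ▸ ⟨t, rfl⟩
      have h2 : q ((y t, -f t) : X × E) = 0 := h1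
      rwa [hqab, map_neg, ← sub_eq_add_neg, sub_eq_zero] at h2
    obtain ⟨p, hp, hpq⟩ := hq.exists_factor_epi (f := g ∘ₗ LinearMap.snd k X E) hqs
      (IsHom.comp hgA (isHom_snd X E)) fun m hm => by
        have h1 : m ∈ LinearMap.range d := hqk ▸ hm
        obtain ⟨t, rfl⟩ := h1
        change g (-f t) = 0
        rw [map_neg, hgf, neg_zero]
    have hpa : ∀ x, p (a x) = 0 := fun x => by
      have h1 := DFunLike.congr_fun hpq ((x, 0) : X × E)
      exact h1.trans (map_zero g)
    have hpb : ∀ m, p (b m) = g m := fun m => DFunLike.congr_fun hpq ((0, m) : X × E)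
    have hai : Function.Injective a := by
      rw [← LinearMap.ker_eq_bot, LinearMap.ker_eq_bot']
      intro x hx
      obtain ⟨t, rfl, ht⟩ := hker x 0 (by rw [hx, map_zero, add_zero])
      rw [hfi (a₁ := t) (a₂ := 0) (by rw [map_zero, ← neg_eq_zero, ht]), map_zero]
    have hpk : ∀ m, p m = 0 → m ∈ LinearMap.range a := fun m hm => by
      obtain ⟨⟨x, m⟩, rfl⟩ := hqs m
      rw [hqab, map_add, hpa, zero_add, hpb] at hm
      obtain ⟨t, rfl⟩ := hmem m hm
      exact ⟨x + y t, by rw [hqab, map_add, hab]⟩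
    by_cases hsp : IsSplitEpi p
    -- If `p` splits then so does `a`, and its retraction composed with `b` extends `y` along `f`.
    · obtain ⟨s, hs, hps⟩ := hsp
      have hps' : ∀ v, p (s v) = v := fun v => DFunLike.congr_fun hps v
      obtain ⟨r, hr, har⟩ := ha.exists_factor_mono (f := LinearMap.id - s ∘ₗ p) hai
        ((IsHom.id Q).sub (hs.comp hp)) fun m => hpk _ (by
          change p (m - s (p m)) = 0
          rw [map_sub, hps', sub_self])
      refine ⟨r ∘ₗ b, hr.comp hb, LinearMap.ext fun t => hai ?_⟩
      have h1 := DFunLike.congr_fun har (b (f t))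
      change a (r (b (f t))) = b (f t) - s (p (b (f t))) at h1
      change a (r (b (f t))) = a (y t)
      rw [h1, hpb, hgf, map_zero, sub_zero, hab]
    -- Otherwise `p` factors through `g`, and minimality makes `z b` an automorphism of `E`. On the
    -- kernel it restricts to `y' y`, so `y` would be a split monomorphism.
    · obtain ⟨z, hz, hgz⟩ := hgl Q p inferInstance hp hsp
      have hgz' : ∀ m, g (z m) = p m := fun m => DFunLike.congr_fun hgz m
      have hw := hmin (z ∘ₗ b) (hz.comp hb) (LinearMap.ext fun m => by
        rw [LinearMap.comp_apply, LinearMap.comp_apply, hgz', hpb])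
      obtain ⟨y', hy', hfy⟩ := hf.exists_factor_mono (f := z ∘ₗ a) hfi (hz.comp ha) fun x =>
        hmem _ (by rw [LinearMap.comp_apply, hgz', hpa])
      have hfy' : ∀ x, f (y' x) = z (a x) := fun x => DFunLike.congr_fun hfy x
      have hi : Function.Injective (y' ∘ₗ y) := fun t t' h => by
        apply hfi
        apply hw.1
        change z (b (f t)) = z (b (f t'))
        rw [← hab, ← hab, ← hfy', ← hfy']
        exact congrArg f h
      obtain ⟨c, hc, hc', -⟩ := IsHom.exists_inverse (hy'.comp hy)
        ⟨hi, LinearMap.injective_iff_surjective.1 hi⟩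
      exact (hys ⟨c ∘ₗ y', hc.comp hy', by rw [LinearMap.comp_assoc, hc']⟩).elim

end Sequence

/-- A homomorphism over `V` restricts to the kernels. -/
lemma exists_restrict_kernel {f : T →ₗ[k] E} {g : E →ₗ[k] V} {f' : T' →ₗ[k] E'}
    {g' : E' →ₗ[k] V} (hf : IsHom f) (hfi : Function.Injective f)
    (hfg : LinearMap.range f = LinearMap.ker g) (hf' : IsHom f')
    (hfg' : LinearMap.range f' = LinearMap.ker g') {u : E' →ₗ[k] E} (hu : IsHom u)
    (hgu : g ∘ₗ u = g') : ∃ t : T' →ₗ[k] T, IsHom t ∧ f ∘ₗ t = u ∘ₗ f' :=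
  hf.exists_factor_mono hfi (hu.comp hf') fun x => by
    have h : f' x ∈ LinearMap.ker g' := hfg' ▸ ⟨x, rfl⟩
    rw [hfg, LinearMap.mem_ker, LinearMap.comp_apply]
    exact (DFunLike.congr_fun hgu (f' x)).trans h

/-- The kernel of a right almost split map contains the kernel of a minimal one as a retract. -/
lemma exists_retract_kernel [Module.Finite k E] [Module.Finite k E'] {f : T →ₗ[k] E}
    {g : E →ₗ[k] V} {f' : T' →ₗ[k] E'}
    {g' : E' →ₗ[k] V} (hf : IsHom f) (hfi : Function.Injective f)
    (hfg : LinearMap.range f = LinearMap.ker g) (hg : IsRightAlmostSplit g)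
    (hmin : ∀ w : E →ₗ[k] E, IsHom w → g ∘ₗ w = g → Function.Bijective w)
    (hf' : IsHom f') (hfi' : Function.Injective f')
    (hfg' : LinearMap.range f' = LinearMap.ker g') (hg' : IsRightAlmostSplit g') :
    ∃ (u : E' →ₗ[k] E) (t : T' →ₗ[k] T) (s : T →ₗ[k] T'), IsHom u ∧ IsHom t ∧ IsHom s ∧
      g ∘ₗ u = g' ∧ f ∘ₗ t = u ∘ₗ f' ∧ t ∘ₗ s = LinearMap.id := by
  have : Module.Finite k T := Module.Finite.of_injective f hfi
  obtain ⟨u, hu, hgu⟩ := hg.2.2 E' g' inferInstance hg'.1 hg'.2.1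
  obtain ⟨v, hv, hgv⟩ := hg'.2.2 E g inferInstance hg.1 hg.2.1
  obtain ⟨t, ht, hft⟩ := exists_restrict_kernel hf hfi hfg hf' hfg' hu hgu
  obtain ⟨s, hs, hfs⟩ := exists_restrict_kernel hf' hfi' hfg' hf hfg hv hgv
  -- `u v` is an endomorphism of `E` over `V`, hence bijective; so the map `t s` which it induces on
  -- the kernel is injective, and then bijective.
  have hw := hmin (u ∘ₗ v) (hu.comp hv) (by rw [← LinearMap.comp_assoc, hgu, hgv])
  have hfts : ∀ x, f (t (s x)) = u (v (f x)) := fun x => by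
    have h1 := DFunLike.congr_fun hft (s x)
    have h2 := DFunLike.congr_fun hfs x
    exact h1.trans (congrArg u h2)
  have hi : Function.Injective (t ∘ₗ s) := fun x y h => by
    apply hfi
    apply hw.1
    change u (v (f x)) = u (v (f y))
    rw [← hfts, ← hfts]
    exact congrArg f h
  obtain ⟨c, hc, -, hc'⟩ := IsHom.exists_inverse (ht.comp hs)
    ⟨hi, LinearMap.injective_iff_surjective.1 hi⟩
  exact ⟨u, t, s ∘ₗ c, hu, ht, hs.comp hc, hgu, hft, by rw [← LinearMap.comp_assoc, hc']⟩

/-- Almost split sequences are unique. -/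
lemma IsARTranslate.exists_equiv [Module.Finite k E] {f : T →ₗ[k] E} {g : E →ₗ[k] V}
    (hf : IsHom f) (hfi : Function.Injective f)
    (hfg : LinearMap.range f = LinearMap.ker g) (hg : IsRightAlmostSplit g)
    (hmin : ∀ w : E →ₗ[k] E, IsHom w → g ∘ₗ w = g → Function.Bijective w)
    (hT' : T'.IsARTranslate V) : ∃ t : T' ≃ₗ[k] T, IsHom t.toLinearMap := by
  obtain ⟨E', f', g', -, hE', -, hfi', hfg', hgs', hf', hg'⟩ := hT'
  have : Module.Finite k T := Module.Finite.of_injective f hfi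
  obtain ⟨u, t, s, hu, ht, hs, hgu, hft, hts⟩ :=
    exists_retract_kernel hf hfi hfg hg hmin hf'.1 hfi' hfg' hg'
  have hgf : g ∘ₗ f = 0 := LinearMap.ext fun x => by
    have h : f x ∈ LinearMap.ker g := hfg ▸ ⟨x, rfl⟩
    exact h
  -- Otherwise `t` would extend along `f'` to some `m`; then `u - f m` kills the kernel of `g'` and
  -- descends to a section of `g`.
  have h1 : IsSplitMono t := by
    by_contra hns
    obtain ⟨m, hm, hmf⟩ := hf'.2.2 T t this ht hns
    obtain ⟨l, hl, hlg⟩ := hg'.1.exists_factor_epi (f := u - f ∘ₗ m) hgs' (hu.sub (hf.comp hm))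
      fun x hx => by
        have h : x ∈ LinearMap.range f' := hfg' ▸ hx
        obtain ⟨y, rfl⟩ := h
        have h2 := DFunLike.congr_fun hft y
        have h3 := DFunLike.congr_fun hmf y
        change f (t y) = u (f' y) at h2
        change m (f' y) = t y at h3
        change u (f' y) - f (m (f' y)) = 0
        rw [h3, h2, sub_self]
    refine hg.2.1 ⟨l, hl, LinearMap.ext fun v => ?_⟩
    obtain ⟨x, rfl⟩ := hgs' v
    have h2 := DFunLike.congr_fun hlg x
    have h3 := DFunLike.congr_fun hgf (m x)
    have h4 := DFunLike.congr_fun hgu x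
    change l (g' x) = u x - f (m x) at h2
    change g (f (m x)) = 0 at h3
    change g (u x) = g' x at h4
    change g (l (g' x)) = g' x
    rw [h2, map_sub, h3, h4, sub_zero]
  obtain ⟨r, hr, hrt⟩ := h1
  have hb : Function.Bijective t :=
    ⟨fun x y h => by
      have h2 := DFunLike.congr_fun hrt x
      have h3 := DFunLike.congr_fun hrt y
      change r (t x) = x at h2
      change r (t y) = y at h3
      rw [← h2, h, h3], fun x => ⟨s x, DFunLike.congr_fun hts x⟩⟩
  exact ⟨LinearEquiv.ofBijective t hb, ht⟩

end AlmostSplit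

end NUModule

/-! ### Auslander-Reiten translates of stably scalar modules -/

namespace FrobeniusSystem

open NUModule

variable {k : Type u} [Field k] {A : Type w} [NonUnitalRing A] [Module k A] {ι : Type*}
  (𝔉 : FrobeniusSystem k A ι)
variable {V W X : NUModule k A k}

/-- The two traces attached to a Frobenius system are adjoint for the trace form. -/
lemma trace_ltr_comp [Module.Finite k V] [Module.Finite k X] [Module.Finite k W] (ν : V ≃ₗ[k] W)
    (hν : ∀ a v, ν (V.act (𝔉.mu a) v) = W.act a (ν v)) (hX : X.HasUnit) (hV : V.HasUnit)
    (π : X →ₗ[k] W) (ζ : V →ₗ[k] X) :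
    LinearMap.trace k V (ν.symm.toLinearMap ∘ₗ 𝔉.ltr π hX ∘ₗ ζ) =
      LinearMap.trace k V (ν.symm.toLinearMap ∘ₗ π ∘ₗ 𝔉.ltr ζ hV) := by
  have hν' : ∀ a w, ν.symm (W.act a w) = V.act (𝔉.mu a) (ν.symm w) := fun a w => by
    rw [LinearEquiv.symm_apply_eq, hν, LinearEquiv.apply_symm_apply]
  obtain ⟨F, hF, hF', -⟩ := 𝔉.exists_common_finset hV hX
  have h1 : ν.symm.toLinearMap ∘ₗ 𝔉.ltr π hX ∘ₗ ζ = ∑ s ∈ F, V.act (𝔉.mu (𝔉.y s)) ∘ₗ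
      (ν.symm.toLinearMap ∘ₗ π ∘ₗ X.act (𝔉.x s) ∘ₗ ζ) := LinearMap.ext fun v => by
    change ν.symm (𝔉.ltr π hX (ζ v)) = _
    rw [𝔉.ltr_apply, 𝔉.tr_apply _ F hF', map_sum, LinearMap.sum_apply]
    exact Finset.sum_congr rfl fun s _ => hν' _ _
  -- This trace is written in the form of `tr_eq_sum_mu`; the terms then match by the cyclicity of
  -- the trace.
  have h2 : ν.symm.toLinearMap ∘ₗ π ∘ₗ 𝔉.ltr ζ hV = ∑ s ∈ F,
      (ν.symm.toLinearMap ∘ₗ π ∘ₗ X.act (𝔉.x s) ∘ₗ ζ) ∘ₗ V.act (𝔉.mu (𝔉.y s)) :=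
    LinearMap.ext fun v => by
      change ν.symm (π (𝔉.ltr ζ hV v)) = _
      rw [𝔉.ltr_apply, 𝔉.tr_eq_sum_mu F hF hF' (isSemilinear_linear ζ).isKLinear, map_sum,
        map_sum, LinearMap.sum_apply]
      rfl
  rw [h1, h2, map_sum, map_sum]
  exact Finset.sum_congr rfl fun s _ => LinearMap.trace_comp_comm' _ _

/-- A non-isomorphism `f` is nilpotent by Fitting's lemma, and `f - c` factors through a projective
for some `c`. If `c` were nonzero, `f - c` would be invertible and the identity would factor through
a projective. So `c = 0`, and the form kills `f`. -/
lemma trace_comp_eq_zero (𝔉 : FrobeniusSystem k A ι) [Module.Finite k V]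
    (hi : V.IsIndecomposable) (hs : V.IsStablyScalar)
    (hV : ¬ FactorsThroughProjective (LinearMap.id : V →ₗ[k] V)) {φ : V →ₗ[k] V}
    (hφ : ∀ f, FactorsThroughProjective f → LinearMap.trace k V (φ ∘ₗ f) = 0)
    {f : V →ₗ[k] V} (hf : IsHom f) (hb : ¬ Function.Bijective f) :
    LinearMap.trace k V (φ ∘ₗ f) = 0 := by
  have hu := 𝔉.hasUnit V
  obtain ⟨c, hc⟩ := hs f hf
  have hn : IsNilpotent (f : Module.End k V) :=
    (hi.nilpotent_or_bijective hu hf).resolve_right hb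
  have hfc : IsHom (f - c • LinearMap.id) := hf.sub ((IsHom.id V).smul c)
  have hc0 : c = 0 := by
    rcases hi.nilpotent_or_bijective hu hfc with h | h
    · have h1 : IsNilpotent ((f : Module.End k V) - (f - c • LinearMap.id)) := by
        refine Commute.isNilpotent_sub ?_ hn h
        have h2 : Commute (f : Module.End k V) (c • LinearMap.id) :=
          (Commute.one_right (f : Module.End k V)).smul_right c
        exact (Commute.refl (f : Module.End k V)).sub_right h2
      rw [sub_sub_cancel] at h1
      obtain ⟨n, hn⟩ := h1
      have : Nontrivial V := hi.1
      obtain ⟨v, hv⟩ := exists_ne (0 : V)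
      have h3 : c ^ n • v = 0 := by
        have h4 : ((c • (1 : Module.End k V)) ^ n) v = 0 := by
          have h5 : (c • (1 : Module.End k V)) ^ n = 0 := hn
          rw [h5]; rfl
        rwa [smul_pow, one_pow] at h4
      exact eq_zero_of_pow_eq_zero ((smul_eq_zero.1 h3).resolve_right hv)
    · obtain ⟨g, hg, hgf, -⟩ := hfc.exists_inverse h
      exact (hV (hgf ▸ hc.comp_left hg)).elim
  rw [hc0, zero_smul, sub_zero] at hc
  exact hφ f hc

variable [IsScalarTower k A A] [SMulCommClass k A A]

/-- A trace form vanishing on the endomorphisms which factor through a projective module. -/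
lemma exists_trace_form (𝔉 : FrobeniusSystem k A ι) [Module.Finite k V]
    (hV : ¬ FactorsThroughProjective (LinearMap.id : V →ₗ[k] V)) :
    ∃ φ : V →ₗ[k] V, LinearMap.trace k V φ = 1 ∧
      ∀ f, FactorsThroughProjective f → LinearMap.trace k V (φ ∘ₗ f) = 0 := by
  let S : Submodule k (V →ₗ[k] V) :=
    { carrier := {f | FactorsThroughProjective f}
      add_mem' := fun hf hg => 𝔉.factorsThroughProjective_add hf hg
      zero_mem' := by
        have h := (𝔉.factorsThroughProjective_iff (𝔉.hasUnit V) (0 : V →ₗ[k] V)).2 ⟨0, by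
          have h := 𝔉.ltr_smul (𝔉.hasUnit V) 0 (0 : V →ₗ[k] V)
          rwa [zero_smul, zero_smul, eq_comm] at h⟩
        exact h
      smul_mem' := fun c f hf => hf.smul c }
  -- A functional separating the identity from the maps that factor through projectives is a trace
  -- form; it is rescaled to take the value 1 at the identity.
  obtain ⟨l, hl, hS⟩ := Submodule.exists_le_ker_of_notMem (p := S) hV
  obtain ⟨φ, hφ⟩ := LinearMap.exists_trace_comp_eq l
  have h1 := hφ LinearMap.id
  rw [LinearMap.comp_id] at h1
  refine ⟨(l LinearMap.id)⁻¹ • φ, ?_, fun f hf => ?_⟩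
  · rw [map_smul, ← h1, smul_eq_mul, inv_mul_cancel₀ hl]
  · rw [LinearMap.smul_comp, map_smul, ← hφ, LinearMap.mem_ker.1 (hS hf), smul_zero]

/-- A stably scalar indecomposable non-projective module has a right almost split map whose kernel
has an equivalent deformation functor. -/
lemma exists_isRightAlmostSplit (𝔉 : FrobeniusSystem k A ι) [Module.Finite k V]
    (hi : V.IsIndecomposable) (hs : V.IsStablyScalar)
    (hV : ¬ FactorsThroughProjective (LinearMap.id : V →ₗ[k] V)) :
    ∃ (K E : NUModule k A k) (f : K →ₗ[k] E) (g : E →ₗ[k] V), Module.Finite k E ∧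
      IsHom f ∧ Function.Injective f ∧ LinearMap.range f = LinearMap.ker g ∧
      IsRightAlmostSplit g ∧ K.IsStablyScalar ∧ DeformationEquivalent V K := by
  have hVu := 𝔉.hasUnit V
  -- `W` is the Nakayama twist of `V`. The sequence to be built starts at `K₀`, obtained from `W` by
  -- taking two kernels of surjections from projectives, as the second syzygy of the twist.
  let W : NUModule k A k := V.twist 𝔉.mu 𝔉.mu_mul
  let ν : V ≃ₗ[k] W := LinearEquiv.refl k V
  have hν : ∀ a v, ν (V.act (𝔉.mu a) v) = W.act a (ν v) := fun _ _ => rfl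
  clear_value ν W
  have hWf : Module.Finite k W := Module.Finite.equiv ν
  have hWu := 𝔉.hasUnit W
  obtain ⟨F, p, hF, hp, hps⟩ := 𝔉.exists_projective_cover_map W
  have hFf := hF.1
  have hFu := 𝔉.hasUnit F
  obtain ⟨K₁, i, hiA, hii, hip⟩ := hp.exists_kernel hFu
  have hK₁f : Module.Finite k K₁ := Module.Finite.of_injective i hii
  have hK₁u := 𝔉.hasUnit K₁
  obtain ⟨P, q, hP, hq, hqs⟩ := 𝔉.exists_projective_cover_map K₁
  have hPf := hP.1
  have hPu := 𝔉.hasUnit P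
  obtain ⟨K₀, i₀, hi₀, hi₀i, hi₀q⟩ := hq.exists_kernel hPu
  have hmem : ∀ m, p m = 0 → m ∈ LinearMap.range i := fun m hm => hip ▸ hm
  have hpi : p ∘ₗ i = 0 := LinearMap.ext fun x => by
    have h : i x ∈ LinearMap.ker p := hip ▸ ⟨x, rfl⟩
    exact h
  obtain ⟨σ, hσ, hσ₀⟩ := 𝔉.exists_trace_form hV
  let φ : V →ₗ[k] W := ν.toLinearMap ∘ₗ σ
  have hνφ : ∀ f : V →ₗ[k] V, ν.symm.toLinearMap ∘ₗ φ ∘ₗ f = σ ∘ₗ f := fun f =>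
    LinearMap.ext fun v => ν.symm_apply_apply _
  -- By adjointness the trace of `φ` pairs with `ζ` as `σ` pairs with the trace of `ζ`, and the
  -- latter factors through a projective.
  have hφ : 𝔉.ltr φ hVu = 0 := by
    have h1 : ν.symm.toLinearMap ∘ₗ 𝔉.ltr φ hVu = 0 := by
      refine LinearMap.eq_zero_of_trace_comp_eq_zero _ fun ζ => ?_
      rw [LinearMap.comp_assoc, 𝔉.trace_ltr_comp ν hν hVu hVu, hνφ]
      exact hσ₀ _ ((𝔉.factorsThroughProjective_iff hVu _).2 ⟨ζ, rfl⟩)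
    refine LinearMap.ext fun v => ν.symm.injective ?_
    rw [LinearMap.zero_apply, map_zero]
    exact DFunLike.congr_fun h1 v
  obtain ⟨j, hj⟩ := p.exists_rightInverse_of_surjective (LinearMap.range_eq_top.2 hps)
  have hpj : ∀ (Y : NUModule k A k) (θ : Y →ₗ[k] W), p ∘ₗ j ∘ₗ θ = θ := fun Y θ => by
    rw [← LinearMap.comp_assoc, hj, LinearMap.id_comp]
  -- Since `φ` has trace zero, the trace of its linear lift `j φ` takes values in `K₁`; thus `h` is
  -- the image of `φ` under a connecting map.
  obtain ⟨h, hh, hih⟩ := hiA.exists_factor_mono (f := 𝔉.ltr (j ∘ₗ φ) hVu) hii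
    (𝔉.ltr_isHom _ hVu hFu) fun x => hmem _ (by
      have h1 := 𝔉.ltr_comp_left hVu hp (j ∘ₗ φ)
      rw [hpj, hφ] at h1
      exact (DFunLike.congr_fun h1 x).symm)
  -- If `h` lifted to `P`, then `φ` would have a linear lift to `F` of trace zero, and adjointness
  -- would give trace 0 for `σ` instead of 1.
  have hnot : ∀ η : V →ₗ[k] P, IsHom η → q ∘ₗ η ≠ h := by
    intro η hη he
    obtain ⟨ψ, hψ⟩ := 𝔉.exists_eq_ltr_of_target hVu hP η hη
    obtain ⟨π, hπ⟩ := 𝔉.exists_eq_ltr_of_source hFu hF p hp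
    have h1 : 𝔉.ltr (j ∘ₗ φ - (i ∘ₗ q) ∘ₗ ψ) hVu = 0 := by
      rw [𝔉.ltr_sub hVu, 𝔉.ltr_comp_left hVu (hiA.comp hq), ← hψ, ← hih, LinearMap.comp_assoc,
        he, sub_self]
    have h2 : p ∘ₗ (j ∘ₗ φ - (i ∘ₗ q) ∘ₗ ψ) = φ := by
      rw [LinearMap.comp_sub, hpj, LinearMap.comp_assoc, ← LinearMap.comp_assoc _ i p, hpi,
        LinearMap.zero_comp, sub_zero]
    have h3 := 𝔉.trace_ltr_comp ν hν hFu hVu π (j ∘ₗ φ - (i ∘ₗ q) ∘ₗ ψ)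
    rw [h1, ← hπ, h2, LinearMap.comp_zero, LinearMap.comp_zero, map_zero] at h3
    have h4 := hνφ LinearMap.id
    rw [LinearMap.comp_id, LinearMap.comp_id] at h4
    rw [h4, hσ] at h3
    exact one_ne_zero h3
  have hlift : ∀ (X : NUModule k A k) (x : X →ₗ[k] V), Module.Finite k X → IsHom x →
      ¬ IsSplitEpi x → ∃ η : X →ₗ[k] P, IsHom η ∧ q ∘ₗ η = h ∘ₗ x := by
    intro X x hX hx hxs
    have hXu := 𝔉.hasUnit X
    -- The maps `θ` for which `j θ` has the same trace as some map into `K₁`. For `φ x` this says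
    -- that `h x` factors through a projective.
    let S : Submodule k (X →ₗ[k] W) :=
      { carrier := {θ | ∃ κ : X →ₗ[k] K₁, 𝔉.ltr (j ∘ₗ θ) hXu = 𝔉.ltr (i ∘ₗ κ) hXu}
        add_mem' := by
          rintro θ θ' ⟨κ, e⟩ ⟨κ', e'⟩
          refine ⟨κ + κ', ?_⟩
          rw [LinearMap.comp_add, LinearMap.comp_add, 𝔉.ltr_add, 𝔉.ltr_add, e, e']
        zero_mem' := ⟨0, by rw [LinearMap.comp_zero, LinearMap.comp_zero]⟩
        smul_mem' := by
          rintro c θ ⟨κ, e⟩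
          refine ⟨c • κ, ?_⟩
          rw [LinearMap.comp_smul, LinearMap.comp_smul, 𝔉.ltr_smul, 𝔉.ltr_smul, e] }
    -- By `ltr_act_comp` the two terms would cancel after lifting if `j` commuted with `b`; the
    -- failure of this takes values in `K₁`.
    have hS : ∀ (ψ : X →ₗ[k] W) (b : A), W.act b ∘ₗ ψ - ψ ∘ₗ X.act (𝔉.mu b) ∈ S := by
      intro ψ b
      have h1 : ∀ w, (j ∘ₗ W.act b - F.act b ∘ₗ j) w ∈ LinearMap.range i := fun w => hmem _ (by
        have hj' : ∀ w, p (j w) = w := fun w => DFunLike.congr_fun hj w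
        change p (j (W.act b w) - F.act b (j w)) = 0
        rw [map_sub, hj', hp, hj', sub_self])
      obtain ⟨r, hr⟩ := i.exists_leftInverse_of_injective (LinearMap.ker_eq_bot.2 hii)
      refine ⟨r ∘ₗ (j ∘ₗ W.act b - F.act b ∘ₗ j) ∘ₗ ψ, ?_⟩
      have h2 : i ∘ₗ r ∘ₗ (j ∘ₗ W.act b - F.act b ∘ₗ j) ∘ₗ ψ =
          (j ∘ₗ W.act b - F.act b ∘ₗ j) ∘ₗ ψ := LinearMap.ext fun m => by
        obtain ⟨n, hn⟩ := h1 (ψ m)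
        change i (r ((j ∘ₗ W.act b - F.act b ∘ₗ j) (ψ m))) = (j ∘ₗ W.act b - F.act b ∘ₗ j) (ψ m)
        rw [← hn]
        exact congrArg i (DFunLike.congr_fun hr n)
      have h3 := 𝔉.ltr_act_comp hXu hFu (j ∘ₗ ψ) b
      rw [h2, LinearMap.comp_sub, LinearMap.sub_comp, 𝔉.ltr_sub, 𝔉.ltr_sub, LinearMap.comp_assoc,
        LinearMap.comp_assoc, h3, LinearMap.comp_assoc]
    -- A functional separating `φ x` from `S` is a trace form given by some `g`, and its vanishing
    -- on the elements of `hS` makes `g` a homomorphism `V → X`. Now `x g` is not bijective, as `x`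
    -- does not split, so `σ` kills it and the functional vanishes at `φ x`, a contradiction.
    have hmemS : φ ∘ₗ x ∈ S := by
      by_contra hn
      obtain ⟨l, hl, hSl⟩ := Submodule.exists_le_ker_of_notMem (p := S) hn
      obtain ⟨g, hg⟩ := LinearMap.exists_trace_comp_eq l
      have hgA : ∀ b, g ∘ₗ W.act b - X.act (𝔉.mu b) ∘ₗ g = 0 := fun b => by
        refine LinearMap.eq_zero_of_trace_comp_eq_zero _ fun ψ => ?_
        have h1 : l (W.act b ∘ₗ ψ - ψ ∘ₗ X.act (𝔉.mu b)) = 0 := hSl (hS ψ b)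
        rw [hg, LinearMap.comp_sub, map_sub, ← LinearMap.comp_assoc _ ψ g,
          LinearMap.trace_comp_comm' (X.act (𝔉.mu b))] at h1
        rw [LinearMap.sub_comp, map_sub, LinearMap.comp_assoc, LinearMap.comp_assoc]
        exact h1
      let g' : V →ₗ[k] X := g ∘ₗ ν.toLinearMap
      have hg' : IsHom g' := fun a v => by
        obtain ⟨a, rfl⟩ := 𝔉.mu.surjective a
        change g (ν (V.act (𝔉.mu a) v)) = X.act (𝔉.mu a) (g (ν v))
        rw [hν]
        exact sub_eq_zero.1 (DFunLike.congr_fun (hgA a) (ν v))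
      have hb : ¬ Function.Bijective (x ∘ₗ g') := fun hb => by
        obtain ⟨s, hs, -, hs'⟩ := IsHom.exists_inverse (hx.comp hg') hb
        exact hxs ⟨g' ∘ₗ s, hg'.comp hs, by rw [← LinearMap.comp_assoc, hs']⟩
      have h1 := 𝔉.trace_comp_eq_zero hi hs hV hσ₀ (hx.comp hg') hb
      refine hl ?_
      rw [hg, LinearMap.trace_comp_comm']
      have h2 : (φ ∘ₗ x) ∘ₗ g = (ν.toLinearMap ∘ₗ σ ∘ₗ x ∘ₗ g') ∘ₗ ν.symm.toLinearMap :=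
        LinearMap.ext fun w => by
          change ν (σ (x (g w))) = ν (σ (x (g (ν (ν.symm w)))))
          rw [LinearEquiv.apply_symm_apply]
      have h3 : ν.symm.toLinearMap ∘ₗ ν.toLinearMap ∘ₗ σ ∘ₗ x ∘ₗ g' = σ ∘ₗ x ∘ₗ g' :=
        LinearMap.ext fun v => ν.symm_apply_apply _
      rw [h2, LinearMap.trace_comp_comm', h3, h1]
    obtain ⟨κ, hκ⟩ := hmemS
    have h1 : h ∘ₗ x = 𝔉.ltr κ hXu := by
      rw [𝔉.ltr_comp_left hXu hiA, ← LinearMap.comp_assoc, 𝔉.ltr_comp_right hXu hVu hx, ← hih] at hκ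
      exact LinearMap.ext fun m => hii (DFunLike.congr_fun hκ m)
    exact ((𝔉.factorsThroughProjective_iff hXu _).2 ⟨κ, h1⟩).exists_lift hq hqs
  -- `E` is the pullback of `h` and `q`: a map to `V` factors through it exactly when its composite
  -- with `h` lifts to `P`.
  obtain ⟨E, e, he, hei, her⟩ := exists_sub (M := V.prod P) (𝔉.hasUnit (V.prod P))
    (LinearMap.ker (h ∘ₗ LinearMap.fst k V P - q ∘ₗ LinearMap.snd k V P)) fun a x hx => by
      have h1 : h x.1 - q x.2 = 0 := hx
      change h (V.act a x.1) - q (P.act a x.2) = 0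
      rw [hh, hq, ← map_sub, h1, map_zero]
  have hmemE : ∀ (v : V) (m : P), h v = q m → ((v, m) : V × P) ∈ LinearMap.range e :=
    fun v m hvm => by
      rw [her]
      exact sub_eq_zero.2 hvm
  have heE : ∀ z, h (e z : V × P).1 = q (e z : V × P).2 := fun z => by
    have h1 : e z ∈ LinearMap.ker (h ∘ₗ LinearMap.fst k V P - q ∘ₗ LinearMap.snd k V P) :=
      her ▸ ⟨z, rfl⟩
    exact sub_eq_zero.1 h1
  have hEf : Module.Finite k E := Module.Finite.of_injective e hei
  have hqi₀ : ∀ x, q (i₀ x) = 0 := fun x => by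
    have h1 : i₀ x ∈ LinearMap.ker q := hi₀q ▸ ⟨x, rfl⟩
    exact h1
  obtain ⟨f, hf, hef⟩ := he.exists_factor_mono (f := LinearMap.inr k V P ∘ₗ i₀) hei
    (IsHom.comp (isHom_inr V P) hi₀) fun x => hmemE 0 (i₀ x) (by rw [map_zero, hqi₀])
  have hef' : ∀ x, e (f x) = ((0, i₀ x) : V × P) := fun x => DFunLike.congr_fun hef x
  let g : E →ₗ[k] V := LinearMap.fst k V P ∘ₗ e
  have hg : IsHom g := IsHom.comp (isHom_fst V P) he
  refine ⟨K₀, E, f, g, hEf, hf, fun x y hxy => hi₀i ?_, le_antisymm ?_ ?_, ⟨hg, ?_, ?_⟩, ?_, ?_⟩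
  · have h1 := (hef' x).symm.trans ((congrArg e hxy).trans (hef' y))
    exact congrArg Prod.snd h1
  · rintro _ ⟨x, rfl⟩
    exact congrArg Prod.fst (hef' x)
  · intro z hz
    have h1 : (e z : V × P).1 = 0 := hz
    have h2 : (e z : V × P).2 ∈ LinearMap.range i₀ := by
      rw [hi₀q, LinearMap.mem_ker, ← heE, h1, map_zero]
    obtain ⟨x, hx⟩ := h2
    exact ⟨x, hei ((hef' x).trans (Prod.ext h1.symm hx))⟩
  · rintro ⟨s, hs', hgs⟩
    refine hnot (LinearMap.snd k V P ∘ₗ e ∘ₗ s) (IsHom.comp (isHom_snd V P) (he.comp hs'))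
      (LinearMap.ext fun v => ?_)
    exact (heE (s v)).symm.trans (congrArg h (DFunLike.congr_fun hgs v))
  · intro X x hX hx hxs
    obtain ⟨η, hη, hqη⟩ := hlift X x hX hx hxs
    let z : X →ₗ[k] V.prod P := LinearMap.prod x η
    have hz : IsHom z := fun a m => by
      change (x (X.act a m), η (X.act a m)) = (V.act a (x m), P.act a (η m))
      rw [hx, hη]
    obtain ⟨t, ht, het⟩ := he.exists_factor_mono hei hz fun m =>
      hmemE _ _ (DFunLike.congr_fun hqη m).symm
    exact ⟨t, ht, LinearMap.ext fun m => congrArg Prod.fst (DFunLike.congr_fun het m)⟩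
  · exact 𝔉.isStablyScalar_kernel (𝔉.isStablyScalar_kernel (hs.of_twist 𝔉.mu 𝔉.mu_mul ν hν)
      hF hiA hp hii hip hps) hP hi₀ hq hi₀i hi₀q hqs
  · exact ((DeformationEquivalent.of_twist 𝔉.mu 𝔉.mu_mul ν hν).trans
      (𝔉.deformationEquivalent_kernel hF hiA hp hii hip hps)).trans
      (𝔉.deformationEquivalent_kernel hP hi₀ hq hi₀i hi₀q hqs)

/-- The Auslander-Reiten translate of a stably scalar indecomposable non-projective module exists
and has an equivalent deformation functor. -/
theorem exists_isARTranslate (𝔉 : FrobeniusSystem k A ι) [Module.Finite k V]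
    (hi : V.IsIndecomposable) (hs : V.IsStablyScalar)
    (hV : ¬ FactorsThroughProjective (LinearMap.id : V →ₗ[k] V)) :
    ∃ T : NUModule k A k, T.IsARTranslate V ∧
      ∀ T' : NUModule k A k, T'.IsARTranslate V → DeformationEquivalent V T' := by
  obtain ⟨K, E₀, f₀, g₀, hE₀, hf₀, hf₀i, hf₀g, hg₀, hKs, hVK⟩ :=
    𝔉.exists_isRightAlmostSplit hi hs hV
  obtain ⟨E, g, hE, hg, hmin⟩ := exists_minimal_right_almost_split (V := V)
    (fun E _ => 𝔉.hasUnit E) ⟨E₀, g₀, hE₀, hg₀⟩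
  obtain ⟨T, f, hf, hfi, hfg⟩ := hg.1.exists_kernel (𝔉.hasUnit E)
  have hTf : Module.Finite k T := Module.Finite.of_injective f hfi
  have hKf : Module.Finite k K := Module.Finite.of_injective f₀ hf₀i
  -- As the identity of `V` does not factor through a projective, a surjection from a projective
  -- does not split and hence factors through `g`.
  have hgs : Function.Surjective g := by
    obtain ⟨F, p, hF, hp, hps⟩ := 𝔉.exists_projective_cover_map V
    have hpn : ¬ IsSplitEpi p := by
      rintro ⟨s, hs, hps⟩
      exact hV ⟨F, s, p, hF, hs, hp, hps.symm⟩
    obtain ⟨l, -, hl⟩ := hg.2.2 F p hF.1 hp hpn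
    intro v
    obtain ⟨m, rfl⟩ := hps v
    exact ⟨l m, DFunLike.congr_fun hl m⟩
  have hfl := isLeftAlmostSplit_of_minimal hf hfi hfg hgs hg hmin
  obtain ⟨-, t, s, -, ht, hs', -, -, hts⟩ :=
    exists_retract_kernel hf hfi hfg hg hmin hf₀ hf₀i hf₀g hg₀
  obtain ⟨Z, j, r, e, hj, hr, hrs, hrj, he⟩ := exists_complement (𝔉.hasUnit K) hs' ht hts
  -- The idempotent `s t` of `K` is a scalar `c` modulo maps through projectives. If `c = 1`, the
  -- complement `Z` of `T` is projective. Any other value would make `T` projective, and then `f`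
  -- would split.
  have hZ : Z.IsProjective := by
    obtain ⟨c, hc⟩ := hKs (s ∘ₗ t) (hs'.comp ht)
    by_cases hc1 : c = 1
    · subst hc1
      have h1 := ((hc.comp_right hj).comp_left hr).smul (-1)
      have h2 : (-1 : k) • r ∘ₗ ((s ∘ₗ t) - (1 : k) • LinearMap.id) ∘ₗ j = LinearMap.id :=
        LinearMap.ext fun z => by
          have h3 := DFunLike.congr_fun hrs (t (j z))
          have h4 := DFunLike.congr_fun hrj z
          change r (s (t (j z))) = 0 at h3
          change r (j z) = z at h4
          change (-1 : k) • r (s (t (j z)) - (1 : k) • j z) = z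
          rw [map_sub, h3, one_smul, h4, zero_sub, neg_smul, one_smul, neg_neg]
      rw [h2] at h1
      exact isProjective_of_factors_id h1
    · exfalso
      have h1 := ((hc.comp_right hs').comp_left ht).smul (1 - c)⁻¹
      have h2 : (1 - c)⁻¹ • t ∘ₗ ((s ∘ₗ t) - c • LinearMap.id) ∘ₗ s = LinearMap.id :=
        LinearMap.ext fun x => by
          have h3 : ∀ y, t (s y) = y := fun y => DFunLike.congr_fun hts y
          change (1 - c)⁻¹ • t (s (t (s x)) - c • s x) = x
          have h4 : x - c • x = (1 - c) • x := by rw [sub_smul, one_smul]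
          rw [map_sub, map_smul, h3, h3, h4, smul_smul,
            inv_mul_cancel₀ (sub_ne_zero.2 (Ne.symm hc1)), one_smul]
      rw [h2] at h1
      exact hfl.2.1 (𝔉.isSplitMono_of_isProjective (isProjective_of_factors_id h1) hf hfi)
  have hVT : DeformationEquivalent V T :=
    (hVK.trans (DeformationEquivalent.of_iso e he).symm).trans
      (𝔉.deformationEquivalent_prod hZ).symm
  refine ⟨T, ⟨E, f, g, hTf, hE, inferInstance, hfi, hfg, hgs, hfl, hg⟩, fun T' hT' => ?_⟩
  obtain ⟨a, ha⟩ := hT'.exists_equiv hf hfi hfg hg hmin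
  exact hVT.trans (DeformationEquivalent.of_iso a ha).symm

end FrobeniusSystem

/-! ### Versal deformation rings over the repetitive algebra -/

theorem theorem1p1 {k : Type u} [Field k] [IsAlgClosed k]
    {Λ : Type v} [Ring Λ] [Algebra k Λ] [Module.Finite k Λ] (hΛ : IsBasicAlgebra k Λ)
    (V : NUModule k (RepetitiveAlgebra k Λ) k) (hV : Module.Finite k V) :
    -- the versal deformation ring exists and is unique up to isomorphism
    (∃ (R : CompleteLocalAlgebra k) (U : Def V R), IsVersal V R U ∧
      ∀ (R' : CompleteLocalAlgebra k) (U' : Def V R'), IsVersal V R' U' →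
        Nonempty (R ≃ₐ[k] R')) ∧
    (Nonempty (V.StableEnd ≃ₐ[k] k) →
      -- the versal deformation ring of `V` is universal
      (∀ (R : CompleteLocalAlgebra k) (U : Def V R), IsVersal V R U → IsUniversal V R U) ∧
      -- adding a finite dimensional projective module
      (∀ P : NUModule k (RepetitiveAlgebra k Λ) k, P.IsProjective →
        ∀ (R : CompleteLocalAlgebra k) (U : Def V R), IsVersal V R U →
          ∀ (R' : CompleteLocalAlgebra k) (U' : Def (V.prod P) R'), IsVersal (V.prod P) R' U' →
            IsUniversal (V.prod P) R' U' ∧ Nonempty (R' ≃ₐ[k] R)) ∧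
      -- the syzygy
      ((∃ K : NUModule k (RepetitiveAlgebra k Λ) k, K.IsSyzygy V) ∧
        ∀ K : NUModule k (RepetitiveAlgebra k Λ) k, K.IsSyzygy V →
          ∀ (R : CompleteLocalAlgebra k) (U : Def V R), IsVersal V R U →
            ∀ (R' : CompleteLocalAlgebra k) (U' : Def K R'), IsVersal K R' U' →
              IsUniversal K R' U' ∧ Nonempty (R' ≃ₐ[k] R)) ∧
      -- the Auslander-Reiten translate
      (V.IsIndecomposable →
        (∃ T : NUModule k (RepetitiveAlgebra k Λ) k, T.IsARTranslate V) ∧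
        ∀ T : NUModule k (RepetitiveAlgebra k Λ) k, T.IsARTranslate V →
          ∀ (R : CompleteLocalAlgebra k) (U : Def V R), IsVersal V R U →
            ∀ (R' : CompleteLocalAlgebra k) (U' : Def T R'), IsVersal T R' U' →
              IsUniversal T R' U' ∧ Nonempty (R' ≃ₐ[k] R))) := by
  let 𝔉 := RepetitiveAlgebra.frobeniusSystem (Module.finBasis k Λ)
  obtain ⟨n, p, ⟨X⟩⟩ := 𝔉.exists_chart V
  obtain ⟨R₀, U₀, h₀, huniv⟩ := X.exists_versal
  refine ⟨⟨R₀, U₀, h₀, fun R' U' h' => h₀.nonempty_algEquiv h'⟩, fun hk => ?_⟩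
  have hs := isStablyScalar_of_stableEnd hk
  have hu : ∃ R₀ U₀, IsUniversal V R₀ U₀ := ⟨R₀, U₀, huniv (𝔉.endomorphismsLift hs)⟩
  refine ⟨fun R U hU => ?_, fun P hP R U hU R' U' hU' => ?_, ⟨𝔉.exists_isSyzygy V, ?_⟩,
    fun hi => ?_⟩
  · exact hU.isUniversal (huniv (𝔉.endomorphismsLift hs))
  · exact (𝔉.deformationEquivalent_prod hP).isUniversal_and_nonempty_algEquiv hu hU hU'
  · rintro K ⟨P, p, i, ⟨hP, hp, hps, -⟩, hi, hii, hip⟩ R U hU R' U' hU'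
    exact (𝔉.deformationEquivalent_kernel hP hi hp hii hip hps).isUniversal_and_nonempty_algEquiv
      hu hU hU'
  · obtain ⟨T, hT, hall⟩ := 𝔉.exists_isARTranslate hi hs (not_factors_id_of_stableEnd hk)
    exact ⟨⟨T, hT⟩, fun T' hT' R U hU R' U' hU' =>
      (hall T' hT').isUniversal_and_nonempty_algEquiv hu hU hU'⟩
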